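/- Fix a dimension $d\ge 1$. Let $\mathcal P=(P_1,\dots,P_n)$, $n\ge 1$, be uncertain points in $\mathbb R^d$: the location of $P_i$ has a probability distribution $\mu_i$ with a density with respect to Lebesgue measure, and $\mu_P=\mu_1\times\dots\times\mu_n$ is the distribution of the random point set $Q=\{q_1,\dots,q_n\}$ with independent $q_i\sim\mu_i$. For a finite non-empty $S\subset\mathbb R^d$ and a unit vector $u$ let $\omega(S,u)=\max_{p\in S}\langle p,u\rangle-\min_{p\in S}\langle p,u\rangle$ be the width of $S$ in direction $u$, and let $F_u(v)=\Pr_{Q\sim\mu_P}[\omega(Q,u)\le v]$. A non-empty $K\subseteq S$ is an $\alpha$-kernel of $S$ if $\omega(S,u)-\omega(K,u)\le\alpha\,\omega(S,u)$ for all unit vectors $u$. A function $h$ is an $(\varepsilon,\alpha)$-quantization of $F_u$ if for every $x\ge 0$ there is $x'\ge 0$ with $|x-x'|\le\alpha x$ and $|h(x)-F_u(x')|\le\varepsilon$. A random family $\mathcal K=\{K_1,\dots,K_m\}$ of finite point sets is an $(\varepsilon,\delta,\alpha)$-kernel for $\mu_P$ if for every unit vector $u$, with probability at least $1-\delta$,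 the function $h_u(x)=\frac1m\,|\{j:\omega(K_j,u)\le x\}|$ is an $(\varepsilon,\alpha)$-quantization of $F_u$. Computation takes place on a real RAM: integer and real memory cells with indirect addressing, unit-cost arithmetic, comparisons, square root and floor, and drawing a fresh independent random point from a given $\mu_i$ at unit cost ($d$ is a constant). **Theorem.** For every $d\ge1$ there is a program for this machine that takes $\varepsilon,\delta,\alpha,n$ as input, has access to $\mu_1,\dots,\mu_n$ only by drawing random points, and has the following property. For every $\delta_0\in(0,1)$ there is a constant $C$, depending only on $d$ and $\delta_0$, such that for all $\varepsilon\in(0,1]$ and $\delta\in(0,\delta_0]$ there is a number $m\ge 1$, $m\le C\,\frac1{\varepsilon^2}\log\frac1\delta$, for which for all $\alpha\in(0,1]$, $n\ge1$ and $\mu_1,\dots,\mu_n$ as above: 1. for all outcomes of the random draws, the program halts after at most $C\,(n+\alpha^{-(d-3/2)})\,\frac1{\varepsilon^2}\log\frac1\delta$ steps; 2. it then outputs $m$ point sets $K_1,\dots,K_m$, where $K_j$ is an $(\alpha/2)$-kernel of $Q_j$, and $Q_1,\dots,Q_m$ are independent random point sets drawn from $\mu_P$ ($Q_j$ consists of the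 $j$-th draw from each $\mu_i$); 3. the total number of points output is at most $C\,\alpha^{-(d-1)/2}\,\frac1{\varepsilon^2}\log\frac1\delta$; 4. $\{K_1,\dots,K_m\}$ is an $(\varepsilon,\delta,\alpha)$-kernel for $\mu_P$: for every unit vector $u$, with probability at least $1-\delta$, the widths $\omega(K_1,u),\dots,\omega(K_m,u)$ form an $(\varepsilon,\alpha)$-quantization of the distribution of the width in direction $u$. -/

import Mathlib

open MeasureTheory

noncomputable section

namespace UncertainPoints

/-- The Euclidean space `ℝ^d`. -/
abbrev Pt (d : ℕ) : Type := EuclideanSpace ℝ (Fin d)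

/-! ### Widths, kernels and quantizations -/

/-- The width of `S` in direction `u`; for a finite non-empty `S` the supremum and the infimum
are a maximum and a minimum. -/
def width {d : ℕ} (S : Set (Pt d)) (u : Pt d) : ℝ :=
  sSup ((fun p : Pt d => inner ℝ p u) '' S) - sInf ((fun p : Pt d => inner ℝ p u) '' S)

/-- `K` is an `α`-kernel of the finite point set `S`. -/
def IsKernel {d : ℕ} (α : ℝ) (K S : Set (Pt d)) : Prop :=
  K ⊆ S ∧ K.Nonempty ∧
    ∀ u : Pt d, ‖u‖ = 1 → width S u - width K u ≤ α * width S u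

/-- `h` describes an `(ε, α)`-quantization of the isotonic function `F` on `[0, ∞)`. -/
def IsQuantization (ε α : ℝ) (h F : ℝ → ℝ) : Prop :=
  ∀ x : ℝ, 0 ≤ x → ∃ x' : ℝ, 0 ≤ x' ∧ |x - x'| ≤ α * x ∧ |h x - F x'| ≤ ε

/-- The law `μ_P` of a random support: one point from each `μ i`, independently. -/
def supportLaw {d n : ℕ} (μ : Fin n → Measure (Pt d)) : Measure (Fin n → Pt d) :=
  Measure.pi μ

/-- The cumulative distribution function of the width in direction `u` of a random support. -/
def widthCDF {d n : ℕ} (μ : Fin n → Measure (Pt d)) (u : Pt d) (v : ℝ) : ℝ :=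
  (supportLaw μ).real {Q | width (Set.range Q) u ≤ v}

/-- The function `h_M` of the multiset `M = {width (K j) u}`, `j < m`: the fraction of the
values that are at most `x`. -/
def widthFraction {d : ℕ} (m : ℕ) (K : ℕ → Set (Pt d)) (u : Pt d) (x : ℝ) : ℝ :=
  (Set.ncard {j : ℕ | j < m ∧ width (K j) u ≤ x} : ℝ) / m

/-- The outcomes of all random draws: `ω k i` is the `k`-th draw from `μ i`. -/
abbrev Draws (d n : ℕ) : Type := ℕ → Fin n → Pt d

/-- All draws are independent, the draws `ω k i` have law `μ i`; so the rows `ω 0, ω 1, …` are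
independent supports with law `μ_P`. -/
def drawLaw {d n : ℕ} (μ : Fin n → Measure (Pt d)) [∀ i, IsProbabilityMeasure (μ i)] :
    Measure (Draws d n) :=
  Measure.infinitePi fun _ : ℕ => Measure.pi μ

/-- The random family `K ω 0, …, K ω (m - 1)` of point sets is an `(ε, δ, α)`-kernel: for every
direction `u`, the widths `width (K ω j) u` form an `(ε, α)`-quantization of the distribution of
the width in direction `u`, except with probability at most `δ`. -/
def IsProbKernel {d n : ℕ} (μ : Fin n → Measure (Pt d)) [∀ i, IsProbabilityMeasure (μ i)]
    (ε δ α : ℝ) (m : ℕ) (K : Draws d n → ℕ → Set (Pt d)) : Prop :=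
  ∀ u : Pt d, ‖u‖ = 1 →
    drawLaw μ {ω | ¬ IsQuantization ε α (widthFraction m (K ω) u) (widthCDF μ u)}
      ≤ ENNReal.ofReal δ

/-! ### A real RAM that can draw random points

The machine has an integer memory and a real memory, both addressed indirectly by integers, with
unit-cost arithmetic, comparisons, square root and floor, an instruction that draws a fresh
random point from one of the `n` distributions, and an output consisting of finite lists of
points. Programs are structured; every operation in an expression and every executed instruction
or test is charged. -/

/-- Integer expressions; `load a` is the content of the integer cell with address `a`. -/
inductive IExp : Type
  | const (z : ℤ)
  | load (a : IExp)
  | add (e f : IExp)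
  | sub (e f : IExp)
  | mul (e f : IExp)

/-- Real expressions; `load a` is the content of the real cell with address `a`. -/
inductive RExp : Type
  | ofInt (e : IExp)
  | load (a : IExp)
  | add (e f : RExp)
  | sub (e f : RExp)
  | mul (e f : RExp)
  | div (e f : RExp)
  | sqrt (e : RExp)

/-- Tests. -/
inductive Test : Type
  | intLe (e f : IExp)
  | realLe (e f : RExp)
  | neg (b : Test)
  | and (b c : Test)

/-- Programs. -/
inductive Prog : Type
  | skip
  /-- store the integer `e` in integer cell `a` -/
  | setInt (a e : IExp)
  /-- store the real `e` in real cell `a` -/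
  | setReal (a : IExp) (e : RExp)
  /-- store the floor of `e` in integer cell `a` -/
  | setFloor (a : IExp) (e : RExp)
  /-- draw a fresh point from distribution number `i`, and store its `d` coordinates in the real
  cells `a, a + 1, …, a + d - 1` -/
  | draw (i a : IExp)
  /-- start a new, empty output list -/
  | newSet
  /-- append the point whose `d` coordinates stand in the real cells `a, a + 1, …, a + d - 1` to
  the output list started last -/
  | emit (a : IExp)
  | seq (p q : Prog)
  | ite (b : Test) (p q : Prog)
  | while (b : Test) (p : Prog)

/-- A state of the machine: the two memories, how many points have been drawn from each
distribution, and the output lists `out 0, …, out (outLen - 1)`. -/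
structure State (d n : ℕ) where
  imem : ℤ → ℤ
  rmem : ℤ → ℝ
  drawn : Fin n → ℕ
  outLen : ℕ
  out : ℕ → List (Pt d)

def IExp.eval (m : ℤ → ℤ) : IExp → ℤ
  | .const z => z
  | .load a => m (a.eval m)
  | .add e f => e.eval m + f.eval m
  | .sub e f => e.eval m - f.eval m
  | .mul e f => e.eval m * f.eval m

def RExp.eval (m : ℤ → ℤ) (r : ℤ → ℝ) : RExp → ℝ
  | .ofInt e => (e.eval m : ℝ)
  | .load a => r (a.eval m)
  | .add e f => e.eval m r + f.eval m r
  | .sub e f => e.eval m r - f.eval m r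
  | .mul e f => e.eval m r * f.eval m r
  | .div e f => e.eval m r / f.eval m r
  | .sqrt e => Real.sqrt (e.eval m r)

def Test.holds (m : ℤ → ℤ) (r : ℤ → ℝ) : Test → Prop
  | .intLe e f => e.eval m ≤ f.eval m
  | .realLe e f => e.eval m r ≤ f.eval m r
  | .neg b => ¬ b.holds m r
  | .and b c => b.holds m r ∧ c.holds m r

def IExp.cost : IExp → ℕ
  | .const _ => 1
  | .load a => a.cost + 1
  | .add e f => e.cost + f.cost + 1
  | .sub e f => e.cost + f.cost + 1
  | .mul e f => e.cost + f.cost + 1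

def RExp.cost : RExp → ℕ
  | .ofInt e => e.cost + 1
  | .load a => a.cost + 1
  | .add e f => e.cost + f.cost + 1
  | .sub e f => e.cost + f.cost + 1
  | .mul e f => e.cost + f.cost + 1
  | .div e f => e.cost + f.cost + 1
  | .sqrt e => e.cost + 1

def Test.cost : Test → ℕ
  | .intLe e f => e.cost + f.cost + 1
  | .realLe e f => e.cost + f.cost + 1
  | .neg b => b.cost + 1
  | .and b c => b.cost + c.cost + 1

/-- The point whose coordinates stand in the real cells `a, …, a + d - 1`. -/
def loadPoint {d : ℕ} (r : ℤ → ℝ) (a : ℤ) : Pt d :=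
  WithLp.toLp 2 fun k : Fin d => r (a + (k : ℕ))

/-- Store the coordinates of `p` in the real cells `a, …, a + d - 1`. -/
def storePoint {d : ℕ} (r : ℤ → ℝ) (a : ℤ) (p : Pt d) : ℤ → ℝ := fun z =>
  if h : a ≤ z ∧ (z - a).toNat < d then p ⟨(z - a).toNat, h.2⟩ else r z

/-- `Exec ω p s s' t`: with the outcomes `ω` of the random draws, the program `p`, started in
state `s`, halts in state `s'` after `t` steps. -/
inductive Exec {d n : ℕ} (ω : Draws d n) : Prog → State d n → State d n → ℕ → Prop
  | skip (s : State d n) : Exec ω .skip s s 1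
  | setInt (s : State d n) (a e : IExp) :
      Exec ω (.setInt a e) s
        { s with imem := Function.update s.imem (a.eval s.imem) (e.eval s.imem) }
        (a.cost + e.cost + 1)
  | setReal (s : State d n) (a : IExp) (e : RExp) :
      Exec ω (.setReal a e) s
        { s with rmem := Function.update s.rmem (a.eval s.imem) (e.eval s.imem s.rmem) }
        (a.cost + e.cost + 1)
  | setFloor (s : State d n) (a : IExp) (e : RExp) :
      Exec ω (.setFloor a e) s
        { s with imem := Function.update s.imem (a.eval s.imem) ⌊e.eval s.imem s.rmem⌋ }
        (a.cost + e.cost + 1)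
  | draw (s : State d n) (i a : IExp) (k : Fin n) (hk : i.eval s.imem = ((k : ℕ) : ℤ)) :
      Exec ω (.draw i a) s
        { s with
          rmem := storePoint s.rmem (a.eval s.imem) (ω (s.drawn k) k)
          drawn := Function.update s.drawn k (s.drawn k + 1) }
        (i.cost + a.cost + d + 1)
  | newSet (s : State d n) :
      Exec ω .newSet s
        { s with outLen := s.outLen + 1, out := Function.update s.out s.outLen [] } 1
  | emit (s : State d n) (a : IExp) (j : ℕ) (hj : s.outLen = j + 1) :
      Exec ω (.emit a) s
        { s with
          out := Function.update s.out j (s.out j ++ [loadPoint s.rmem (a.eval s.imem)]) }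
        (a.cost + d + 1)
  | seq {p q : Prog} {s s' s'' : State d n} {t t' : ℕ} :
      Exec ω p s s' t → Exec ω q s' s'' t' → Exec ω (.seq p q) s s'' (t + t')
  | iteTrue {b : Test} {p q : Prog} {s s' : State d n} {t : ℕ} :
      b.holds s.imem s.rmem → Exec ω p s s' t → Exec ω (.ite b p q) s s' (b.cost + t + 1)
  | iteFalse {b : Test} {p q : Prog} {s s' : State d n} {t : ℕ} :
      ¬ b.holds s.imem s.rmem → Exec ω q s s' t → Exec ω (.ite b p q) s s' (b.cost + t + 1)
  | whileTrue {b : Test} {p : Prog} {s s' s'' : State d n} {t t' : ℕ} :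
      b.holds s.imem s.rmem → Exec ω p s s' t → Exec ω (.while b p) s' s'' t' →
        Exec ω (.while b p) s s'' (b.cost + t + t' + 1)
  | whileFalse {b : Test} {p : Prog} {s : State d n} :
      ¬ b.holds s.imem s.rmem → Exec ω (.while b p) s s (b.cost + 1)

/-- The initial state: integer cell `0` holds `n`, the real cells `0, 1, 2` hold `ε, δ, α`, all
other cells hold `0`, nothing has been drawn, and there is no output. -/
def initState (d n : ℕ) (ε δ α : ℝ) : State d n where
  imem := fun z => if z = 0 then (n : ℤ) else 0
  rmem := fun z => if z = 0 then ε else if z = 1 then δ else if z = 2 then α else 0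
  drawn := fun _ => 0
  outLen := 0
  out := fun _ => []

/-- The `j`-th output set. -/
def State.outSet {d n : ℕ} (s : State d n) (j : ℕ) : Set (Pt d) := {p | p ∈ s.out j}

end UncertainPoints

end

open UncertainPoints

/-! The geometry (a small kernel of each drawn support) and the statistics (how many supports are
needed) are independent. The program runs `rounds 128 ε δ` identical rounds; round `j` draws one
support and outputs an `(α/2)`-kernel of it.

Geometry. Let `D = d - 1`. Gaussian elimination with pivoting writes the points, relative to the
first one, as combinations of vectors `r j` with coefficients `w` in `[-1, 1]`, and a functional
whose variation on the points is `W` takes values at most `2 ^ j * W` on `r j` (`Eliminated.step`,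
`Eliminated.coeff_le`). An additive error in the cube therefore becomes an error relative to the
width. After scaling, a direction has one coordinate `s = ±1`, in position `a`, and the others form
some `x` in `[-1, 1]^D`. Write `w'` for the coordinates other than `a`. For each point `y` of a grid
of `E ^ D` points in `[-2, 2]^D`, keep a point of the support maximising `s * w a - |w'|² / 2 + ⟨y,
w'⟩`. If `y` is `w' + x + e` for a point `p`, completing the square shows that the maximiser for `y`
loses at most `|e|² / 2` against `p` in direction `x` (`grid_coord`). The grid spacing thus enters
squared, so `E` of order `α^(-1/2)` suffices and `O(α^(-(d-1)/2))` points are output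
(`Eliminated.isKernel`).

Running time. The maximum is computed for all grid points together, one coordinate at a time. The
objective is a sum over the coordinates, so among items that agree in the coordinates still to come
and in the grid coordinates already chosen only the best matters (`wp_stages_aux`). One stage is an
upper envelope of lines, evaluated at `E` integers, in every column of such items; it is linear once
the slopes are sorted (`wp_push`, `wp_stage`). To sort by two bucket passes, the coordinates are
rounded to `E²` cells in the linear term, which costs another `O(E^(-2))`. The first stage has
`E^(2D-2)` columns with at most `E` results each, and this number `E^(2D-1)`, of order
`α^(-(d-3/2))`, dominates.

Statistics. For a fixed direction the widths of the supports are independent with distribution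
function `F`. A bound of Dvoretzky–Kiefer–Wolfowitz type (`infinitePi_exists_empirical_far_le`),
from symmetrisation and a maximal inequality for random signs, makes their empirical distribution
function `G` uniformly `ε`-close to `F`. A kernel has between `1 - α/2` and `1` times the width of
its support, so the fraction `h x` computed from the kernels lies between `G x` and `G ((1 + α) *
x)`. Since the laws have densities, `F` is continuous on `(0, ∞)`, and the intermediate value
theorem provides the point `x'` (`isQuantization_of_empirical`).

Charges. A weakest-precondition calculus counts executed instructions and tests; the true cost
exceeds this count by at most a factor depending on the program text only. -/

noncomputable section

namespace UncertainPoints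

variable {d n : ℕ}

/-! ### Named variables and arrays -/

/-- Names of the integer arrays of the program; a scalar is the entry `0` of its array. -/
inductive IVar : Type
  | n | m | kk | rd | E | F | Nc | N | cnt | p | q | b | t | j | i | best
  | key | id | okey | oid | col | cell | lo | hi | ord | nxt | head | top | below | start
  deriving DecidableEq

/-- Names of the real arrays of the program: `raw k` and `wrk k` hold `k`-th coordinates. -/
inductive RVar (d : ℕ) : Type
  | eps | del | alp | x | c | val | oval | lam | piv
  | raw (k : Fin d)
  | wrk (k : Fin d)
  deriving DecidableEq

/-- Entry `i` of array `v` lives in cell `30 * i + v.code`, so the arrays are interleaved and none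
needs a bound on its length. The code of `n` is `0` because the machine starts with `n` in integer
cell `0`. -/
def IVar.code : IVar → ℕ
  | .n => 0 | .m => 1 | .kk => 2 | .rd => 3 | .E => 4 | .F => 5 | .Nc => 6 | .N => 7 | .cnt => 8
  | .p => 9 | .q => 10 | .b => 11 | .t => 12 | .j => 13 | .i => 14 | .best => 15 | .key => 16
  | .id => 17 | .okey => 18 | .oid => 19 | .col => 20 | .cell => 21 | .lo => 22 | .hi => 23
  | .ord => 24 | .nxt => 25 | .head => 26 | .top => 27 | .below => 28 | .start => 29

def IVar.dec : ℕ → IVar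
  | 0 => .n | 1 => .m | 2 => .kk | 3 => .rd | 4 => .E | 5 => .F | 6 => .Nc | 7 => .N | 8 => .cnt
  | 9 => .p | 10 => .q | 11 => .b | 12 => .t | 13 => .j | 14 => .i | 15 => .best | 16 => .key
  | 17 => .id | 18 => .okey | 19 => .oid | 20 => .col | 21 => .cell | 22 => .lo | 23 => .hi
  | 24 => .ord | 25 => .nxt | 26 => .head | 27 => .top | 28 => .below | _ => .start

/-- The first three codes match the cells of `ε`, `δ`, `α` in the initial state. The codes of `raw
k` are consecutive, so the raw point with a given index is a block of `d` adjacent cells, as drawing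
and output require. -/
def RVar.code {d : ℕ} : RVar d → ℕ
  | .eps => 0 | .del => 1 | .alp => 2 | .x => 3 | .c => 4 | .val => 5 | .oval => 6 | .lam => 7
  | .piv => 8 | .raw k => k + 9 | .wrk k => k + d + 9

def RVar.dec {d : ℕ} : ℕ → RVar d
  | 0 => .eps | 1 => .del | 2 => .alp | 3 => .x | 4 => .c | 5 => .val | 6 => .oval | 7 => .lam
  | 8 => .piv
  | r + 9 => if h : r < d then .raw ⟨r, h⟩ else if h : r - d < d then .wrk ⟨r - d, h⟩ else .eps

/-- The number of real arrays. -/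
def rwidth (d : ℕ) : ℕ := 9 + d + d

theorem IVar.code_lt (v : IVar) : v.code < 30 := by cases v <;> decide

theorem IVar.dec_code (v : IVar) : IVar.dec v.code = v := by cases v <;> rfl

theorem IVar.code_dec (r : ℕ) (h : r < 30) : (IVar.dec r).code = r := by
  interval_cases r <;> rfl

theorem RVar.code_lt {d : ℕ} (v : RVar d) : v.code < rwidth d := by
  cases v <;> simp only [RVar.code, rwidth] <;> omega

theorem RVar.dec_code {d : ℕ} (v : RVar d) : RVar.dec v.code = v := by
  cases v with
  | raw k => simp [RVar.code, RVar.dec]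
  | wrk k => simp [RVar.code, RVar.dec]
  | _ => simp [RVar.code, RVar.dec]

theorem RVar.code_dec {d : ℕ} (r : ℕ) (h : r < rwidth d) : (RVar.dec r : RVar d).code = r := by
  unfold rwidth at h
  by_cases h9 : r < 9
  · interval_cases r <;> rfl
  · obtain ⟨r, rfl⟩ : ∃ q, r = q + 9 := ⟨r - 9, by omega⟩
    simp only [RVar.dec]
    split_ifs with h1 h2
    · simp [RVar.code]
    · simp only [RVar.code]; omega
    · omega

/-- A state of the machine, seen through named arrays. -/
@[ext] structure Mem (d n : ℕ) where
  I : IVar → ℤ → ℤ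
  R : RVar d → ℤ → ℝ
  drawn : Fin n → ℕ
  outLen : ℕ
  out : ℕ → List (Pt d)

namespace Mem


def im (h : Mem d n) : ℤ → ℤ := fun z => h.I (IVar.dec (z % 30).toNat) (z / 30)

def rm (h : Mem d n) : ℤ → ℝ := fun z =>
  h.R (RVar.dec (z % (rwidth d : ℤ)).toNat) (z / (rwidth d : ℤ))

/-- The machine state described by `h`. -/
def st (h : Mem d n) : State d n := ⟨h.im, h.rm, h.drawn, h.outLen, h.out⟩

def setI (h : Mem d n) (v : IVar) (i x : ℤ) : Mem d n :=
  { h with I := Function.update h.I v (Function.update (h.I v) i x) }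

def setR (h : Mem d n) (v : RVar d) (i : ℤ) (x : ℝ) : Mem d n :=
  { h with R := Function.update h.R v (Function.update (h.R v) i x) }

def setRaw (h : Mem d n) (i : ℤ) (p : Pt d) : Mem d n :=
  { h with R := fun v => match v with
      | .raw k => Function.update (h.R (.raw k)) i (p k)
      | v => h.R v }

end Mem

theorem mul_add_ediv_of_lt {W a : ℕ} (i : ℤ) (h : a < W) : ((W : ℤ) * i + a) / W = i := by
  rw [Int.add_comm, Int.add_mul_ediv_left _ _ (by omega), Int.ediv_eq_zero_of_lt (by omega) (by omega)]
  simp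

theorem mul_add_emod_of_lt {W a : ℕ} (i : ℤ) (h : a < W) :
    (((W : ℤ) * i + a) % W).toNat = a := by
  rw [Int.add_comm, Int.add_mul_emod_self_left, Int.emod_eq_of_lt (by omega) (by omega)]
  simp

theorem emod_toNat_lt {W : ℕ} (hW : 0 < W) (z : ℤ) : (z % (W : ℤ)).toNat < W := by
  have := Int.emod_nonneg z (b := (W : ℤ)) (by omega)
  have := Int.emod_lt_of_pos z (b := (W : ℤ)) (by omega)
  omega

theorem eq_mul_add_emod {W : ℕ} (hW : 0 < W) (z : ℤ) :
    z = (W : ℤ) * (z / W) + ((z % (W : ℤ)).toNat : ℤ) := by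
  have h1 := Int.emod_nonneg z (b := (W : ℤ)) (by omega)
  have h2 := Int.mul_ediv_add_emod z W
  rw [Int.toNat_of_nonneg h1]; exact h2.symm

namespace Mem


theorem im_addr (h : Mem d n) (v : IVar) (i : ℤ) : h.im (30 * i + v.code) = h.I v i := by
  have h1 := mul_add_ediv_of_lt i v.code_lt
  have h2 := mul_add_emod_of_lt i v.code_lt
  push_cast at h1 h2
  unfold im
  rw [h1, h2, IVar.dec_code]

theorem rm_addr (h : Mem d n) (v : RVar d) (i : ℤ) :
    h.rm ((rwidth d : ℤ) * i + v.code) = h.R v i := by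
  unfold rm
  rw [mul_add_ediv_of_lt i v.code_lt, mul_add_emod_of_lt i v.code_lt, RVar.dec_code]

/-- Division with remainder by `30` shows that every address belongs to exactly one named entry, so
a memory is determined by its named entries. -/
theorem ext_im {f : ℤ → ℤ} {h : Mem d n} (H : ∀ v i, f (30 * i + IVar.code v) = h.I v i) :
    f = h.im := by
  funext z
  have h1 := eq_mul_add_emod (W := 30) (by norm_num) z
  have h2 := emod_toNat_lt (W := 30) (by norm_num) z
  push_cast at h1 h2
  have h3 := H (IVar.dec (z % 30).toNat) (z / 30)
  rw [IVar.code_dec _ h2, ← h1] at h3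
  exact h3

theorem rwidth_pos (d : ℕ) : 0 < rwidth d := by unfold rwidth; omega

theorem ext_rm {f : ℤ → ℝ} {h : Mem d n}
    (H : ∀ v i, f ((rwidth d : ℤ) * i + RVar.code v) = h.R v i) : f = h.rm := by
  funext z
  have h1 := eq_mul_add_emod (rwidth_pos d) z
  have h2 := emod_toNat_lt (rwidth_pos d) z
  have h3 := H (RVar.dec (z % (rwidth d : ℤ)).toNat) (z / (rwidth d : ℤ))
  rw [RVar.code_dec _ h2, ← h1] at h3
  exact h3

theorem addr_inj {W a b : ℕ} {i j : ℤ} (ha : a < W) (hb : b < W) :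
    (W : ℤ) * i + a = W * j + b ↔ i = j ∧ a = b := by
  constructor
  · intro h
    have h1 := mul_add_ediv_of_lt i ha
    have h2 := mul_add_emod_of_lt i ha
    rw [h, mul_add_ediv_of_lt j hb] at h1
    rw [h, mul_add_emod_of_lt j hb] at h2
    exact ⟨h1.symm, h2.symm⟩
  · rintro ⟨rfl, rfl⟩; rfl

theorem icode_inj {v w : IVar} : v.code = w.code ↔ v = w :=
  ⟨fun h => by rw [← IVar.dec_code v, h, IVar.dec_code], fun h => h ▸ rfl⟩

theorem rcode_inj {v w : RVar d} : v.code = w.code ↔ v = w :=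
  ⟨fun h => by rw [← RVar.dec_code v, h, RVar.dec_code], fun h => h ▸ rfl⟩

theorem im_setI (h : Mem d n) (v : IVar) (i x : ℤ) :
    (h.setI v i x).im = Function.update h.im (30 * i + v.code) x := by
  symm
  apply ext_im
  intro w j
  have := addr_inj (i := j) (j := i) w.code_lt v.code_lt
  push_cast at this
  simp only [Function.update_apply, this, icode_inj, setI, im_addr]
  by_cases hw : w = v
  · subst hw; by_cases hj : j = i <;> simp [hj]
  · simp [hw]

theorem rm_setR (h : Mem d n) (v : RVar d) (i : ℤ) (x : ℝ) :
    (h.setR v i x).rm = Function.update h.rm ((rwidth d : ℤ) * i + v.code) x := by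
  symm
  apply ext_rm
  intro w j
  simp only [Function.update_apply, addr_inj w.code_lt v.code_lt, rcode_inj, setR, rm_addr]
  by_cases hw : w = v
  · subst hw; by_cases hj : j = i <;> simp [hj]
  · simp [hw]

theorem rm_setRaw (h : Mem d n) (i : ℤ) (p : Pt d) :
    (h.setRaw i p).rm = storePoint h.rm ((rwidth d : ℤ) * i + 9) p := by
  symm
  apply ext_rm
  intro w j
  simp only [storePoint]
  by_cases hc : ∃ k : Fin d, w = .raw k ∧ j = i
  · obtain ⟨k, rfl, rfl⟩ := hc
    have hk := k.2
    have e : ((rwidth d : ℤ) * j + ((RVar.raw k).code : ℕ) - ((rwidth d : ℤ) * j + 9)).toNat = k := by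
      simp only [RVar.code]; push_cast; omega
    rw [dif_pos ⟨by simp only [RVar.code]; push_cast; omega, by rw [e]; exact hk⟩]
    simp only [setRaw, Function.update_self]
    exact congrArg p.ofLp (Fin.ext e)
  · rw [dif_neg, rm_addr]
    · cases w with
      | raw k =>
        have : j ≠ i := fun hj => hc ⟨k, rfl, hj⟩
        simp [setRaw, this]
      | _ => rfl
    · rintro ⟨h1, h2⟩
      apply hc
      set k := ((rwidth d : ℤ) * j + (w.code : ℕ) - ((rwidth d : ℤ) * i + 9)).toNat with hk
      have h3 : (rwidth d : ℤ) * j + w.code = (rwidth d : ℤ) * i + ((RVar.raw ⟨k, h2⟩ : RVar d).code : ℕ) := by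
        have : (RVar.raw ⟨k, h2⟩ : RVar d).code = k + 9 := rfl
        rw [this]; push_cast; omega
      rw [addr_inj w.code_lt (RVar.code_lt _), rcode_inj] at h3
      exact ⟨_, h3.2, h3.1⟩

theorem loadPoint_rm (h : Mem d n) (i : ℤ) :
    loadPoint h.rm ((rwidth d : ℤ) * i + 9) = WithLp.toLp 2 fun k : Fin d => h.R (.raw k) i := by
  unfold loadPoint
  congr 1
  funext k
  rw [← rm_addr]
  congr 1
  simp only [RVar.code]; push_cast; ring

end Mem

/-! ### Expressions with named arrays -/

/-- Read an entry of an integer array. -/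
def iget (v : IVar) (e : IExp) : IExp := .load (.add (.mul (.const 30) e) (.const v.code))

/-- The value of an integer scalar. -/
def isc (v : IVar) : IExp := iget v (.const 0)

/-- Read an entry of a real array. -/
def rget {d : ℕ} (v : RVar d) (e : IExp) : RExp :=
  .load (.add (.mul (.const (rwidth d)) e) (.const v.code))

/-- The value of a real scalar. -/
def rsc {d : ℕ} (v : RVar d) : RExp := rget v (.const 0)

def iset (v : IVar) (e x : IExp) : Prog := .setInt (.add (.mul (.const 30) e) (.const v.code)) x

def fset (v : IVar) (e : IExp) (x : RExp) : Prog :=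
  .setFloor (.add (.mul (.const 30) e) (.const v.code)) x

def rset {d : ℕ} (v : RVar d) (e : IExp) (x : RExp) : Prog :=
  .setReal (.add (.mul (.const (rwidth d)) e) (.const v.code)) x

/-- The address of the raw point with index `e`. -/
def rawAddr (d : ℕ) (e : IExp) : IExp := .add (.mul (.const (rwidth d)) e) (.const 9)

namespace Mem


def ie (h : Mem d n) (e : IExp) : ℤ := e.eval h.im

def re (h : Mem d n) (e : RExp) : ℝ := e.eval h.im h.rm

def te (h : Mem d n) (b : Test) : Prop := b.holds h.im h.rm

@[simp] theorem ie_const (h : Mem d n) (z : ℤ) : h.ie (.const z) = z := rfl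
@[simp] theorem ie_add (h : Mem d n) (e f : IExp) : h.ie (.add e f) = h.ie e + h.ie f := rfl
@[simp] theorem ie_sub (h : Mem d n) (e f : IExp) : h.ie (.sub e f) = h.ie e - h.ie f := rfl
@[simp] theorem ie_mul (h : Mem d n) (e f : IExp) : h.ie (.mul e f) = h.ie e * h.ie f := rfl
@[simp] theorem ie_iget (h : Mem d n) (v : IVar) (e : IExp) : h.ie (iget v e) = h.I v (h.ie e) :=
  im_addr h v _
@[simp] theorem ie_isc (h : Mem d n) (v : IVar) : h.ie (isc v) = h.I v 0 := ie_iget h v _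

@[simp] theorem re_ofInt (h : Mem d n) (e : IExp) : h.re (.ofInt e) = (h.ie e : ℝ) := rfl
@[simp] theorem re_add (h : Mem d n) (e f : RExp) : h.re (.add e f) = h.re e + h.re f := rfl
@[simp] theorem re_sub (h : Mem d n) (e f : RExp) : h.re (.sub e f) = h.re e - h.re f := rfl
@[simp] theorem re_mul (h : Mem d n) (e f : RExp) : h.re (.mul e f) = h.re e * h.re f := rfl
@[simp] theorem re_div (h : Mem d n) (e f : RExp) : h.re (.div e f) = h.re e / h.re f := rfl
@[simp] theorem re_sqrt (h : Mem d n) (e : RExp) : h.re (.sqrt e) = Real.sqrt (h.re e) := rfl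
@[simp] theorem re_rget (h : Mem d n) (v : RVar d) (e : IExp) :
    h.re (rget v e) = h.R v (h.ie e) := rm_addr h v _
@[simp] theorem re_rsc (h : Mem d n) (v : RVar d) : h.re (rsc v) = h.R v 0 := re_rget h v _

@[simp] theorem te_intLe (h : Mem d n) (e f : IExp) : h.te (.intLe e f) ↔ h.ie e ≤ h.ie f := Iff.rfl
@[simp] theorem te_realLe (h : Mem d n) (e f : RExp) : h.te (.realLe e f) ↔ h.re e ≤ h.re f :=
  Iff.rfl
@[simp] theorem te_neg (h : Mem d n) (b : Test) : h.te (.neg b) ↔ ¬ h.te b := Iff.rfl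
@[simp] theorem te_and (h : Mem d n) (b c : Test) : h.te (.and b c) ↔ h.te b ∧ h.te c := Iff.rfl

@[simp] theorem setI_I (h : Mem d n) (v : IVar) (i x : ℤ) :
    (h.setI v i x).I = Function.update h.I v (Function.update (h.I v) i x) := rfl
@[simp] theorem setI_R (h : Mem d n) (v : IVar) (i x : ℤ) : (h.setI v i x).R = h.R := rfl
@[simp] theorem setI_drawn (h : Mem d n) (v : IVar) (i x : ℤ) :
    (h.setI v i x).drawn = h.drawn := rfl
@[simp] theorem setI_outLen (h : Mem d n) (v : IVar) (i x : ℤ) :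
    (h.setI v i x).outLen = h.outLen := rfl
@[simp] theorem setI_out (h : Mem d n) (v : IVar) (i x : ℤ) : (h.setI v i x).out = h.out := rfl
@[simp] theorem setR_R (h : Mem d n) (v : RVar d) (i : ℤ) (x : ℝ) :
    (h.setR v i x).R = Function.update h.R v (Function.update (h.R v) i x) := rfl
@[simp] theorem setR_I (h : Mem d n) (v : RVar d) (i : ℤ) (x : ℝ) : (h.setR v i x).I = h.I := rfl
@[simp] theorem setR_drawn (h : Mem d n) (v : RVar d) (i : ℤ) (x : ℝ) :
    (h.setR v i x).drawn = h.drawn := rfl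
@[simp] theorem setR_outLen (h : Mem d n) (v : RVar d) (i : ℤ) (x : ℝ) :
    (h.setR v i x).outLen = h.outLen := rfl
@[simp] theorem setR_out (h : Mem d n) (v : RVar d) (i : ℤ) (x : ℝ) :
    (h.setR v i x).out = h.out := rfl

end Mem

/-! ### Runs and weakest preconditions with a clock

Every executed instruction or test advances the clock by one; the charged cost is at most the clock
times a constant `Prog.bnd` of the program. -/

/-- The total charge for all instructions and tests that occur in a program. -/
def _root_.UncertainPoints.Prog.bnd (d : ℕ) : Prog → ℕ
  | .skip => 1
  | .setInt a e => a.cost + e.cost + 1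
  | .setReal a e => a.cost + e.cost + 1
  | .setFloor a e => a.cost + e.cost + 1
  | .draw i a => i.cost + a.cost + d + 1
  | .newSet => 1
  | .emit a => a.cost + d + 1
  | .seq p q => p.bnd d + q.bnd d
  | .ite b p q => b.cost + 1 + p.bnd d + q.bnd d
  | .while b p => b.cost + 1 + p.bnd d


def Run (ω : Draws d n) (p : Prog) (s : State d n) (k : ℕ) (s' : State d n) : Prop :=
  ∃ t, Exec ω p s s' t ∧ t ≤ p.bnd d * k

/-- Total correctness: halting is part of the claim. The clock `c` is passed through, so that time
bounds can be stated inside loop invariants like any other quantity. -/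
def WP (ω : Draws d n) (p : Prog) (h : Mem d n) (c : ℕ) (Q : Mem d n → ℕ → Prop) : Prop :=
  ∃ h' k, Run ω p h.st k h'.st ∧ Q h' (c + k)

section WP

variable {ω : Draws d n} {h : Mem d n} {c : ℕ} {Q : Mem d n → ℕ → Prop}

theorem WP.mono {p : Prog} {Q' : Mem d n → ℕ → Prop} (H : WP ω p h c Q)
    (HQ : ∀ h c, Q h c → Q' h c) : WP ω p h c Q' := by
  obtain ⟨h', k, h1, h2⟩ := H
  exact ⟨h', k, h1, HQ _ _ h2⟩

theorem wp_iset {v : IVar} {e x : IExp} (H : Q (h.setI v (h.ie e) (h.ie x)) (c + 1)) :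
    WP ω (iset v e x) h c Q := by
  refine ⟨_, 1, ⟨_, ?_, le_of_eq (mul_one _).symm⟩, H⟩
  have := Exec.setInt (ω := ω) h.st (.add (.mul (.const 30) e) (.const v.code)) x
  have e1 := Mem.im_setI h v (h.ie e) (h.ie x)
  simp only [Mem.st]
  rw [e1]
  exact this

theorem wp_fset {v : IVar} {e : IExp} {x : RExp} (H : Q (h.setI v (h.ie e) ⌊h.re x⌋) (c + 1)) :
    WP ω (fset v e x) h c Q := by
  refine ⟨_, 1, ⟨_, ?_, le_of_eq (mul_one _).symm⟩, H⟩
  have := Exec.setFloor (ω := ω) h.st (.add (.mul (.const 30) e) (.const v.code)) x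
  have e1 := Mem.im_setI h v (h.ie e) ⌊h.re x⌋
  simp only [Mem.st]
  rw [e1]
  exact this

theorem wp_rset {v : RVar d} {e : IExp} {x : RExp} (H : Q (h.setR v (h.ie e) (h.re x)) (c + 1)) :
    WP ω (rset v e x) h c Q := by
  refine ⟨_, 1, ⟨_, ?_, le_of_eq (mul_one _).symm⟩, H⟩
  have := Exec.setReal (ω := ω) h.st (.add (.mul (.const (rwidth d)) e) (.const v.code)) x
  have e1 := Mem.rm_setR h v (h.ie e) (h.re x)
  simp only [Mem.st]
  rw [e1]
  exact this

theorem wp_skip (H : Q h (c + 1)) : WP ω .skip h c Q :=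
  ⟨_, 1, ⟨_, Exec.skip _, le_of_eq (mul_one _).symm⟩, H⟩

theorem wp_newSet (H : Q { h with outLen := h.outLen + 1, out := Function.update h.out h.outLen [] }
    (c + 1)) : WP ω .newSet h c Q :=
  ⟨_, 1, ⟨_, Exec.newSet _, le_of_eq (mul_one _).symm⟩, H⟩

theorem wp_draw {i e : IExp} (k : Fin n) (hk : h.ie i = ((k : ℕ) : ℤ))
    (H : Q { h.setRaw (h.ie e) (ω (h.drawn k) k) with
      drawn := Function.update h.drawn k (h.drawn k + 1) } (c + 1)) :
    WP ω (.draw i (rawAddr d e)) h c Q := by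
  refine ⟨_, 1, ⟨_, ?_, le_of_eq (mul_one _).symm⟩, H⟩
  have := Exec.draw (ω := ω) h.st i (rawAddr d e) k hk
  have e1 := Mem.rm_setRaw h (h.ie e) (ω (h.drawn k) k)
  have e2 : (rawAddr d e).eval h.im = (rwidth d : ℤ) * h.ie e + 9 := rfl
  simp only [Mem.st] at this ⊢
  rw [e2, ← e1] at this
  exact this

theorem wp_emit {e : IExp} (j : ℕ) (hj : h.outLen = j + 1)
    (H : Q { h with out := Function.update h.out j (h.out j ++
      [WithLp.toLp 2 fun k : Fin d => h.R (.raw k) (h.ie e)]) } (c + 1)) :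
    WP ω (.emit (rawAddr d e)) h c Q := by
  refine ⟨_, 1, ⟨_, ?_, le_of_eq (mul_one _).symm⟩, H⟩
  have := Exec.emit (ω := ω) h.st (rawAddr d e) j hj
  have e2 : (rawAddr d e).eval h.im = (rwidth d : ℤ) * h.ie e + 9 := rfl
  simp only [Mem.st] at this ⊢
  rw [e2, Mem.loadPoint_rm] at this
  exact this

/-- Clocks add, and so do the constants: `a * k + b * k' ≤ (a + b) * (k + k')`. This is why
`Prog.bnd` sums over all parts of a program, even over branches not taken. -/
theorem wp_seq {p q : Prog} (H : WP ω p h c (fun h' c' => WP ω q h' c' Q)) :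
    WP ω (.seq p q) h c Q := by
  obtain ⟨h', k, ⟨t, ht, htb⟩, h'', k', ⟨t', ht', htb'⟩, hQ⟩ := H
  refine ⟨h'', k + k', ⟨t + t', Exec.seq ht ht', ?_⟩, by rwa [← add_assoc]⟩
  simp only [Prog.bnd]
  nlinarith [Nat.zero_le (p.bnd d * k'), Nat.zero_le (q.bnd d * k)]

theorem wp_ite {b : Test} {p q : Prog} (H1 : h.te b → WP ω p h (c + 1) Q)
    (H2 : ¬ h.te b → WP ω q h (c + 1) Q) : WP ω (.ite b p q) h c Q := by
  by_cases hb : h.te b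
  · obtain ⟨h', k, ⟨t, ht, htb⟩, hQ⟩ := H1 hb
    refine ⟨h', 1 + k, ⟨_, Exec.iteTrue hb ht, ?_⟩, by rwa [← add_assoc]⟩
    simp only [Prog.bnd]
    nlinarith [Nat.zero_le (q.bnd d * k), Nat.zero_le (b.cost * k)]
  · obtain ⟨h', k, ⟨t, ht, htb⟩, hQ⟩ := H2 hb
    refine ⟨h', 1 + k, ⟨_, Exec.iteFalse hb ht, ?_⟩, by rwa [← add_assoc]⟩
    simp only [Prog.bnd]
    nlinarith [Nat.zero_le (p.bnd d * k), Nat.zero_le (b.cost * k)]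

theorem wp_while_false {b : Test} {p : Prog} (hb : ¬ h.te b) (H : Q h (c + 1)) :
    WP ω (.while b p) h c Q := by
  refine ⟨_, 1, ⟨_, Exec.whileFalse hb, ?_⟩, H⟩
  simp only [Prog.bnd]; omega

theorem wp_while_true {b : Test} {p : Prog} (hb : h.te b)
    (H : WP ω p h (c + 1) (fun h' c' => WP ω (.while b p) h' c' Q)) :
    WP ω (.while b p) h c Q := by
  obtain ⟨h', k, ⟨t, ht, htb⟩, h'', k', ⟨t', ht', htb'⟩, hQ⟩ := H
  refine ⟨h'', 1 + k + k', ⟨_, Exec.whileTrue hb ht ht', ?_⟩, by rwa [← add_assoc, ← add_assoc]⟩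
  simp only [Prog.bnd] at htb' ⊢
  nlinarith [Nat.zero_le (p.bnd d * k'), Nat.zero_le (b.cost * k)]

/-- `for x := 0 to N - 1 do body`. -/
def forP (x : IVar) (N : IExp) (body : Prog) : Prog :=
  .seq (iset x (.const 0) (.const 0))
    (.while (.intLe (.add (isc x) (.const 1)) N)
      (.seq body (iset x (.const 0) (.add (isc x) (.const 1)))))

/-- Induction on the number of remaining iterations. An iteration costs two ticks beyond its body
(test and increment); initialisation and exit cost one each. The invariant itself has to keep the
counter and the bound intact (`hN`). -/
theorem wp_for {x : IVar} {Ne : IExp} {body : Prog} (N : ℕ) (Inv : ℕ → Mem d n → ℕ → Prop)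
    (h0 : Inv 0 (h.setI x 0 0) (c + 1))
    (hN : ∀ k h c, k ≤ N → Inv k h c → h.I x 0 = k ∧ h.ie Ne = N)
    (hb : ∀ k h c, k < N → Inv k h c → WP ω body h (c + 1)
      (fun h' c' => Inv (k + 1) (h'.setI x 0 (h'.I x 0 + 1)) (c' + 1)))
    (hQ : ∀ h c, Inv N h c → Q h (c + 1)) : WP ω (forP x Ne body) h c Q := by
  refine wp_seq (wp_iset ?_)
  have key : ∀ r k h c, k + r = N → Inv k h c → WP ω (.while (.intLe (.add (isc x) (.const 1)) Ne)
      (.seq body (iset x (.const 0) (.add (isc x) (.const 1))))) h c Q := by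
    intro r
    induction r with
    | zero =>
      intro k h c hk hI
      obtain ⟨h1, h2⟩ := hN k h c (by omega) hI
      refine wp_while_false (by simp [h1, h2]; omega) (hQ _ _ ?_)
      rwa [show k = N by omega] at hI
    | succ r ih =>
      intro k h c hk hI
      obtain ⟨h1, h2⟩ := hN k h c (by omega) hI
      refine wp_while_true (by simp [h1, h2]; omega) (wp_seq ?_)
      refine (hb k h c (by omega) hI).mono fun h' c' hI' => wp_iset (ih (k + 1) _ _ (by omega) ?_)
      simpa using hI'
  exact key N 0 _ _ (by omega) h0

end WP

/-- `h'` differs from `h` only in the arrays listed. -/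
structure Frame (MI : List IVar) (MR : List (RVar d)) (h h' : Mem d n) : Prop where
  I : ∀ v, v ∉ MI → h'.I v = h.I v
  R : ∀ v, v ∉ MR → h'.R v = h.R v
  drawn : h'.drawn = h.drawn
  outLen : h'.outLen = h.outLen
  out : h'.out = h.out

theorem Frame.refl (MI : List IVar) (MR : List (RVar d)) (h : Mem d n) : Frame MI MR h h :=
  ⟨fun _ _ => rfl, fun _ _ => rfl, rfl, rfl, rfl⟩

theorem Frame.trans {MI MI' : List IVar} {MR MR' : List (RVar d)} {h h' h'' : Mem d n}
    (a : Frame MI MR h h') (b : Frame MI' MR' h' h'') (hI : MI' ⊆ MI := by simp)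
    (hR : MR' ⊆ MR := by simp) : Frame MI MR h h'' :=
  ⟨fun v hv => (b.I v fun h => hv (hI h)).trans (a.I v hv),
    fun v hv => (b.R v fun h => hv (hR h)).trans (a.R v hv),
    b.drawn.trans a.drawn, b.outLen.trans a.outLen, b.out.trans a.out⟩

theorem Frame.weaken {MI MI' : List IVar} {MR MR' : List (RVar d)} {h h' : Mem d n}
    (b : Frame MI' MR' h h') (hI : MI' ⊆ MI := by simp) (hR : MR' ⊆ MR := by simp) :
    Frame MI MR h h' := (Frame.refl MI MR h).trans b hI hR

theorem Frame.setI {MI : List IVar} {MR : List (RVar d)} {h h' : Mem d n}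
    (a : Frame MI MR h h') {v : IVar} {i x : ℤ} (hv : v ∈ MI := by simp) :
    Frame MI MR h (h'.setI v i x) :=
  ⟨fun w hw => by
    rw [Mem.setI_I, Function.update_of_ne (by rintro rfl; exact hw hv)]; exact a.I w hw,
    a.R, a.drawn, a.outLen, a.out⟩

theorem Frame.setR {MI : List IVar} {MR : List (RVar d)} {h h' : Mem d n}
    (a : Frame MI MR h h') {v : RVar d} {i : ℤ} {x : ℝ} (hv : v ∈ MR := by simp) :
    Frame MI MR h (h'.setR v i x) :=
  ⟨a.I, fun w hw => by
    rw [Mem.setR_R, Function.update_of_ne (by rintro rfl; exact hw hv)]; exact a.R w hw,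
    a.drawn, a.outLen, a.out⟩

/-! ### Arrays, linked lists and stable bucket sort -/

/-- The array `a` starts with the entries of `L`. -/
def IsArr (a : ℤ → ℤ) (L : List ℕ) : Prop := ∀ t (ht : t < L.length), a t = (L[t] : ℕ)

/-- `L` is the linked list that starts at `x`; the end is marked by `-1`. -/
def IsLinked (next : ℤ → ℤ) : ℤ → List ℕ → Prop
  | x, [] => x = -1
  | x, p :: l => x = p ∧ IsLinked next (next p) l

theorem IsLinked.update {next : ℤ → ℤ} {x : ℤ} {L : List ℕ} (H : IsLinked next x L) {p : ℕ}
    (hp : p ∉ L) (y : ℤ) : IsLinked (Function.update next p y) x L := by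
  induction L generalizing x with
  | nil => exact H
  | cons a l ih =>
    simp only [List.mem_cons, not_or] at hp
    refine ⟨H.1, ?_⟩
    rw [Function.update_of_ne (by exact_mod_cast Ne.symm hp.1)]
    exact ih H.2 hp.2

/-- Used for the buckets of the sort and for the stacks of the envelopes. Links are indexed by
items, so a new item cannot disturb lists that do not contain it. -/
theorem IsLinked.cons_update {next : ℤ → ℤ} {x : ℤ} {L : List ℕ} (H : IsLinked next x L) {p : ℕ}
    (hp : p ∉ L) : IsLinked (Function.update next p x) p (p :: L) :=
  ⟨rfl, by rw [Function.update_self]; exact H.update hp x⟩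

theorem IsArr.snoc {a : ℤ → ℤ} {L : List ℕ} (H : IsArr a L) {t : ℤ} (ht : t = L.length) {p : ℕ}
    {x : ℤ} (hx : x = p) : IsArr (Function.update a t x) (L ++ [p]) := by
  intro s hs
  subst ht hx
  rcases lt_or_ge s L.length with h | h
  · rw [Function.update_of_ne (by exact_mod_cast h.ne), List.getElem_append_left h, H s h]
  · have : s = L.length := by simp at hs; omega
    subst this
    simp

/-- Stable bucket sort with keys below `B`. -/
def bsort (B : ℕ) (key : ℕ → ℕ) (L : List ℕ) : List ℕ :=
  (List.range B).flatMap fun b => L.filter fun p => key p = b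

theorem mem_bsort {B : ℕ} {key : ℕ → ℕ} {L : List ℕ} (hB : ∀ p ∈ L, key p < B) {p : ℕ} :
    p ∈ bsort B key L ↔ p ∈ L := by
  simp only [bsort, List.mem_flatMap, List.mem_range, List.mem_filter, decide_eq_true_eq]
  constructor
  · rintro ⟨b, -, h, -⟩; exact h
  · intro h; exact ⟨key p, hB p h, h, rfl⟩

theorem nodup_bsort {B : ℕ} {key : ℕ → ℕ} {L : List ℕ} (hL : L.Nodup) : (bsort B key L).Nodup := by
  unfold bsort
  rw [List.nodup_flatMap]
  refine ⟨fun b _ => hL.filter _, List.nodup_range.imp fun {a b} hab => ?_⟩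
  intro p h1 h2
  simp only [List.mem_filter, decide_eq_true_eq] at h1 h2
  exact hab (h1.2.symm.trans h2.2)

theorem length_bsort {B : ℕ} {key : ℕ → ℕ} {L : List ℕ} (hL : L.Nodup)
    (hB : ∀ p ∈ L, key p < B) : (bsort B key L).length = L.length := by
  apply List.Perm.length_eq
  rw [List.perm_ext_iff_of_nodup (nodup_bsort hL) hL]
  exact fun a => mem_bsort hB

/-- Filtering preserves the earlier order inside a bucket. This is stability: two passes, low digit
first, sort lexicographically. -/
theorem pairwise_bsort {B : ℕ} {key : ℕ → ℕ} {L : List ℕ} {R : ℕ → ℕ → Prop} (hL : L.Pairwise R) :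
    (bsort B key L).Pairwise fun a b => key a < key b ∨ key a = key b ∧ R a b := by
  unfold bsort
  rw [List.pairwise_flatMap]
  refine ⟨fun b _ => ?_, List.pairwise_lt_range.imp ?_⟩
  · refine (hL.filter _).imp_of_mem ?_
    intro x y hx hy hxy
    simp only [List.mem_filter, decide_eq_true_eq] at hx hy
    exact Or.inr ⟨hx.2.trans hy.2.symm, hxy⟩
  · intro a b hab x hx y hy
    simp only [List.mem_filter, decide_eq_true_eq] at hx hy
    exact Or.inl (by omega)

/-- One pass of bucket sort of the array `ord` by the keys in the array `kv`. -/
def passP (kv : IVar) : Prog :=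
  .seq (forP .b (isc .E) (iset .head (isc .b) (.const (-1))))
  (.seq (forP .t (isc .N)
    (.seq (iset .p (.const 0) (iget .ord (.sub (.sub (isc .N) (.const 1)) (isc .t))))
    (.seq (iset .nxt (isc .p) (iget .head (iget kv (isc .p))))
      (iset .head (iget kv (isc .p)) (isc .p)))))
  (.seq (iset .cnt (.const 0) (.const 0))
    (forP .b (isc .E)
      (.seq (iset .p (.const 0) (iget .head (isc .b)))
        (.while (.intLe (.const 0) (isc .p))
          (.seq (iset .ord (isc .cnt) (isc .p))
          (.seq (iset .cnt (.const 0) (.add (isc .cnt) (.const 1)))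
            (iset .p (.const 0) (iget .nxt (isc .p))))))))))

/-- The variables changed by `passP`. -/
def passVars : List IVar := [.b, .t, .p, .cnt, .nxt, .head, .ord]

theorem wp_pass_copy {ω : Draws d n} (l : List ℕ) :
    ∀ {h : Mem d n} {c : ℕ} {out : List ℕ} {Q : Mem d n → ℕ → Prop},
    IsLinked (h.I .nxt) (h.I .p 0) l → IsArr (h.I .ord) out → h.I .cnt 0 = out.length →
    (∀ h' c', Frame [.p, .cnt, .ord] [] h h' → IsArr (h'.I .ord) (out ++ l) →
      h'.I .cnt 0 = (out ++ l).length → c' = c + 4 * l.length + 1 → Q h' c') →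
    WP ω (.while (.intLe (.const 0) (isc .p))
          (.seq (iset .ord (isc .cnt) (isc .p))
          (.seq (iset .cnt (.const 0) (.add (isc .cnt) (.const 1)))
            (iset .p (.const 0) (iget .nxt (isc .p)))))) h c Q := by
  induction l with
  | nil =>
    intro h c out Q hl ho hc hQ
    refine wp_while_false (by simp [show h.I .p 0 = -1 from hl]) ?_
    exact hQ _ _ (Frame.refl _ _ _) (by simpa using ho) (by simpa using hc) rfl
  | cons p l ih =>
    intro h c out Q hl ho hc hQ
    have hp : h.I .p 0 = p := hl.1
    refine wp_while_true (by simp [hp]) ?_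
    refine wp_seq (wp_iset (wp_seq (wp_iset (wp_iset ?_))))
    refine ih (out := out ++ [p]) ?_ ?_ ?_ ?_
    · simpa [hp] using hl.2
    · simpa [hp] using ho.snoc hc rfl
    · simp [hc]
    · intro h' c' hf h1 h2 h3
      refine hQ h' c' (((((Frame.refl _ _ h).setI).setI).setI).trans hf) (by simpa using h1)
        (by simpa using h2) (by simp at h3 ⊢; omega)

/-- The array is read from its end while items are pushed to the front of their buckets, so every
bucket ends up in the original order. Each item and each bucket is handled a bounded number of
times. -/
theorem wp_pass {ω : Draws d n} {kv : IVar} (hkv : kv ∉ passVars) {h : Mem d n} {c E : ℕ}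
    {L : List ℕ} {key : ℕ → ℕ} (hE : h.I .E 0 = E) (hN : h.I .N 0 = L.length)
    (hL : IsArr (h.I .ord) L) (hnd : L.Nodup) (hk : ∀ p ∈ L, h.I kv p = key p)
    (hkE : ∀ p ∈ L, key p < E) :
    WP ω (passP kv) h c fun h' c' => Frame passVars [] h h' ∧
      IsArr (h'.I .ord) (bsort E key L) ∧ c' ≤ c + 20 * (L.length + E + 1) := by
  have hkv' := hkv
  simp only [passVars, List.mem_cons, List.not_mem_nil, or_false, not_or] at hkv'
  obtain ⟨k1, k2, k3, k4, k5, k6, k7⟩ := hkv'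
  refine wp_seq (wp_for E (fun k h' c' => h'.I .b 0 = k ∧ Frame [.b, .head] [] h h' ∧
    (∀ b < k, h'.I .head (b : ℕ) = -1) ∧ c' = c + 1 + 3 * k) ?_ ?_ ?_ ?_)
  · exact ⟨by simp, (Frame.refl _ _ h).setI, by simp, rfl⟩
  · rintro k h' c' - ⟨h1, hf, -⟩
    exact ⟨h1, by simp [hf.I .E (by simp), hE]⟩
  · rintro k h' c' hk' ⟨h1, hf, h2, rfl⟩
    refine wp_iset ⟨by simp [h1], hf.setI.setI, ?_, by ring⟩
    intro b hb
    simp only [Mem.setI_I, Mem.ie_isc, h1]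
    rcases Nat.lt_succ_iff_lt_or_eq.1 hb with hb | rfl
    · have := hb.ne
      simp [this, h2 b hb]
    · simp
  rintro h1 c1 ⟨-, hf1, hhead, rfl⟩
  -- After `k` iterations the buckets hold exactly the last `k` entries of the array, in array
  -- order.
  refine wp_seq (wp_for L.length (fun k h' c' => h'.I .t 0 = k ∧
    Frame [.b, .head, .t, .p, .nxt] [] h h' ∧
    (∀ b < E, IsLinked (h'.I .nxt) (h'.I .head (b : ℕ))
      ((L.drop (L.length - k)).filter fun p => key p = b)) ∧
      c' = c + 3 + 3 * E + 5 * k) ?_ ?_ ?_ ?_)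
  · exact ⟨by simp, hf1.weaken.setI, by simpa [IsLinked] using hhead, by ring⟩
  · rintro k h' c' - ⟨h1, hf, -⟩
    exact ⟨h1, by simp [hf.I .N (by simp), hN]⟩
  · rintro k h2 c2 hk' ⟨h3, hf, h4, rfl⟩
    have hi : L.length - (k + 1) < L.length := by omega
    set p := L[L.length - (k + 1)] with hp
    have hpL : p ∈ L := List.getElem_mem _
    have hdrop : L.drop (L.length - (k + 1)) = p :: L.drop (L.length - k) := by
      rw [List.drop_eq_getElem_cons hi, ← hp]; congr 2; omega
    have hpd : p ∉ L.drop (L.length - k) := by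
      have := hnd.sublist (List.drop_sublist (L.length - (k + 1)) L)
      rw [hdrop] at this
      exact (List.nodup_cons.1 this).1
    have e0 : ((L.length : ℤ) - 1 - k) = ((L.length - (k + 1) : ℕ) : ℤ) := by omega
    have e1 : h2.I .ord ((L.length : ℤ) - 1 - k) = p := by
      rw [hf.I .ord (by simp), e0, hL _ hi]
    have e2 : h2.I kv p = key p := by
      rw [hf.I kv (by simp; tauto), hk p hpL]
    have e3 : h2.I .N 0 = L.length := by rw [hf.I .N (by simp), hN]
    refine wp_seq (wp_iset (wp_seq (wp_iset (wp_iset ?_))))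
    refine ⟨by simp [h3], hf.setI.setI.setI.setI, ?_, by ring⟩
    intro b hb
    rw [hdrop]
    simp only [Mem.ie_const, Mem.ie_iget, Mem.ie_sub, Mem.ie_isc, e3, h3, e1, Mem.setI_I,
      Function.update_self, ne_eq, reduceCtorEq, not_false_eq_true, Function.update_of_ne, k3, e2,
      k5]
    by_cases hkb : key p = b
    · subst hkb
      rw [List.filter_cons_of_pos (by simp), Function.update_self]
      exact (h4 _ hb).cons_update fun hm => hpd (List.mem_of_mem_filter hm)
    · rw [List.filter_cons_of_neg (by simpa using hkb),
        Function.update_of_ne (by exact_mod_cast Ne.symm hkb)]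
      exact (h4 _ hb).update (fun hm => hpd (List.mem_of_mem_filter hm)) _
  rintro h2 c2 ⟨-, hf2, hlink, rfl⟩
  simp only [Nat.sub_self, List.drop_zero] at hlink
  refine wp_seq (wp_iset ?_)
  refine wp_for E (fun k h' c' => h'.I .b 0 = k ∧ Frame passVars [] h h' ∧
    h'.I .nxt = h2.I .nxt ∧ h'.I .head = h2.I .head ∧ IsArr (h'.I .ord) (bsort k key L) ∧
    h'.I .cnt 0 = (bsort k key L).length ∧
    c' = c + 6 + 3 * E + 5 * L.length + 4 * k + 4 * (bsort k key L).length) ?_ ?_ ?_ ?_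
  · refine ⟨by simp, (hf2.weaken (by simp [passVars])).setI (by simp [passVars]) |>.setI (by simp [passVars]), by simp, by simp, ?_, ?_, ?_⟩
    · intro t ht; simp [bsort] at ht
    · simp [bsort]
    · simp [bsort]; ring
  · rintro k h' c' - ⟨h1, hf, -⟩
    exact ⟨h1, by simp [hf.I .E (by simp [passVars]), hE]⟩
  · rintro k h' c' hk' ⟨h3, hf, e1, e2, e3, e4, rfl⟩
    refine wp_seq (wp_iset ?_)
    have hl := hlink k hk'
    have hs : bsort (k + 1) key L = bsort k key L ++ L.filter fun p => key p = k := by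
      simp [bsort, List.range_succ]
    refine wp_pass_copy (L.filter fun p => key p = k) (out := bsort k key L) ?_ ?_ ?_ ?_
    · simpa [h3, e1, e2] using hl
    · simpa using e3
    · simpa using e4
    · intro h'' c'' hf'' a1 a2 a3
      have := hf''.I .b (by simp)
      have b1 := hf''.I .nxt (by simp)
      have b2 := hf''.I .head (by simp)
      simp only [Mem.setI_I, ne_eq, reduceCtorEq, not_false_eq_true, Function.update_of_ne] at this b1 b2
      refine ⟨by simp [this, h3], ?_, by simp [b1, e1], by simp [b2, e2], by simpa [hs] using a1,
        by simpa [hs] using a2, ?_⟩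
      · exact ((hf.setI (by simp [passVars])).trans hf'' (by simp [passVars])).setI (by simp [passVars])
      · rw [a3, hs, List.length_append]; ring
  · rintro h' c' ⟨-, hf, -, -, a1, a2, rfl⟩
    refine ⟨hf, a1, ?_⟩
    rw [length_bsort hnd hkE]
    omega

/-! ### Upper envelopes of lines at integer points -/

/-- The line with slope `cc * cell p` through `val p`, at the integer `j`. -/
def line (val : ℤ → ℝ) (cell : ℤ → ℤ) (cc : ℝ) (p : ℕ) (j : ℤ) : ℝ :=
  val p + cc * j * cell p

/-- The lines in the list attain the maximum over `S` at the integers in `[0, e)`; the first line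
does so on `[start, e)`, the rest of the list below that. -/
def Env (f : ℕ → ℤ → ℝ) (start : ℤ → ℤ) (S : Set ℕ) : List ℕ → ℤ → Prop
  | [], e => e = 0
  | q :: L, e => 0 ≤ start q ∧ start q < e ∧ q ∈ S ∧
      (∀ j, start q ≤ j → j < e → ∀ p ∈ S, f p j ≤ f q j) ∧ Env f start S L (start q)

theorem Env.mem {f : ℕ → ℤ → ℝ} {start : ℤ → ℤ} {S : Set ℕ} {L : List ℕ} {e : ℤ}
    (H : Env f start S L e) : ∀ p ∈ L, p ∈ S := by
  induction L generalizing e with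
  | nil => simp
  | cons q L ih =>
    intro p hp
    rcases List.mem_cons.1 hp with rfl | hp
    · exact H.2.2.1
    · exact ih H.2.2.2.2 p hp

theorem Env.update {f : ℕ → ℤ → ℝ} {start : ℤ → ℤ} {S : Set ℕ} {L : List ℕ} {e : ℤ}
    (H : Env f start S L e) {p : ℕ} (hp : p ∉ L) (x : ℤ) :
    Env f (Function.update start p x) S L e := by
  induction L generalizing e with
  | nil => exact H
  | cons q L ih =>
    simp only [List.mem_cons, not_or] at hp
    have hq : Function.update start (p : ℤ) x q = start q :=
      Function.update_of_ne (by exact_mod_cast Ne.symm hp.1) _ _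
    simp only [Env, hq]
    exact ⟨H.1, H.2.1, H.2.2.1, H.2.2.2.1, ih H.2.2.2.2 hp.2⟩

/-- A line that nowhere below `e` exceeds all lines of `S` leaves the envelope there unchanged. -/
theorem Env.insert {f : ℕ → ℤ → ℝ} {start : ℤ → ℤ} {S : Set ℕ} {L : List ℕ} {e : ℤ}
    (H : Env f start S L e) {p : ℕ} (hp : ∀ j, j < e → ∃ q ∈ S, f p j ≤ f q j) :
    Env f start (insert p S) L e := by
  induction L generalizing e with
  | nil => exact H
  | cons q L ih =>
    obtain ⟨h1, h2, h3, h4, h5⟩ := H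
    refine ⟨h1, h2, Or.inr h3, ?_, ih h5 fun j hj => hp j (hj.trans h2)⟩
    rintro j hj hj' r (rfl | hr)
    · obtain ⟨s, hs, hrs⟩ := hp j hj'
      exact hrs.trans (h4 j hj hj' s hs)
    · exact h4 j hj hj' r hr

/-! ### Crossing points of two lines -/

section Cross

variable {val : ℤ → ℝ} {cell : ℤ → ℤ} {cc : ℝ} {p q : ℕ}

/-- The reason for inserting lines by increasing slope: once the newer line has caught up with an
older one it stays above it, so it takes over a final segment of the integers. -/
theorem line_sub_mono (hc : 0 ≤ cc) (hpq : cell q ≤ cell p) {i j : ℤ} (hij : i ≤ j) :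
    line val cell cc p i - line val cell cc q i ≤ line val cell cc p j - line val cell cc q j := by
  unfold line
  have h1 : (0 : ℝ) ≤ (cell p : ℝ) - cell q := by
    have : (cell q : ℝ) ≤ cell p := by exact_mod_cast hpq
    linarith
  have h2 : (0 : ℝ) ≤ (j : ℝ) - i := by
    have : (i : ℝ) ≤ j := by exact_mod_cast hij
    linarith
  nlinarith [mul_nonneg (mul_nonneg hc h1) h2]

/-- The quotient is the real crossing point and `s` the first integer not below it. The two strict
and weak comparisons at `i` and `j` force different slopes, so the quotient makes sense. -/
theorem line_cross (hc : 0 ≤ cc) (hpq : cell q ≤ cell p) {i j : ℤ}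
    (h1 : line val cell cc p i < line val cell cc q i)
    (h2 : line val cell cc q j ≤ line val cell cc p j) {s : ℤ}
    (hs : s = ⌈(val q - val p) / (cc * ((cell p : ℝ) - cell q))⌉) :
    i < s ∧ s ≤ j ∧ (∀ k, s ≤ k → line val cell cc q k ≤ line val cell cc p k) ∧
      ∀ k, k < s → line val cell cc p k ≤ line val cell cc q k := by
  have hpos : 0 < cc * ((cell p : ℝ) - cell q) := by
    have h3 : (0 : ℝ) ≤ (cell p : ℝ) - cell q := by
      have : (cell q : ℝ) ≤ cell p := by exact_mod_cast hpq
      linarith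
    rcases (mul_nonneg hc h3).lt_or_eq with h | h
    · exact h
    -- With equal slopes the difference of the lines would be constant, contradicting its sign
    -- change between `i` and `j`.
    · unfold line at h1 h2
      have e1 : cc * i * cell p - cc * i * cell q = 0 := by
        linear_combination (-(i : ℝ)) * h
      have e2 : cc * j * cell p - cc * j * cell q = 0 := by
        linear_combination (-(j : ℝ)) * h
      linarith
  have key : ∀ k : ℤ, s ≤ k ↔ line val cell cc q k ≤ line val cell cc p k := by
    intro k
    rw [hs, Int.ceil_le, div_le_iff₀ hpos]
    unfold line
    constructor <;> intro h <;> nlinarith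
  refine ⟨?_, (key j).2 h2, fun k hk => (key k).1 hk, fun k hk => ?_⟩
  · by_contra hcon
    exact absurd ((key i).1 (not_lt.1 hcon)) (not_le.2 h1)
  · by_contra hcon
    exact absurd ((key k).2 (not_le.1 hcon).le) (not_le.2 hk)

end Cross

/-- The line of item `pe` at `je`. -/
def lineE (d : ℕ) (pe je : IExp) : RExp :=
  .add (rget (RVar.val : RVar d) pe)
    (.mul (.mul (rsc (RVar.c : RVar d)) (.ofInt je)) (.ofInt (iget .cell pe)))

theorem re_lineE {h : Mem d n} {val : ℤ → ℝ} {cell : ℤ → ℤ} {cc : ℝ} (hval : h.R .val = val)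
    (hcell : h.I .cell = cell) (hcc : h.R .c 0 = cc) {pe je : IExp} {p : ℕ} (hp : h.ie pe = p) :
    h.re (lineE d pe je) = line val cell cc p (h.ie je) := by
  simp [lineE, line, hval, hcell, hcc, hp]

/-- Remove the lines that are no longer needed when line `p` is added. -/
def popP (d : ℕ) : Prog :=
  .while (.and (.intLe (.const 0) (isc .q))
      (.realLe (lineE d (isc .q) (iget .start (isc .q))) (lineE d (isc .p) (iget .start (isc .q)))))
    (iset .q (.const 0) (iget .below (isc .q)))

/-- Add the line of item `ord[t]` to the envelope of its column. -/
def pushP (d : ℕ) : Prog :=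
  .seq (iset .p (.const 0) (iget .ord (isc .t)))
  (.seq (iset .b (.const 0) (iget .col (isc .p)))
  (.seq (iset .q (.const 0) (iget .top (isc .b)))
  (.seq (popP d)
    (.ite (.intLe (.const 0) (isc .q))
      (.ite (.realLe (lineE d (isc .q) (.sub (isc .E) (.const 1)))
          (lineE d (isc .p) (.sub (isc .E) (.const 1))))
        (.seq (fset .start (isc .p)
          (.div (.sub (rget (RVar.val : RVar d) (isc .p)) (rget (RVar.val : RVar d) (isc .q)))
            (.mul (rsc (RVar.c : RVar d))
              (.ofInt (.sub (iget .cell (isc .p)) (iget .cell (isc .q)))))))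
        (.seq (iset .start (isc .p) (.sub (.const 0) (iget .start (isc .p))))
        (.seq (iset .below (isc .p) (isc .q))
          (iset .top (isc .b) (isc .p)))))
        (iset .top (isc .b) (isc .q)))
      (.seq (iset .start (isc .p) (.const 0))
      (.seq (iset .below (isc .p) (isc .q))
        (iset .top (isc .b) (isc .p))))))))

/-! ### Inserting a line into an envelope -/

section Push

variable {val : ℤ → ℝ} {cell : ℤ → ℤ} {cc : ℝ} {S : Set ℕ} {p : ℕ} {E : ℤ}

/-- If the new line `p` reaches the top line already at the start of its interval, it does so on the
whole interval, and the top line can go. The invariant is that the remaining stack is the envelope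
on `[0, e)` while `p` dominates on `[e, E)`. Each removal takes two ticks, paid for by the stack
becoming shorter. -/
theorem wp_pop {ω : Draws d n} (hcc0 : 0 ≤ cc) (hS : ∀ q ∈ S, cell q ≤ cell p)
    (L : List ℕ) : ∀ {h : Mem d n} {c : ℕ} {e : ℤ} {Q : Mem d n → ℕ → Prop}, h.R .val = val →
    h.I .cell = cell → h.R .c 0 = cc → h.I .p 0 = p → IsLinked (h.I .below) (h.I .q 0) L →
    Env (line val cell cc) (h.I .start) S L e → e ≤ E →
    (∀ j, e ≤ j → j < E → ∀ q ∈ S, line val cell cc q j ≤ line val cell cc p j) →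
    (∀ h' c' L' e', Frame [.q] [] h h' → IsLinked (h'.I .below) (h'.I .q 0) L' →
      Env (line val cell cc) (h.I .start) S L' e' → e' ≤ E →
      (∀ j, e' ≤ j → j < E → ∀ q ∈ S, line val cell cc q j ≤ line val cell cc p j) →
      (∀ q ∈ L'.head?, line val cell cc p (h.I .start q) < line val cell cc q (h.I .start q)) →
      c' + 2 * L'.length = c + 2 * L.length + 1 → Q h' c') →
    WP ω (popP d) h c Q := by
  induction L with
  | nil =>
    intro h c e Q hval hcell hcc hp hl he heE hdom hQ
    refine wp_while_false (by simp [show h.I .q 0 = -1 from hl]) ?_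
    exact hQ _ _ [] e (Frame.refl _ _ _) hl he heE hdom (by simp) rfl
  | cons q L ih =>
    intro h c e Q hval hcell hcc hp hl he heE hdom hQ
    have hq : h.I .q 0 = q := hl.1
    have r1 := re_lineE (je := iget .start (isc .q)) hval hcell hcc
      (pe := isc .q) (p := q) (by simp [hq])
    have r2 := re_lineE (je := iget .start (isc .q)) hval hcell hcc
      (pe := isc .p) (p := p) (by simp [hp])
    simp only [Mem.ie_iget, Mem.ie_isc, hq] at r1 r2
    obtain ⟨h1, h2, h3, h4, h5⟩ := id he
    by_cases hb : line val cell cc q (h.I .start q) ≤ line val cell cc p (h.I .start q)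
    · refine wp_while_true (by simpa [hq, r1, r2] using hb) (wp_iset ?_)
      refine ih (e := h.I .start q) (by simpa) (by simpa) (by simpa) (by simpa)
        (by simpa [hq] using hl.2) (by simpa using h5) (h2.le.trans heE) ?_ ?_
      · intro j hj hjE r hr
        rcases lt_or_ge j e with hje | hje
        · have := line_sub_mono (val := val) (cc := cc) hcc0 (hS q h3) hj
          have := h4 j hj hje r hr
          linarith
        · exact hdom j hje hjE r hr
      · intro h' c' L' e' hf a1 a2 a3 a4 a5 a6
        refine hQ h' c' L' e' ((Frame.refl _ _ h).setI.trans hf) a1 (by simpa using a2) a3 a4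
          (by simpa using a5) ?_
        simp only [List.length_cons]; omega
    · refine wp_while_false (by simpa [hq, r1, r2] using hb) ?_
      refine hQ _ _ (q :: L) e (Frame.refl _ _ _) hl he heE hdom ?_ (by ring)
      intro r hr
      simp only [List.head?_cons, Option.mem_def, Option.some.injEq] at hr
      subst hr
      exact not_le.1 hb

/-- After the removals, `p` loses at the start of the top line, if there is one. Its value at `E -
1` then decides whether it wins on a final segment or nowhere; with an empty stack it wins
everywhere. Twice the stack length serves as potential, so the amortised cost is constant. -/
theorem wp_push {ω : Draws d n} (hcc0 : 0 ≤ cc) (hS : ∀ q ∈ S, cell q ≤ cell p) (hpS : p ∉ S)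
    {L : List ℕ} {h : Mem d n} {c b : ℕ} {Q : Mem d n → ℕ → Prop} (hE : 0 < E)
    (hval : h.R .val = val) (hcell : h.I .cell = cell) (hcc : h.R .c 0 = cc) (hhE : h.I .E 0 = E)
    (hp : h.I .ord (h.I .t 0) = p) (hb : h.I .col p = b)
    (hl : IsLinked (h.I .below) (h.I .top b) L)
    (he : (S = ∅ ∧ L = []) ∨ Env (line val cell cc) (h.I .start) S L E)
    (hQ : ∀ h' c' L', Frame [.p, .b, .q, .below, .start, .top] [] h h' →
      IsLinked (h'.I .below) (h'.I .top b) L' →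
      Env (line val cell cc) (h'.I .start) (insert p S) L' E →
      (∀ i : ℤ, i ≠ p → h'.I .below i = h.I .below i ∧ h'.I .start i = h.I .start i) →
      (∀ i : ℤ, i ≠ b → h'.I .top i = h.I .top i) →
      c' + 2 * L'.length ≤ c + 2 * L.length + 12 → Q h' c') :
    WP ω (pushP d) h c Q := by
  refine wp_seq (wp_iset (wp_seq (wp_iset (wp_seq (wp_iset (wp_seq ?_))))))
  -- For a column without lines the envelope ends at `0`, and domination over the empty set is
  -- vacuous.
  have he' : ∃ e, e ≤ E ∧ Env (line val cell cc) (h.I .start) S L e ∧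
      ∀ j, e ≤ j → j < E → ∀ q ∈ S, line val cell cc q j ≤ line val cell cc p j := by
    rcases he with ⟨rfl, rfl⟩ | he
    · exact ⟨0, hE.le, rfl, by simp⟩
    · exact ⟨E, le_rfl, he, fun j hj hj' => absurd hj (not_le.2 hj')⟩
  obtain ⟨e, heE, henv, hdom⟩ := he'
  refine wp_pop (val := val) (cell := cell) (cc := cc) (S := S) (p := p) hcc0 hS L (e := e)
    (by simpa) (by simpa) (by simpa) (by simp [hp]) (by simpa [hp, hb] using hl)
    (by simpa using henv) heE hdom ?_
  intro h1 c1 L1 e1 hf1 a1 a2 a3 a4 a5 a6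
  simp only [Mem.setI_I, ne_eq, reduceCtorEq, not_false_eq_true, Function.update_of_ne] at a2 a5
  have hf : Frame [.p, .b, .q] [] h h1 := (Frame.refl _ _ h).setI.setI.setI.trans hf1
  have g1 : h1.I .p 0 = p := by rw [hf1.I .p (by simp)]; simp [hp]
  have g2 : h1.I .b 0 = b := by rw [hf1.I .b (by simp)]; simp [hp, hb]
  have g3 : h1.I .E 0 = E := by rw [hf.I .E (by simp), hhE]
  have g4 : h1.R .val = val := by rw [hf.R .val (by simp), hval]
  have g5 : h1.I .cell = cell := by rw [hf.I .cell (by simp), hcell]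
  have g6 : h1.R .c 0 = cc := by rw [hf.R .c (by simp), hcc]
  have g7 : h1.I .below = h.I .below := hf.I _ (by simp)
  have g8 : h1.I .start = h.I .start := hf.I _ (by simp)
  have g9 : h1.I .top = h.I .top := hf.I _ (by simp)
  cases L1 with
  | nil =>
    have hq : h1.I .q 0 = -1 := a1
    have he0 : e1 = 0 := a2
    subst he0
    refine wp_ite (by simp [hq]) fun _ => wp_seq (wp_iset (wp_seq (wp_iset (wp_iset ?_))))
    refine hQ _ _ [p] ?_ ?_ ?_ ?_ ?_ ?_
    · exact hf.weaken.setI.setI.setI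
    · simp [IsLinked, g1, g2, hq]
    · simp only [Env, Mem.setI_I, Mem.ie_isc, g1]
      refine ⟨by simp, by simpa, by simp, ?_, by simp⟩
      rintro j hj hjE r (rfl | hr)
      · exact le_rfl
      · exact a4 j (by simpa using hj) hjE r hr
    · intro i hi; simp [g1, hi, g7, g8]
    · intro i hi; simp [g2, hi, g9]
    · simp only [List.length_cons, List.length_nil] at a6 ⊢; omega
  | cons q L1 =>
    have hq : h1.I .q 0 = q := a1.1
    have a5' := a5 q (by simp)
    obtain ⟨b1, b2, b3, b4, b5⟩ := id a2
    have hpL : p ∉ q :: L1 := fun hm => hpS (a2.mem p hm)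
    have hpq : (q : ℤ) ≠ p := by
      simp only [List.mem_cons, not_or] at hpL
      exact_mod_cast Ne.symm hpL.1
    have r1 := re_lineE (je := .sub (isc .E) (.const 1)) g4 g5 g6
      (pe := isc .q) (p := q) (by simp [hq])
    have r2 := re_lineE (je := .sub (isc .E) (.const 1)) g4 g5 g6
      (pe := isc .p) (p := p) (by simp [g1])
    simp only [Mem.ie_sub, Mem.ie_isc, g3, Mem.ie_const] at r1 r2
    refine wp_ite (fun _ => wp_ite (fun ht => ?_) (fun ht => ?_)) (by simp [hq])
    · simp only [Mem.te_realLe, r1, r2] at ht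
      -- The machine has a floor but no ceiling; the start is therefore computed as minus the floor
      -- of the negated crossing point.
      set x := (val p - val q) / (cc * ((cell p : ℝ) - cell q)) with hx
      have hs : -⌊x⌋ = ⌈(val q - val p) / (cc * ((cell p : ℝ) - cell q))⌉ := by
        rw [← Int.ceil_neg, hx, ← neg_div, neg_sub]
      obtain ⟨s1, s2, s3, s4⟩ := line_cross hcc0 (hS q b3) a5' ht hs
      refine wp_seq (wp_fset (wp_seq (wp_iset (wp_seq (wp_iset (wp_iset ?_))))))
      have hx' : h1.re (.div (.sub (rget (RVar.val : RVar d) (isc .p)) (rget (RVar.val : RVar d) (isc .q)))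
            (.mul (rsc (RVar.c : RVar d))
              (.ofInt (.sub (iget .cell (isc .p)) (iget .cell (isc .q)))))) = x := by
        simp [g1, hq, g4, g5, g6, hx]
      rw [hx']
      refine hQ _ _ (p :: q :: L1) ?_ ?_ ?_ ?_ ?_ ?_
      · exact hf.weaken.setI.setI.setI.setI
      · have a1' := a1.cons_update hpL
        simpa [g1, g2] using a1'
      · simp only [Mem.setI_I, ne_eq, reduceCtorEq, not_false_eq_true, Function.update_of_ne,
          Mem.ie_isc, g1, Function.update_self, Mem.ie_sub, Mem.ie_const, Mem.ie_iget, zero_sub,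
          Function.update_idem]
        refine ⟨by rw [Function.update_self]; omega, by rw [Function.update_self]; omega, by simp,
          ?_, ?_⟩
        · rw [Function.update_self]
          rintro j hj hjE r (rfl | hr)
          · exact le_rfl
          · rcases lt_or_ge j e1 with hje | hje
            · exact (b4 j (by omega) hje r hr).trans (s3 j hj)
            · exact a4 j hje hjE r hr
        · rw [Function.update_self, Env, Function.update_of_ne hpq, g8]
          refine ⟨b1, s1, Or.inr b3, ?_, ?_⟩
          -- The segment of `p` has to reach down to the end `e1` of the old envelope without a gap.
          -- Otherwise `e1 < E`, where `p` is already known to dominate `q`, so the crossing cannot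
          -- come later.
          · have hse : -⌊x⌋ ≤ e1 := by
              by_contra hcon
              have h3 := a4 e1 le_rfl (by omega) q b3
              have h4 := s4 e1 (by omega)
              have h5 := (s4 (e1 - 1) (by omega))
              have hcr : ∀ k : ℤ, line val cell cc q k ≤ line val cell cc p k → -⌊x⌋ ≤ k := by
                intro k hk
                by_cases hik : h.I .start q ≤ k
                · exact (line_cross hcc0 (hS q b3) a5' hk hs).2.1
                · have := line_sub_mono (val := val) hcc0 (hS q b3) (not_le.1 hik).le
                  linarith
              exact hcon (hcr e1 h3)
            rintro j hj hjs r (rfl | hr)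
            · exact s4 j hjs
            · exact b4 j hj (by omega) r hr
          · refine (b5.insert fun j hj => ⟨q, b3, ?_⟩).update
              (fun hm => hpL (List.mem_cons_of_mem _ hm)) _
            have := line_sub_mono (val := val) hcc0 (hS q b3) hj.le
            linarith
      · intro i hi; simp [g1, hi, g7, g8]
      · intro i hi; simp [g2, hi, g9]
      · simp only [List.length_cons] at a6 ⊢; omega
    · simp only [Mem.te_realLe, r1, r2, not_le] at ht
      -- If `p` loses at `E - 1`, nothing was removed: a removal would have made `p` dominate there.
      have hee : e1 = E := by
        by_contra hne
        exact absurd (a4 (E - 1) (by omega) (by omega) q b3) (not_le.2 ht)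
      subst hee
      refine wp_iset (hQ _ _ (q :: L1) ?_ ?_ ?_ ?_ ?_ ?_)
      · exact hf.weaken.setI
      · simpa [g2, hq] using a1
      · simp only [Mem.setI_I, ne_eq, reduceCtorEq, not_false_eq_true, Function.update_of_ne, g8]
        refine a2.insert fun j hj => ⟨q, b3, ?_⟩
        have := line_sub_mono (val := val) hcc0 (hS q b3) (show j ≤ e1 - 1 by omega)
        linarith
      · intro i hi; simp [g7, g8]
      · intro i hi; simp [g2, hi, g9]
      · omega

end Push

/-! ### One stage: the discrete transform along one coordinate -/

/-- The machine has no integer division; digits of keys are extracted by a real division and a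
floor. -/
theorem floor_natCast_div (a b : ℕ) : ⌊(a : ℝ) / (b : ℝ)⌋ = ((a / b : ℕ) : ℤ) := by
  rw [← Nat.floor_div_eq_div (K := ℝ), Int.natCast_floor_eq_floor (by positivity)]

/-- Split the keys into column, cell, and the two digits of the cell. -/
def splitP : Prog :=
  forP .t (isc .N)
    (.seq (fset .col (isc .t) (.div (.ofInt (iget .key (isc .t))) (.ofInt (isc .F))))
    (.seq (iset .cell (isc .t)
      (.sub (iget .key (isc .t)) (.mul (isc .F) (iget .col (isc .t)))))
    (.seq (fset .hi (isc .t) (.div (.ofInt (iget .cell (isc .t))) (.ofInt (isc .E))))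
    (.seq (iset .lo (isc .t)
      (.sub (iget .cell (isc .t)) (.mul (isc .E) (iget .hi (isc .t)))))
      (iset .ord (isc .t) (isc .t))))))

theorem wp_split {ω : Draws d n} {h : Mem d n} {c E F N : ℕ} {key : ℕ → ℕ} (hE : h.I .E 0 = E)
    (hF : h.I .F 0 = F) (hN : h.I .N 0 = N) (hkey : ∀ t < N, h.I .key (t : ℕ) = key t) :
    WP ω splitP h c fun h' c' => Frame [.t, .col, .cell, .hi, .lo, .ord] [] h h' ∧
      (∀ t < N, h'.I .col (t : ℕ) = (key t / F : ℕ) ∧ h'.I .cell (t : ℕ) = (key t % F : ℕ) ∧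
        h'.I .hi (t : ℕ) = (key t % F / E : ℕ) ∧ h'.I .lo (t : ℕ) = (key t % F % E : ℕ)) ∧
      IsArr (h'.I .ord) (List.range N) ∧ c' = c + 7 * N + 2 := by
  refine wp_for N (fun k h' c' => h'.I .t 0 = k ∧
    Frame [.t, .col, .cell, .hi, .lo, .ord] [] h h' ∧
      (∀ t < k, h'.I .col (t : ℕ) = (key t / F : ℕ) ∧ h'.I .cell (t : ℕ) = (key t % F : ℕ) ∧
        h'.I .hi (t : ℕ) = (key t % F / E : ℕ) ∧ h'.I .lo (t : ℕ) = (key t % F % E : ℕ)) ∧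
      IsArr (h'.I .ord) (List.range k) ∧ c' = c + 7 * k + 1) ?_ ?_ ?_ ?_
  · exact ⟨by simp, (Frame.refl _ _ h).setI, by simp, fun t ht => by simp at ht, by simp⟩
  · rintro k h' c' - ⟨h1, hf, -⟩
    exact ⟨h1, by simp [hf.I .N (by simp), hN]⟩
  · rintro k h' c' hk ⟨h1, hf, h2, h3, rfl⟩
    refine wp_seq (wp_fset (wp_seq (wp_iset (wp_seq (wp_fset (wp_seq (wp_iset (wp_iset ?_))))))))
    have e1 : h'.I .key (k : ℕ) = key k := by rw [hf.I .key (by simp), hkey k hk]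
    have e2 : h'.I .F 0 = F := by rw [hf.I .F (by simp), hF]
    have e3 : h'.I .E 0 = E := by rw [hf.I .E (by simp), hE]
    have d1 : (key k : ℤ) - F * (key k / F : ℕ) = (key k % F : ℕ) := by
      have := Nat.div_add_mod (key k) F
      push_cast at this ⊢; zify at this; linarith
    have d2 : ((key k % F : ℕ) : ℤ) - E * (key k % F / E : ℕ) = (key k % F % E : ℕ) := by
      have := Nat.div_add_mod (key k % F) E
      zify at this; push_cast; linarith
    have f1 := floor_natCast_div (key k) F
    have f2 := floor_natCast_div (key k % F) E
    refine ⟨by simp [h1], hf.setI.setI.setI.setI.setI.setI, ?_, ?_, by ring⟩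
    · intro t ht
      simp only [Mem.setI_I, ne_eq, reduceCtorEq, not_false_eq_true, Function.update_of_ne,
        Mem.ie_isc, h1, Function.update_self, Mem.ie_sub, Mem.ie_mul, Mem.ie_iget, e1, e2, e3,
        Mem.re_div, Mem.re_ofInt, Int.cast_natCast, f1, d1, f2, d2]
      rcases Nat.lt_succ_iff_lt_or_eq.1 ht with ht | rfl
      · have hne : (t : ℤ) ≠ k := by exact_mod_cast ht.ne
        simp only [Function.update_of_ne hne]
        exact h2 t ht
      · simp only [Function.update_self, and_self]
    · rw [List.range_succ]
      have := h3.snoc (t := k) (p := k) (x := k) (by simp) rfl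
      simpa [h1] using this
  · rintro h' c' ⟨-, hf, h2, h3, rfl⟩
    exact ⟨hf, h2, h3, by ring⟩

/-- Empty the stacks of all columns. -/
def clearTopP : Prog := forP .b (isc .Nc) (iset .top (isc .b) (.const (-1)))

theorem wp_clearTop {ω : Draws d n} {h : Mem d n} {c Nc : ℕ} (hN : h.I .Nc 0 = Nc) :
    WP ω clearTopP h c fun h' c' => Frame [.b, .top] [] h h' ∧
      (∀ b < Nc, h'.I .top (b : ℕ) = -1) ∧ c' = c + 3 * Nc + 2 := by
  refine wp_for Nc (fun k h' c' => h'.I .b 0 = k ∧ Frame [.b, .top] [] h h' ∧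
    (∀ b < k, h'.I .top (b : ℕ) = -1) ∧ c' = c + 1 + 3 * k) ?_ ?_ ?_ ?_
  · exact ⟨by simp, (Frame.refl _ _ h).setI, by simp, rfl⟩
  · rintro k h' c' - ⟨h1, hf, -⟩
    exact ⟨h1, by simp [hf.I .Nc (by simp), hN]⟩
  · rintro k h' c' hk' ⟨h1, hf, h2, rfl⟩
    refine wp_iset ⟨by simp [h1], hf.setI.setI, ?_, by ring⟩
    intro b hb
    simp only [Mem.setI_I, Mem.ie_isc, h1]
    rcases Nat.lt_succ_iff_lt_or_eq.1 hb with hb | rfl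
    · have := hb.ne
      simp [this, h2 b hb]
    · simp
  · rintro h' c' ⟨-, hf, h2, rfl⟩
    exact ⟨hf, h2, by ring⟩

/-- Add all lines to the envelopes of their columns, by increasing slope. -/
def pushAllP (d : ℕ) : Prog := forP .t (isc .N) (pushP d)

/-- One global order by slope serves all columns at once. The arrays `below` and `start` are indexed
by items, and different columns have disjoint items, so a push leaves the other stacks valid. The
potential is twice the total length of all stacks. -/
theorem wp_pushAll {ω : Draws d n} {h : Mem d n} {c Nc N E : ℕ} {L : List ℕ} {col : ℕ → ℕ}
    {val : ℤ → ℝ} {cell : ℤ → ℤ} {cc : ℝ} (hcc0 : 0 ≤ cc) (hE0 : 0 < E)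
    (hval : h.R .val = val) (hcell : h.I .cell = cell) (hcc : h.R .c 0 = cc) (hE : h.I .E 0 = E)
    (hN : h.I .N 0 = N) (hLN : L.length = N) (hL : IsArr (h.I .ord) L) (hnd : L.Nodup)
    (hcol : ∀ p ∈ L, h.I .col p = col p ∧ col p < Nc)
    (hsort : L.Pairwise fun p q : ℕ => cell p ≤ cell q) (htop : ∀ b < Nc, h.I .top (b : ℕ) = -1) :
    WP ω (pushAllP d) h c fun h' c' => Frame [.t, .p, .b, .q, .below, .start, .top] [] h h' ∧
      (∀ b < Nc, ∃ l, IsLinked (h'.I .below) (h'.I .top (b : ℕ)) l ∧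
        (({p | p ∈ L ∧ col p = b} = ∅ ∧ l = []) ∨
          Env (line val cell cc) (h'.I .start) {p | p ∈ L ∧ col p = b} l E)) ∧
      c' ≤ c + 14 * N + 2 := by
  refine wp_for N (fun k h' c' => h'.I .t 0 = k ∧
    Frame [.t, .p, .b, .q, .below, .start, .top] [] h h' ∧
    ∃ Ls : ℕ → List ℕ, (∀ b < Nc, IsLinked (h'.I .below) (h'.I .top (b : ℕ)) (Ls b) ∧
        (({p | p ∈ L.take k ∧ col p = b} = ∅ ∧ Ls b = []) ∨
          Env (line val cell cc) (h'.I .start) {p | p ∈ L.take k ∧ col p = b} (Ls b) E)) ∧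
      c' + 2 * ∑ b ∈ Finset.range Nc, (Ls b).length ≤ c + 14 * k + 1) ?_ ?_ ?_ ?_
  · exact ⟨by simp, (Frame.refl _ _ h).setI, fun _ => [], by simpa [IsLinked] using htop, by simp⟩
  · rintro k h' c' - ⟨h1, hf, -⟩
    exact ⟨h1, by simp [hf.I .N (by simp), hN]⟩
  · rintro k h' c' hk ⟨h1, hf, Ls, h2, h3⟩
    have hk' : k < L.length := by omega
    set p := L[k] with hp
    have hpL : p ∈ L := List.getElem_mem _
    obtain ⟨hcp, hcpN⟩ := hcol p hpL
    have htake : L.take (k + 1) = L.take k ++ [p] := by simp [hp]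
    have hpt : p ∉ L.take k := by
      have := hnd.sublist (List.take_sublist (k + 1) L)
      rw [htake, List.nodup_append] at this
      intro hm
      exact this.2.2 p hm p (by simp) rfl
    have hS : ∀ q ∈ {q | q ∈ L.take k ∧ col q = col p}, cell q ≤ cell p := by
      rintro q ⟨hq, -⟩
      have := hsort.sublist (List.take_sublist (k + 1) L)
      rw [htake, List.pairwise_append] at this
      exact this.2.2 q hq p (by simp)
    obtain ⟨a1, a2⟩ := h2 (col p) hcpN
    refine wp_push (val := val) (cell := cell) (cc := cc) (E := E) (b := col p)
      (S := {q | q ∈ L.take k ∧ col q = col p}) hcc0 hS (fun hm => hpt hm.1)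
      (by exact_mod_cast hE0) (by rw [hf.R _ (by simp), hval]) (by rw [hf.I _ (by simp), hcell])
      (by rw [hf.R _ (by simp), hcc]) (by rw [hf.I _ (by simp), hE])
      (by rw [h1, hf.I _ (by simp), hL k hk']) (by rw [hf.I _ (by simp), hcp]) a1 a2 ?_
    intro h'' c'' L' hf' b1 b2 b3 b4 b5
    have e1 : h''.I .t 0 = k := by rw [hf'.I _ (by simp), h1]
    refine ⟨by simp [e1], (hf.trans hf').setI, Function.update Ls (col p) L', ?_, ?_⟩
    · intro b hb
      simp only [Mem.setI_I, ne_eq, reduceCtorEq, not_false_eq_true, Function.update_of_ne]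
      by_cases hbp : b = col p
      · subst hbp
        rw [Function.update_self]
        refine ⟨b1, Or.inr ?_⟩
        convert b2 using 1
        ext q
        simp only [htake, List.mem_append, List.mem_singleton, Set.mem_ofPred_eq, Set.mem_insert_iff]
        constructor
        · rintro ⟨h | h, h'⟩
          · exact Or.inr ⟨h, h'⟩
          · exact Or.inl h
        · rintro (rfl | h)
          · exact ⟨Or.inr rfl, rfl⟩
          · exact ⟨Or.inl h.1, h.2⟩
      · rw [Function.update_of_ne hbp]
        obtain ⟨g1, g2⟩ := h2 b hb
        have hSS : {q | q ∈ L.take (k + 1) ∧ col q = b} = {q | q ∈ L.take k ∧ col q = b} := by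
          ext q
          simp only [htake, List.mem_append, List.mem_singleton, Set.mem_ofPred_eq]
          constructor
          · rintro ⟨h | rfl, h'⟩
            · exact ⟨h, h'⟩
            · exact absurd h'.symm hbp
          · exact fun h => ⟨Or.inl h.1, h.2⟩
        have hpl : p ∉ Ls b := by
          rcases g2 with ⟨-, g2⟩ | g2
          · simp [g2]
          · exact fun hm => hpt (g2.mem p hm).1
        have u1 : h''.I .below = Function.update (h'.I .below) p (h''.I .below p) := by
          funext i
          by_cases hi : i = p
          · subst hi; simp
          · rw [Function.update_of_ne hi, (b3 i hi).1]
        have u2 : h''.I .start = Function.update (h'.I .start) p (h''.I .start p) := by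
          funext i
          by_cases hi : i = p
          · subst hi; simp
          · rw [Function.update_of_ne hi, (b3 i hi).2]
        rw [hSS, u1, u2, b4 b (by exact_mod_cast hbp)]
        exact ⟨g1.update hpl _, g2.imp_right fun g => g.update hpl _⟩
    -- Only the stack of the column of `p` changes length; the amortised `12` of a push and the `2`
    -- of the loop give `14`.
    · have hsum : ∑ b ∈ Finset.range Nc, (Function.update Ls (col p) L' b).length + (Ls (col p)).length
          = ∑ b ∈ Finset.range Nc, (Ls b).length + L'.length := by
        have hm : col p ∈ Finset.range Nc := Finset.mem_range.2 hcpN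
        rw [← Finset.add_sum_erase _ _ hm, ← Finset.add_sum_erase _ (fun b => (Ls b).length) hm,
          Function.update_self]
        rw [Finset.sum_congr rfl fun b hb => by
          rw [Function.update_of_ne (Finset.ne_of_mem_erase hb)]]
        ring
      omega
  · rintro h' c' ⟨-, hf, Ls, h2, h3⟩
    rw [← hLN, List.take_length] at h2
    exact ⟨hf, fun b hb => ⟨Ls b, h2 b hb⟩, by omega⟩

/-- Output the maximal lines of column `b`, at the integers `E - 1, …, 0`. -/
def flushColP (d : ℕ) : Prog :=
  forP .j (isc .E)
    (.seq (iset .q (.const 0) (iget .top (isc .b)))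
    (.seq (iset .i (.const 0) (.sub (.sub (isc .E) (.const 1)) (isc .j)))
    (.seq (iset .okey (isc .cnt) (.add (isc .b) (.mul (isc .Nc) (isc .i))))
    (.seq (iset .oid (isc .cnt) (iget .id (isc .q)))
    (.seq (rset (RVar.oval : RVar d) (isc .cnt) (lineE d (isc .q) (isc .i)))
    (.seq (iset .cnt (.const 0) (.add (isc .cnt) (.const 1)))
      (.ite (.intLe (isc .i) (iget .start (isc .q)))
        (iset .top (isc .b) (iget .below (isc .q))) .skip)))))))

/-- The integers are visited downwards, since the top line is the optimal one on the last interval.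
It is removed when its start is reached, and after `k` iterations the stack is the envelope on `[0,
E - k)`. -/
theorem wp_flushCol {ω : Draws d n} {h : Mem d n} {c Nc E b M : ℕ} {L : List ℕ} {S : Set ℕ}
    {val : ℤ → ℝ} {cell : ℤ → ℤ} {cc : ℝ} (hval : h.R .val = val)
    (hcell : h.I .cell = cell) (hcc : h.R .c 0 = cc) (hE : h.I .E 0 = E)
    (hNc : h.I .Nc 0 = Nc) (hb : h.I .b 0 = b) (hM : h.I .cnt 0 = M)
    (hl : IsLinked (h.I .below) (h.I .top b) L)
    (he : Env (line val cell cc) (h.I .start) S L E) :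
    WP ω (flushColP d) h c fun h' c' =>
      Frame [.j, .q, .i, .okey, .oid, .cnt, .top] [.oval] h h' ∧
      h'.I .cnt 0 = (M + E : ℕ) ∧ (∀ i : ℤ, i ≠ b → h'.I .top i = h.I .top i) ∧
      (∀ s < M, h'.I .okey (s : ℕ) = h.I .okey (s : ℕ) ∧ h'.I .oid (s : ℕ) = h.I .oid (s : ℕ) ∧
        h'.R .oval (s : ℕ) = h.R .oval (s : ℕ)) ∧
      (∀ t < E, h'.I .okey (M + t : ℕ) = (b + Nc * (E - 1 - t) : ℕ) ∧
        ∃ q ∈ S, h'.I .oid (M + t : ℕ) = h.I .id q ∧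
          h'.R .oval (M + t : ℕ) = line val cell cc q (E - 1 - t : ℕ) ∧
          ∀ p ∈ S, line val cell cc p (E - 1 - t : ℕ) ≤ line val cell cc q (E - 1 - t : ℕ)) ∧
      c' = c + 10 * E + 2 := by
  refine wp_for E (fun k h' c' => h'.I .j 0 = k ∧
      Frame [.j, .q, .i, .okey, .oid, .cnt, .top] [.oval] h h' ∧
      h'.I .cnt 0 = (M + k : ℕ) ∧ (∀ i : ℤ, i ≠ b → h'.I .top i = h.I .top i) ∧
      (∀ s < M, h'.I .okey (s : ℕ) = h.I .okey (s : ℕ) ∧ h'.I .oid (s : ℕ) = h.I .oid (s : ℕ) ∧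
        h'.R .oval (s : ℕ) = h.R .oval (s : ℕ)) ∧
      (∀ t < k, h'.I .okey (M + t : ℕ) = (b + Nc * (E - 1 - t) : ℕ) ∧
        ∃ q ∈ S, h'.I .oid (M + t : ℕ) = h.I .id q ∧
          h'.R .oval (M + t : ℕ) = line val cell cc q (E - 1 - t : ℕ) ∧
          ∀ p ∈ S, line val cell cc p (E - 1 - t : ℕ) ≤ line val cell cc q (E - 1 - t : ℕ)) ∧
      c' = c + 10 * k + 1 ∧ ∃ l, IsLinked (h.I .below) (h'.I .top b) l ∧
        Env (line val cell cc) (h.I .start) S l (E - k : ℕ)) ?_ ?_ ?_ ?_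
  · exact ⟨by simp, (Frame.refl _ _ h).setI, by simp [hM], by simp, by simp, by simp, by simp,
      L, by simpa using hl, by simpa using he⟩
  · rintro k h' c' - ⟨h1, hf, -⟩
    exact ⟨h1, by simp [hf.I .E (by simp), hE]⟩
  · rintro k h' c' hk ⟨h1, hf, h2, h3, h4, h5, rfl, l, h6, h7⟩
    cases l with
    | nil => simp only [Env] at h7; omega
    | cons q l =>
      obtain ⟨g1, g2, g3, g4, g5⟩ := h7
      have e0 : h'.I .b 0 = b := by rw [hf.I _ (by simp), hb]
      have e1 : h'.I .top b = q := h6.1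
      have e2 : h'.I .E 0 = E := by rw [hf.I _ (by simp), hE]
      have e3 : h'.I .Nc 0 = Nc := by rw [hf.I _ (by simp), hNc]
      have e4 : h'.I .below = h.I .below := by rw [hf.I _ (by simp)]
      have e5 : h'.I .start = h.I .start := by rw [hf.I _ (by simp)]
      have e6 : h'.I .id = h.I .id := by rw [hf.I _ (by simp)]
      have e7 : h'.R .val = val := by rw [hf.R _ (by simp), hval]
      have e8 : h'.R .c 0 = cc := by rw [hf.R _ (by simp), hcc]
      have e9 : h'.I .cell = cell := by rw [hf.I _ (by simp), hcell]
      have ei : (E : ℤ) - 1 - k = (E - 1 - k : ℕ) := by omega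
      refine wp_seq (wp_iset (wp_seq (wp_iset (wp_seq (wp_iset (wp_seq (wp_iset (wp_seq
        (wp_rset (wp_seq (wp_iset ?_)))))))))))
      rw [re_lineE (val := val) (cell := cell) (cc := cc) (p := q) (by simpa) (by simpa)
        (by simpa) (by simp [e0, e1])]
      have key : ∀ (h'' : Mem d n) (c'' : ℕ), (h''.I .j 0 = k ∧
          Frame [.j, .q, .i, .okey, .oid, .cnt, .top] [.oval] h h'' ∧
          h''.I .cnt 0 = (M + k : ℕ) + 1 ∧ h''.I .okey = Function.update (h'.I .okey) (M + k : ℕ)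
            (b + Nc * (E - 1 - k) : ℕ) ∧
          h''.I .oid = Function.update (h'.I .oid) (M + k : ℕ) (h.I .id q) ∧
          h''.R .oval = Function.update (h'.R .oval) (M + k : ℕ)
            (line val cell cc q (E - 1 - k : ℕ)) ∧
          (∀ i : ℤ, i ≠ b → h''.I .top i = h'.I .top i) ∧
          c'' = c + 10 * k + 10 ∧ ∃ l, IsLinked (h.I .below) (h''.I .top b) l ∧
            Env (line val cell cc) (h.I .start) S l (E - (k + 1) : ℕ)) →
          (h''.setI .j 0 (h''.I .j 0 + 1)).I .j 0 = (k + 1 : ℕ) ∧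
          Frame [.j, .q, .i, .okey, .oid, .cnt, .top] [.oval] h (h''.setI .j 0 (h''.I .j 0 + 1)) ∧
          (h''.setI .j 0 (h''.I .j 0 + 1)).I .cnt 0 = (M + (k + 1) : ℕ) ∧
          (∀ i : ℤ, i ≠ b → (h''.setI .j 0 (h''.I .j 0 + 1)).I .top i = h.I .top i) ∧
          (∀ s < M, (h''.setI .j 0 (h''.I .j 0 + 1)).I .okey (s : ℕ) = h.I .okey (s : ℕ) ∧
            (h''.setI .j 0 (h''.I .j 0 + 1)).I .oid (s : ℕ) = h.I .oid (s : ℕ) ∧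
            (h''.setI .j 0 (h''.I .j 0 + 1)).R .oval (s : ℕ) = h.R .oval (s : ℕ)) ∧
          (∀ t < k + 1, (h''.setI .j 0 (h''.I .j 0 + 1)).I .okey (M + t : ℕ) =
              (b + Nc * (E - 1 - t) : ℕ) ∧
            ∃ q ∈ S, (h''.setI .j 0 (h''.I .j 0 + 1)).I .oid (M + t : ℕ) = h.I .id q ∧
              (h''.setI .j 0 (h''.I .j 0 + 1)).R .oval (M + t : ℕ) =
                line val cell cc q (E - 1 - t : ℕ) ∧
              ∀ p ∈ S, line val cell cc p (E - 1 - t : ℕ) ≤ line val cell cc q (E - 1 - t : ℕ)) ∧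
          c'' + 1 = c + 10 * (k + 1) + 1 ∧
          ∃ l, IsLinked (h.I .below) ((h''.setI .j 0 (h''.I .j 0 + 1)).I .top b) l ∧
            Env (line val cell cc) (h.I .start) S l (E - (k + 1) : ℕ) := by
        rintro h'' c'' ⟨a1, a2, a3, a4, a5, a6, a7, rfl, l', a8, a9⟩
        simp only [Mem.setI_I, ne_eq, reduceCtorEq, not_false_eq_true, Function.update_of_ne,
          Function.update_self, Mem.setI_R, a4, a5, a6]
        refine ⟨by rw [a1]; push_cast; ring, a2.setI, by rw [a3]; push_cast; ring,
          fun i hi => (a7 i hi).trans (h3 i hi), ?_, ?_, by ring, l', a8, a9⟩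
        · intro s hs
          have hne : (s : ℤ) ≠ (M + k : ℕ) := by omega
          simp only [Function.update_of_ne hne]
          exact h4 s hs
        · intro t ht
          rcases Nat.lt_succ_iff_lt_or_eq.1 ht with ht | rfl
          · have hne : ((M + t : ℕ) : ℤ) ≠ (M + k : ℕ) := by omega
            simp only [Function.update_of_ne hne]
            exact h5 t ht
          · simp only [Function.update_self, true_and]
            exact ⟨q, g3, rfl, rfl, fun p hp => g4 _ (by omega) (by omega) p hp⟩
      refine wp_ite (fun ht => wp_iset (key _ _ ?_)) (fun ht => wp_skip (key _ _ ?_))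
      · simp [e0, e1, h1, e2, e5, ei] at ht
        refine ⟨by simp [h1], hf.setI.setI.setI.setI.setR.setI.setI, by simp [h2],
          by simp [h2, h1, e0, e2, e3, ei], by simp [h2, e0, e1, e6],
          by simp [h2, h1, e2, ei], fun i hi => by simp [e0, hi], by ring, l, ?_, ?_⟩
        · simp [e0, e1, e4]
          simpa [e4] using h6.2
        · have : h.I .start q = (E - (k + 1) : ℕ) := by omega
          rw [← this]; exact g5
      · simp [e0, e1, h1, e2, e5, ei] at ht
        refine ⟨by simp [h1], hf.setI.setI.setI.setI.setR.setI, by simp [h2],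
          by simp [h2, h1, e0, e2, e3, ei], by simp [h2, e0, e1, e6],
          by simp [h2, h1, e2, ei], fun i hi => by simp, by ring, q :: l, ?_, ?_⟩
        · simpa using h6
        · exact ⟨g1, by omega, g3, fun j hj hj' => g4 j hj (by omega), g5⟩
  · rintro h' c' ⟨-, hf, h2, h3, h4, h5, rfl, -⟩
    exact ⟨hf, h2, h3, h4, h5, by ring⟩

/-- Output the maximal lines of all columns. -/
def flushP (d : ℕ) : Prog :=
  .seq (iset .cnt (.const 0) (.const 0))
    (forP .b (isc .Nc) (.ite (.intLe (.const 0) (iget .top (isc .b))) (flushColP d) .skip))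

/-- Here the compression takes place: the number of results is bounded by `Nc * E`, however many
items there were. Empty columns contribute nothing. -/
theorem wp_flush {ω : Draws d n} {h : Mem d n} {c Nc E : ℕ} {S : ℕ → Set ℕ}
    {val : ℤ → ℝ} {cell : ℤ → ℤ} {cc : ℝ} (hval : h.R .val = val)
    (hcell : h.I .cell = cell) (hcc : h.R .c 0 = cc) (hE : h.I .E 0 = E) (hE0 : 0 < E)
    (hNc : h.I .Nc 0 = Nc)
    (H : ∀ b < Nc, ∃ l, IsLinked (h.I .below) (h.I .top (b : ℕ)) l ∧
      ((S b = ∅ ∧ l = []) ∨ Env (line val cell cc) (h.I .start) (S b) l E)) :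
    WP ω (flushP d) h c fun h' c' =>
      Frame [.b, .j, .q, .i, .okey, .oid, .cnt, .top] [.oval] h h' ∧ ∃ M : ℕ, M ≤ Nc * E ∧
      h'.I .cnt 0 = M ∧
      (∀ b < Nc, ∀ p ∈ S b, ∀ j < E, ∃ s < M, h'.I .okey (s : ℕ) = (b + Nc * j : ℕ) ∧
        line val cell cc p (j : ℕ) ≤ h'.R .oval (s : ℕ)) ∧
      (∀ s < M, ∃ b < Nc, ∃ q ∈ S b, ∃ j < E, h'.I .okey (s : ℕ) = (b + Nc * j : ℕ) ∧
        h'.I .oid (s : ℕ) = h.I .id q ∧ h'.R .oval (s : ℕ) = line val cell cc q (j : ℕ)) ∧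
      c' ≤ c + 6 * Nc + 10 * (Nc * E) + 3 := by
  refine wp_seq (wp_iset (wp_for Nc (fun k h' c' => h'.I .b 0 = k ∧
      Frame [.b, .j, .q, .i, .okey, .oid, .cnt, .top] [.oval] h h' ∧
      (∀ b : ℕ, k ≤ b → h'.I .top b = h.I .top b) ∧ ∃ M : ℕ, M ≤ k * E ∧
      h'.I .cnt 0 = M ∧
      (∀ b < k, ∀ p ∈ S b, ∀ j < E, ∃ s < M, h'.I .okey (s : ℕ) = (b + Nc * j : ℕ) ∧
        line val cell cc p (j : ℕ) ≤ h'.R .oval (s : ℕ)) ∧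
      (∀ s < M, ∃ b < k, ∃ q ∈ S b, ∃ j < E, h'.I .okey (s : ℕ) = (b + Nc * j : ℕ) ∧
        h'.I .oid (s : ℕ) = h.I .id q ∧ h'.R .oval (s : ℕ) = line val cell cc q (j : ℕ)) ∧
      c' ≤ c + 6 * k + 10 * (k * E) + 2) ?_ ?_ ?_ ?_))
  · exact ⟨by simp, (Frame.refl _ _ h).setI.setI, by simp, 0, by simp, by simp, by simp, by simp,
      by simp⟩
  · rintro k h' c' - ⟨h1, hf, -⟩
    exact ⟨h1, by simp [hf.I .Nc (by simp), hNc]⟩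
  · rintro k h' c' hk ⟨h1, hf, h2, M, h3, h4, h5, h6, h7⟩
    obtain ⟨l, g1, g2⟩ := H k hk
    have e1 : h'.I .top k = h.I .top k := h2 k le_rfl
    refine wp_ite (fun ht => ?_) (fun ht => wp_skip ?_)
    · simp [h1, e1] at ht
      have g3 : Env (line val cell cc) (h.I .start) (S k) l E := by
        rcases g2 with ⟨-, rfl⟩ | g2
        · rw [show h.I .top k = -1 from g1] at ht; omega
        · exact g2
      refine (wp_flushCol (val := val) (cell := cell) (cc := cc) (S := S k) (L := l) (E := E)
        (b := k) (M := M) (Nc := Nc)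
        (by rw [hf.R _ (by simp), hval]) (by rw [hf.I _ (by simp), hcell])
        (by rw [hf.R _ (by simp), hcc]) (by rw [hf.I _ (by simp), hE])
        (by rw [hf.I _ (by simp), hNc]) h1 h4 (by rw [hf.I .below (by simp), e1]; exact g1)
        (by rw [hf.I .start (by simp)]; exact g3)).mono ?_
      rintro h'' c'' ⟨hf', a1, a2, a3, a4, rfl⟩
      have e2 : h''.I .b 0 = k := by rw [hf'.I _ (by simp), h1]
      simp only [Mem.setI_I, ne_eq, reduceCtorEq, not_false_eq_true, Function.update_of_ne,
          Mem.setI_R]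
      refine ⟨by simp [e2], (hf.trans hf').setI, ?_, M + E, ?_, a1, ?_, ?_, ?_⟩
      · intro b hb
        rw [a2 b (by omega), h2 b (by omega)]
      · have : (k + 1) * E = k * E + E := by ring
        omega
      · intro b hb p hp j hj
        rcases Nat.lt_succ_iff_lt_or_eq.1 hb with hb | rfl
        · obtain ⟨s, hs, s1, s2⟩ := h5 b hb p hp j hj
          obtain ⟨b1, b2, b3⟩ := a3 s hs
          exact ⟨s, by omega, b1.trans s1, by rw [b3]; exact s2⟩
        · obtain ⟨b1, q, b2, b3, b4, b5⟩ := a4 (E - 1 - j) (by omega)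
          rw [show E - 1 - (E - 1 - j) = j by omega] at b1 b4 b5
          exact ⟨M + (E - 1 - j), by omega, b1, by rw [b4]; exact b5 p hp⟩
      · intro s hs
        rcases lt_or_ge s M with hsM | hsM
        · obtain ⟨b, hb, q, hq, j, hj, s1, s2, s3⟩ := h6 s hsM
          obtain ⟨b1, b2, b3⟩ := a3 s hsM
          exact ⟨b, by omega, q, hq, j, hj, b1.trans s1, b2.trans s2, b3.trans s3⟩
        · obtain ⟨t, rfl⟩ := Nat.exists_eq_add_of_le hsM
          obtain ⟨b1, q, b2, b3, b4, b5⟩ := a4 t (by omega)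
          refine ⟨k, by omega, q, b2, E - 1 - t, by omega, b1, ?_, b4⟩
          rw [b3, hf.I _ (by simp)]
      · have : (k + 1) * E = k * E + E := by ring
        omega
    · simp [h1, e1] at ht
      have g3 : S k = ∅ := by
        rcases g2 with ⟨g2, -⟩ | g2
        · exact g2
        · cases l with
          | nil => simp only [Env] at g2; omega
          | cons q l => rw [g1.1] at ht; omega
      simp only [Mem.setI_I, ne_eq, reduceCtorEq, not_false_eq_true, Function.update_of_ne,
          Mem.setI_R]
      refine ⟨by simp [h1], hf.setI, fun b hb => h2 b (by omega), M, ?_, h4, ?_, ?_, ?_⟩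
      · have : (k + 1) * E = k * E + E := by ring
        omega
      · intro b hb p hp j hj
        rcases Nat.lt_succ_iff_lt_or_eq.1 hb with hb | rfl
        · exact h5 b hb p hp j hj
        · simp [g3] at hp
      · intro s hs
        obtain ⟨b, hb, r⟩ := h6 s hs
        exact ⟨b, by omega, r⟩
      · have : (k + 1) * E = k * E + E := by ring
        omega
  · rintro h' c' ⟨-, hf, -, M, h3, h4, h5, h6, h7⟩
    exact ⟨hf, M, h3, h4, h5, h6, by omega⟩

/-- Make the output items the current items. -/
def copyP (d : ℕ) : Prog :=
  .seq (forP .t (isc .cnt)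
    (.seq (iset .key (isc .t) (iget .okey (isc .t)))
    (.seq (iset .id (isc .t) (iget .oid (isc .t)))
      (rset (RVar.val : RVar d) (isc .t) (rget (RVar.oval : RVar d) (isc .t))))))
  (iset .N (.const 0) (isc .cnt))

theorem wp_copy {ω : Draws d n} {h : Mem d n} {c M : ℕ} (hM : h.I .cnt 0 = M) :
    WP ω (copyP d) h c fun h' c' => Frame [.t, .key, .id, .N] [.val] h h' ∧ h'.I .N 0 = M ∧
      (∀ s < M, h'.I .key (s : ℕ) = h.I .okey (s : ℕ) ∧ h'.I .id (s : ℕ) = h.I .oid (s : ℕ) ∧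
        h'.R .val (s : ℕ) = h.R .oval (s : ℕ)) ∧ c' = c + 5 * M + 3 := by
  refine wp_seq (wp_for M (fun k h' c' => h'.I .t 0 = k ∧ Frame [.t, .key, .id] [.val] h h' ∧
    (∀ s < k, h'.I .key (s : ℕ) = h.I .okey (s : ℕ) ∧ h'.I .id (s : ℕ) = h.I .oid (s : ℕ) ∧
        h'.R .val (s : ℕ) = h.R .oval (s : ℕ)) ∧ c' = c + 5 * k + 1) ?_ ?_ ?_ ?_)
  · exact ⟨by simp, (Frame.refl _ _ h).setI, by simp, by simp⟩
  · rintro k h' c' - ⟨h1, hf, -⟩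
    exact ⟨h1, by simp [hf.I .cnt (by simp), hM]⟩
  · rintro k h' c' hk' ⟨h1, hf, h2, rfl⟩
    have e1 : h'.I .okey = h.I .okey := hf.I _ (by simp)
    have e2 : h'.I .oid = h.I .oid := hf.I _ (by simp)
    have e3 : h'.R .oval = h.R .oval := hf.R _ (by simp)
    refine wp_seq (wp_iset (wp_seq (wp_iset (wp_rset ⟨by simp [h1], hf.setI.setI.setR.setI,
      ?_, by ring⟩))))
    intro s hs
    simp only [Mem.setR_I, Mem.setI_I, Mem.setI_R, Mem.setR_R, Mem.ie_isc, Mem.ie_iget,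
      Mem.re_rget, ne_eq, reduceCtorEq, not_false_eq_true, Function.update_of_ne, h1, e1, e2, e3,
      Function.update_self]
    rcases Nat.lt_succ_iff_lt_or_eq.1 hs with hs | rfl
    · have hne : (s : ℤ) ≠ k := by omega
      simp only [Function.update_of_ne hne]
      exact h2 s hs
    · simp only [Function.update_self, and_self]
  · rintro h' c' ⟨-, hf, h2, rfl⟩
    have e1 : h'.I .cnt 0 = M := by rw [hf.I .cnt (by simp), hM]
    refine wp_iset ⟨hf.weaken.setI, by simp [e1], ?_, by ring⟩
    simpa using h2

/-- Transform the items along the coordinate that is the lowest digit of their keys; the new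
coordinate becomes the highest digit. -/
def stageP (d : ℕ) (Nc : IExp) : Prog :=
  .seq (iset .Nc (.const 0) Nc)
  (.seq splitP
  (.seq (passP .lo)
  (.seq (passP .hi)
  (.seq clearTopP
  (.seq (pushAllP d)
  (.seq (flushP d) (copyP d)))))))

/-- The integer variables changed by `stageP`. -/
def stageVars : List IVar :=
  [.Nc, .N, .cnt, .p, .q, .b, .t, .j, .i, .key, .id, .okey, .oid, .col, .cell, .lo, .hi, .ord,
    .nxt, .head, .top, .below, .start]

/-- Items with equal `key / (E * E)` form a column, and the digit `key % (E * E)` is the slope. The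
result is described by two halves: nothing is lost (some result is at least as good) and nothing is
invented (each result comes from an item). Maximality follows from the two together. -/
theorem wp_stage {ω : Draws d n} {h : Mem d n} {c N E Nc : ℕ} {Ne : IExp} {cc : ℝ} {key : ℕ → ℕ}
    {val : ℕ → ℝ} (hcc0 : 0 ≤ cc) (hcc : h.R .c 0 = cc) (hE : h.I .E 0 = E) (hE0 : 0 < E)
    (hF : h.I .F 0 = (E * E : ℕ)) (hN : h.I .N 0 = N) (hNe : h.ie Ne = Nc) (hNc : 0 < Nc)
    (hkey : ∀ t < N, h.I .key (t : ℕ) = key t ∧ key t < E * E * Nc)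
    (hval : ∀ t < N, h.R .val (t : ℕ) = val t) :
    WP ω (stageP d Ne) h c fun h' c' => Frame stageVars [.val, .oval] h h' ∧ ∃ M : ℕ,
      M ≤ Nc * E ∧ h'.I .N 0 = M ∧
      (∀ t < N, ∀ j < E, ∃ s < M,
        h'.I .key (s : ℕ) = (key t / (E * E) + Nc * j : ℕ) ∧
        val t + cc * j * (key t % (E * E) : ℕ) ≤ h'.R .val (s : ℕ)) ∧
      (∀ s < M, ∃ t < N, ∃ j < E,
        h'.I .key (s : ℕ) = (key t / (E * E) + Nc * j : ℕ) ∧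
        h'.I .id (s : ℕ) = h.I .id (t : ℕ) ∧
        h'.R .val (s : ℕ) = val t + cc * j * (key t % (E * E) : ℕ)) ∧
      c' ≤ c + 200 * (N + Nc * E) := by
  have hEE : 0 < E * E := Nat.mul_pos hE0 hE0
  refine wp_seq (wp_iset (wp_seq ?_))
  set h0 := h.setI .Nc (h.ie (.const 0)) (h.ie Ne) with h0def
  have f0 : Frame stageVars [.val, .oval] h h0 := (Frame.refl _ _ h).setI (by simp [stageVars])
  have n0 : h0.I .Nc 0 = Nc := by simp [h0def, hNe]
  refine (wp_split (E := E) (F := E * E) (N := N) (key := key) (by rw [f0.I _ (by simp [stageVars]), hE])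
    (by rw [f0.I _ (by simp [stageVars]), hF]) (by simp [h0def, hN])
    (fun t ht => by simp [h0def, (hkey t ht).1])).mono ?_
  rintro h1 c1 ⟨f1, s1, s2, rfl⟩
  have hlo : ∀ t, key t % (E * E) % E < E := fun t => Nat.mod_lt _ hE0
  have hhi : ∀ t, key t % (E * E) / E < E := fun t => by
    rw [Nat.div_lt_iff_lt_mul hE0]; exact Nat.mod_lt _ hEE
  have n1 : h1.I .N 0 = N := by rw [f1.I _ (by simp)]; simp [h0def, hN]
  have e1 : h1.I .E 0 = E := by rw [f1.I _ (by simp)]; simp [h0def, hE]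
  refine wp_seq ((wp_pass (E := E) (L := List.range N) (key := fun t => key t % (E * E) % E)
    (by simp [passVars]) e1 (by simpa using n1) s2 List.nodup_range
    (fun p hp => (s1 p (List.mem_range.1 hp)).2.2.2) (fun p _ => hlo p)).mono ?_)
  rintro h2 c2 ⟨f2, t1, t2⟩
  set L1 := bsort E (fun t => key t % (E * E) % E) (List.range N) with hL1
  have nd1 : L1.Nodup := nodup_bsort List.nodup_range
  have m1 : ∀ p, p ∈ L1 ↔ p < N := fun p => by rw [hL1, mem_bsort (fun p _ => hlo p), List.mem_range]
  have l1 : L1.length = N := by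
    rw [hL1, length_bsort List.nodup_range (fun p _ => hlo p), List.length_range]
  refine wp_seq ((wp_pass (E := E) (L := L1) (key := fun t => key t % (E * E) / E)
    (by simp [passVars]) (by rw [f2.I _ (by simp [passVars]), e1])
    (by rw [f2.I _ (by simp [passVars]), n1, l1]) t1 nd1
    (fun p hp => by rw [f2.I _ (by simp [passVars])]; exact (s1 p ((m1 p).1 hp)).2.2.1)
    (fun p _ => hhi p)).mono ?_)
  rintro h3 c3 ⟨f3, u1, u2⟩
  set L2 := bsort E (fun t => key t % (E * E) / E) L1 with hL2
  have nd2 : L2.Nodup := nodup_bsort nd1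
  have m2 : ∀ p, p ∈ L2 ↔ p < N := fun p => by rw [hL2, mem_bsort (fun p _ => hhi p), m1]
  have l2 : L2.length = N := by rw [hL2, length_bsort nd1 (fun p _ => hhi p), l1]
  have f13 : Frame passVars [] h1 h3 := f2.trans f3
  refine wp_seq ((wp_clearTop (Nc := Nc) (by
    rw [f13.I _ (by simp [passVars]), f1.I _ (by simp), n0])).mono ?_)
  rintro h4 c4 ⟨f4, v1, rfl⟩
  have f14 : Frame (.top :: passVars) [] h1 h4 :=
    f13.weaken.trans f4 (by simp [passVars]) (by simp)
  have f04 : Frame ([.t, .col, .cell, .hi, .lo, .ord] ++ (.top :: passVars)) [] h0 h4 :=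
    (f1.weaken (by simp)).trans f14 (by simp [passVars])
  have f05 : Frame stageVars [.val, .oval] h h4 :=
    f0.trans f04 (by simp [stageVars, passVars]) (by simp)
  have c4 : ∀ p < N, h4.I .cell (p : ℕ) = (key p % (E * E) : ℕ) := fun p hp => by
    rw [f14.I _ (by simp [passVars])]; exact (s1 p hp).2.1
  have a1 : h4.R .c 0 = cc := by rw [f05.R _ (by simp), hcc]
  have a2 : h4.I .E 0 = E := by rw [f05.I _ (by simp [stageVars]), hE]
  have a3 : h4.I .N 0 = N := by rw [f14.I _ (by simp [passVars]), n1]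
  refine wp_seq ((wp_pushAll (Nc := Nc) (E := E) (N := N) (L := L2)
    (col := fun p => key p / (E * E)) (cc := cc) hcc0 hE0 rfl rfl
    a1 a2 a3 l2 (by rw [f4.I _ (by simp)]; exact u1) nd2 ?_ ?_ v1).mono ?_)
  · intro p hp
    have hp := (m2 p).1 hp
    refine ⟨by rw [f14.I _ (by simp [passVars])]; exact (s1 p hp).1, ?_⟩
    exact Nat.div_lt_of_lt_mul (hkey p hp).2
  -- Radix sort: a slope below `E * E` has two digits in base `E`, so two passes with `E` buckets
  -- suffice, in time linear in `N + E`.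
  · have hpw := pairwise_bsort (B := E) (key := fun t => key t % (E * E) / E)
      (pairwise_bsort (B := E) (key := fun t => key t % (E * E) % E)
        (R := fun _ _ => True) (L := List.range N) (by simp [List.pairwise_iff_getElem]))
    refine hpw.imp_of_mem fun {a b} ha hb hab => ?_
    rw [c4 a ((m2 a).1 ha), c4 b ((m2 b).1 hb)]
    have ea := Nat.div_add_mod (key a % (E * E)) E
    have eb := Nat.div_add_mod (key b % (E * E)) E
    have la := hlo a
    have lb := hlo b
    simp only [and_true] at hab
    norm_cast
    rcases hab with hab | ⟨hab, hab' | hab'⟩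
    · have : E * (key a % (E * E) / E + 1) ≤ E * (key b % (E * E) / E) := Nat.mul_le_mul_left _ hab
      rw [mul_add] at this
      omega
    · rw [hab] at ea; omega
    · rw [hab] at ea; omega
  rintro h5 c5 ⟨f5, w1, w2⟩
  refine wp_seq ((wp_flush (val := h4.R .val) (cell := h4.I .cell) (cc := cc) (E := E) (Nc := Nc)
    (S := fun b => {p | p ∈ L2 ∧ key p / (E * E) = b}) (by rw [f5.R _ (by simp)])
    (by rw [f5.I _ (by simp)]) (by rw [f5.R _ (by simp), a1]) (by rw [f5.I _ (by simp), a2]) hE0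
    (by rw [f5.I _ (by simp), f04.I _ (by simp [passVars]), n0]) w1).mono ?_)
  rintro h6 c6 ⟨f6, M, x1, x2, x3, x4, x5⟩
  refine (wp_copy x2).mono ?_
  rintro h7 c7 ⟨f7, y1, y2, rfl⟩
  have hline : ∀ t < N, ∀ j : ℕ, line (h4.R .val) (h4.I .cell) cc t (j : ℕ) =
      val t + cc * j * (key t % (E * E) : ℕ) := by
    intro t ht j
    rw [line, c4 t ht, f04.R .val (by simp)]
    simp only [h0def, Mem.setI_R, hval t ht, Int.cast_natCast]
  refine ⟨?_, M, x1, y1, ?_, ?_, ?_⟩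
  · exact (((f05.trans f5 (by simp [stageVars])).trans f6 (by simp [stageVars])).trans f7
      (by simp [stageVars]))
  · intro t ht j hj
    obtain ⟨s, hs, z1, z2⟩ := x3 (key t / (E * E)) (Nat.div_lt_of_lt_mul (hkey t ht).2) t
      ⟨(m2 t).2 ht, rfl⟩ j hj
    obtain ⟨b1, b2, b3⟩ := y2 s hs
    exact ⟨s, hs, by rw [b1, z1], by rw [b3, ← hline t ht]; exact z2⟩
  · intro s hs
    obtain ⟨b, hb, t, ⟨ht, rfl⟩, j, hj, z1, z2, z3⟩ := x4 s hs
    obtain ⟨b1, b2, b3⟩ := y2 s hs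
    have ht := (m2 t).1 ht
    refine ⟨t, ht, j, hj, by rw [b1, z1], ?_, by rw [b3, z3, hline t ht]⟩
    rw [b2, z2, f5.I _ (by simp), f04.I _ (by simp [passVars])]
    simp [h0def]
  · rw [List.length_range] at t2
    rw [l1] at u2
    have : E ≤ Nc * E := Nat.le_mul_of_pos_left E hNc
    have : Nc ≤ Nc * E := Nat.le_mul_of_pos_right Nc hE0
    have : 1 ≤ Nc * E := Nat.mul_pos hNc hE0
    omega

/-! ### All stages -/

def ipow (e : IExp) : ℕ → IExp
  | 0 => .const 1
  | k + 1 => .mul (ipow e k) e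

@[simp] theorem ie_ipow (h : Mem d n) (e : IExp) (k : ℕ) : h.ie (ipow e k) = h.ie e ^ k := by
  induction k with
  | zero => simp [ipow]
  | succ k ih => rw [ipow, Mem.ie_mul, ih, pow_succ]

/-- The first `k` of `D` stages. -/
def stagesP (d D : ℕ) : ℕ → Prog
  | 0 => .skip
  | k + 1 => .seq (stagesP d D k) (stageP d (ipow (isc .E) (2 * D - 2 - k)))

/-- The key after `k` of `D` stages of an item with initial key `a`, at the grid point `Y`. -/
def stageKey (E D k a : ℕ) (Y : ℕ → ℕ) : ℕ :=
  a / (E * E) ^ k + (E * E) ^ (D - k) * ∑ l ∈ Finset.range k, Y l * E ^ l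

/-- The value after `k` stages of an item with initial key `a` and value `v`. -/
def stageVal (E k a : ℕ) (cc v : ℝ) (Y : ℕ → ℕ) : ℝ :=
  v + cc * ∑ l ∈ Finset.range k, (Y l : ℝ) * (a / (E * E) ^ l % (E * E) : ℕ)

theorem stageKey_congr {E D k a : ℕ} {Y Y' : ℕ → ℕ} (h : ∀ l < k, Y l = Y' l) :
    stageKey E D k a Y = stageKey E D k a Y' := by
  unfold stageKey
  rw [Finset.sum_congr rfl fun l hl => by rw [h l (Finset.mem_range.1 hl)]]

theorem stageVal_congr {E k a : ℕ} {cc v : ℝ} {Y Y' : ℕ → ℕ} (h : ∀ l < k, Y l = Y' l) :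
    stageVal E k a cc v Y = stageVal E k a cc v Y' := by
  unfold stageVal
  rw [Finset.sum_congr rfl fun l hl => by rw [h l (Finset.mem_range.1 hl)]]

/-- The grid coordinates chosen so far sit above the `D - k` remaining cell digits, so the lowest
digit is still digit `k` of the initial key. -/
theorem stageKey_mod {E D k a : ℕ} {Y : ℕ → ℕ} (hk : k < D) :
    stageKey E D k a Y % (E * E) = a / (E * E) ^ k % (E * E) := by
  unfold stageKey
  obtain ⟨r, hr⟩ : ∃ r, D - k = r + 1 := ⟨D - k - 1, by omega⟩
  rw [hr, pow_succ' (E * E) r, mul_assoc, Nat.add_mul_mod_self_left]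

/-- Without its lowest digit the key has `D - k - 1` digits in base `E²` and `k` digits in base `E`;
together they range below `E ^ (2 * D - 2 - k)`, the number of columns of this stage. -/
theorem stageKey_succ {E D k a : ℕ} {Y : ℕ → ℕ} (hE : 0 < E) (hk : k < D) :
    stageKey E D (k + 1) a Y =
      stageKey E D k a Y / (E * E) + E ^ (2 * D - 2 - k) * Y k := by
  unfold stageKey
  obtain ⟨r, rfl⟩ : ∃ r, D = k + r + 1 := ⟨D - k - 1, by omega⟩
  rw [show k + r + 1 - k = r + 1 by omega, show k + r + 1 - (k + 1) = r by omega,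
    show 2 * (k + r + 1) - 2 - k = 2 * r + k by omega, pow_succ' (E * E) r, mul_assoc,
    Nat.add_mul_div_left _ _ (Nat.mul_pos hE hE), Nat.div_div_eq_div_mul, ← pow_succ,
    Finset.sum_range_succ, mul_add, add_assoc]
  congr 2
  rw [pow_add, pow_mul]
  ring

theorem stageVal_succ {E D k a : ℕ} {cc v : ℝ} {Y : ℕ → ℕ} (hk : k < D) :
    stageVal E (k + 1) a cc v Y =
      stageVal E k a cc v Y + cc * Y k * (stageKey E D k a Y % (E * E) : ℕ) := by
  rw [stageKey_mod hk]
  unfold stageVal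
  rw [Finset.sum_range_succ]
  ring

theorem sum_digits_lt {E : ℕ} {Y : ℕ → ℕ} (hY : ∀ l, Y l < E) (k : ℕ) :
    ∑ l ∈ Finset.range k, Y l * E ^ l < E ^ k := by
  induction k with
  | zero => simp
  | succ k ih =>
    rw [Finset.sum_range_succ, pow_succ]
    have : (Y k + 1) * E ^ k ≤ E * E ^ k := Nat.mul_le_mul_right _ (hY k)
    rw [add_mul] at this
    linarith

theorem sum_digits_inj {E : ℕ} {Y Y' : ℕ → ℕ} (hY : ∀ l, Y l < E) (hY' : ∀ l, Y' l < E) {k : ℕ}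
    (h : ∑ l ∈ Finset.range k, Y l * E ^ l = ∑ l ∈ Finset.range k, Y' l * E ^ l) :
    ∀ l < k, Y l = Y' l := by
  induction k with
  | zero => intro l hl; omega
  | succ k ih =>
    have hp : 0 < E ^ k := pow_pos (Nat.zero_lt_of_lt (hY 0)) k
    have key : ∀ Z : ℕ → ℕ, (∀ l, Z l < E) →
        (∑ l ∈ Finset.range (k + 1), Z l * E ^ l) / E ^ k = Z k := by
      intro Z hZ
      rw [Finset.sum_range_succ, Nat.add_mul_div_right _ _ hp,
        Nat.div_eq_of_lt (sum_digits_lt hZ k), zero_add]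
    have hk : Y k = Y' k := by rw [← key Y hY, h, key Y' hY']
    intro l hl
    rcases Nat.lt_succ_iff_lt_or_eq.1 hl with hl | rfl
    · refine ih ?_ l hl
      rw [Finset.sum_range_succ, Finset.sum_range_succ, hk] at h
      omega
    · exact hk

theorem stageKey_lt {E D k a : ℕ} {Y : ℕ → ℕ} (ha : a < (E * E) ^ D)
    (hY : ∀ l, Y l < E) (hk : k < D) :
    stageKey E D k a Y < E * E * E ^ (2 * D - 2 - k) := by
  unfold stageKey
  have h1 : a / (E * E) ^ k < (E * E) ^ (D - k) := by
    apply Nat.div_lt_of_lt_mul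
    rwa [← pow_add, show k + (D - k) = D by omega]
  have h2 := sum_digits_lt hY k
  have h3 : (E * E) ^ (D - k) * (∑ l ∈ Finset.range k, Y l * E ^ l + 1) ≤
      (E * E) ^ (D - k) * E ^ k := Nat.mul_le_mul_left _ h2
  have h4 : (E * E) ^ (D - k) * E ^ k = E * E * E ^ (2 * D - 2 - k) := by
    obtain ⟨r, rfl⟩ : ∃ r, D = k + r + 1 := ⟨D - k - 1, by omega⟩
    rw [show k + r + 1 - k = r + 1 by omega, show 2 * (k + r + 1) - 2 - k = 2 * r + k by omega,
      pow_add E, pow_mul]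
    ring
  rw [mul_add] at h3
  omega

/-- Dynamic programming: what later stages add to an item depends only on its key, so among items
with equal keys only the largest value matters. From the first stage on there are at most `E ^ (2 *
D - k)` items, and the worst case `k = 1` determines the running time. -/
theorem wp_stages_aux {ω : Draws d n} {h : Mem d n} {c N E D : ℕ} {cc : ℝ} {key : ℕ → ℕ}
    {val : ℕ → ℝ} (hcc0 : 0 ≤ cc) (hcc : h.R .c 0 = cc) (hE : h.I .E 0 = E) (hE0 : 0 < E)
    (hF : h.I .F 0 = (E * E : ℕ)) (hN : h.I .N 0 = N)
    (hkey : ∀ t < N, h.I .key (t : ℕ) = key t ∧ key t < (E * E) ^ D)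
    (hval : ∀ t < N, h.R .val (t : ℕ) = val t) (hid : ∀ t < N, h.I .id (t : ℕ) = t) (k : ℕ)
    (hk : k ≤ D) :
    WP ω (stagesP d D k) h c fun h' c' => Frame stageVars [.val, .oval] h h' ∧ ∃ M : ℕ,
      (k = 0 ∧ M = N ∨ 0 < k ∧ M ≤ E ^ (2 * D - k)) ∧ h'.I .N 0 = M ∧
      (∀ p < N, ∀ Y : ℕ → ℕ, (∀ l, Y l < E) → ∃ s < M,
        h'.I .key (s : ℕ) = (stageKey E D k (key p) Y : ℕ) ∧
        stageVal E k (key p) cc (val p) Y ≤ h'.R .val (s : ℕ)) ∧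
      (∀ s < M, ∃ p < N, ∃ Y : ℕ → ℕ, (∀ l, Y l < E) ∧
        h'.I .key (s : ℕ) = (stageKey E D k (key p) Y : ℕ) ∧
        h'.I .id (s : ℕ) = p ∧ h'.R .val (s : ℕ) = stageVal E k (key p) cc (val p) Y) ∧
      c' ≤ c + 1 + k * (400 * (N + E ^ (2 * D - 1))) := by
  induction k with
  | zero =>
    refine wp_skip ⟨Frame.refl _ _ _, N, Or.inl ⟨rfl, rfl⟩, hN, ?_, ?_, by omega⟩
    · intro p hp Y hY
      exact ⟨p, hp, by simp [stageKey, hkey p hp], by simp [stageVal, hval p hp]⟩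
    · intro s hs
      exact ⟨s, hs, fun _ => 0, fun _ => hE0, by simp [stageKey, hkey s hs], hid s hs,
        by simp [stageVal, hval s hs]⟩
  | succ k ih =>
    refine wp_seq ((ih (by omega)).mono ?_)
    rintro h1 c1 ⟨f1, M, m1, m2, m3, m4, m5⟩
    choose! P hP YY hYY a1 a2 a3 using m4
    refine (wp_stage (N := M) (E := E) (Nc := E ^ (2 * D - 2 - k)) (cc := cc)
      (key := fun s => stageKey E D k (key (P s)) (YY s))
      (val := fun s => stageVal E k (key (P s)) cc (val (P s)) (YY s)) hcc0
      (by rw [f1.R _ (by simp), hcc]) (by rw [f1.I _ (by simp [stageVars]), hE]) hE0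
      (by rw [f1.I _ (by simp [stageVars]), hF]) m2
      (by simp [f1.I .E (by simp [stageVars]), hE]) (pow_pos hE0 _)
      (fun t ht => ⟨a1 t ht, stageKey_lt (hkey _ (hP t ht)).2 (hYY t ht) (by omega)⟩)
      a3).mono ?_
    rintro h2 c2 ⟨f2, M', b1, b2, b3, b4, b5⟩
    have hpw : E ^ (2 * D - 2 - k) * E = E ^ (2 * D - (k + 1)) := by
      rw [← pow_succ]; congr 1; omega
    refine ⟨f1.trans f2, M', Or.inr ⟨by omega, hpw ▸ b1⟩, b2, ?_, ?_, ?_⟩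
    · intro p hp Y hY
      obtain ⟨t, ht, t1, t2⟩ := m3 p hp Y hY
      obtain ⟨s, hs, s1, s2⟩ := b3 t ht (Y k) (hY k)
      -- The exchange: the surviving item `t` has the same key as the one followed here, so it gains
      -- the same amount in the next stage.
      have e1 : stageKey E D k (key (P t)) (YY t) = stageKey E D k (key p) Y := by
        rw [a1 t ht] at t1; exact_mod_cast t1
      refine ⟨s, hs, ?_, ?_⟩
      · rw [s1, e1, stageKey_succ hE0 (by omega)]
      · refine le_trans ?_ s2
        rw [stageVal_succ (show k < D by omega), e1, ← a3 t ht]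
        linarith
    · intro s hs
      obtain ⟨t, ht, j, hj, s1, s2, s3⟩ := b4 s hs
      have hY' : ∀ l < k, YY t l = Function.update (YY t) k j l := fun l hl => by
        rw [Function.update_of_ne hl.ne]
      refine ⟨P t, hP t ht, Function.update (YY t) k j, ?_, ?_, ?_, ?_⟩
      · intro l
        by_cases hl : l = k
        · subst hl; simpa using hj
        · rw [Function.update_of_ne hl]; exact hYY t ht l
      · rw [s1, stageKey_succ hE0 (by omega), Function.update_self, stageKey_congr hY']
      · rw [s2, a2 t ht]
      · rw [s3, stageVal_succ (show k < D by omega), Function.update_self, stageKey_congr hY',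
          stageVal_congr hY']
    · have h3 : E ^ (2 * D - (k + 1)) ≤ E ^ (2 * D - 1) := Nat.pow_le_pow_right hE0 (by omega)
      have h4 : M ≤ N + E ^ (2 * D - 1) := by
        rcases m1 with ⟨-, rfl⟩ | ⟨hk0, m1⟩
        · omega
        · have : E ^ (2 * D - k) ≤ E ^ (2 * D - 1) := Nat.pow_le_pow_right hE0 (by omega)
          omega
      rw [hpw] at b5
      have : (k + 1) * (400 * (N + E ^ (2 * D - 1))) =
        k * (400 * (N + E ^ (2 * D - 1))) + 400 * (N + E ^ (2 * D - 1)) := by ring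
      omega

/-- At the end all cell digits are used up and the key encodes only the grid point, so by uniqueness
of digits an item found under the key of `Y` has its value evaluated at `Y` itself. -/
theorem wp_stages {ω : Draws d n} {h : Mem d n} {c N E D : ℕ} {cc : ℝ} {key : ℕ → ℕ}
    {val : ℕ → ℝ} (hcc0 : 0 ≤ cc) (hcc : h.R .c 0 = cc) (hE : h.I .E 0 = E) (hE0 : 0 < E)
    (hF : h.I .F 0 = (E * E : ℕ)) (hN : h.I .N 0 = N)
    (hkey : ∀ t < N, h.I .key (t : ℕ) = key t ∧ key t < (E * E) ^ D)
    (hval : ∀ t < N, h.R .val (t : ℕ) = val t) (hid : ∀ t < N, h.I .id (t : ℕ) = t)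
    (hD : 0 < D) :
    WP ω (stagesP d D D) h c fun h' c' => Frame stageVars [.val, .oval] h h' ∧ ∃ M : ℕ,
      M ≤ E ^ D ∧ h'.I .N 0 = M ∧
      (∀ p < N, ∀ Y : ℕ → ℕ, (∀ l, Y l < E) → ∃ s < M, ∃ q < N, h'.I .id (s : ℕ) = q ∧
        stageVal E D (key p) cc (val p) Y ≤ stageVal E D (key q) cc (val q) Y) ∧
      (∀ s < M, ∃ p < N, h'.I .id (s : ℕ) = p) ∧
      c' ≤ c + 1 + D * (400 * (N + E ^ (2 * D - 1))) := by
  refine (wp_stages_aux hcc0 hcc hE hE0 hF hN hkey hval hid D le_rfl).mono ?_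
  rintro h' c' ⟨hf, M, m1, m2, m3, m4, m5⟩
  refine ⟨hf, M, ?_, m2, ?_, ?_, m5⟩
  · rcases m1 with ⟨rfl, -⟩ | ⟨-, m1⟩
    · omega
    · rwa [show 2 * D - D = D by omega] at m1
  · intro p hp Y hY
    obtain ⟨s, hs, s1, s2⟩ := m3 p hp Y hY
    obtain ⟨q, hq, Y', hY', t1, t2, t3⟩ := m4 s hs
    refine ⟨s, hs, q, hq, t2, ?_⟩
    have hfin : ∀ a < (E * E) ^ D, ∀ Z : ℕ → ℕ,
        stageKey E D D a Z = ∑ l ∈ Finset.range D, Z l * E ^ l := by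
      intro a ha Z
      rw [stageKey, Nat.div_eq_of_lt ha, Nat.sub_self, pow_zero, one_mul, zero_add]
    have hYY : ∀ l < D, Y' l = Y l := by
      apply sum_digits_inj hY' hY
      rw [← hfin _ (hkey q hq).2, ← hfin _ (hkey p hp).2]
      exact_mod_cast t1.symm.trans s1
    rw [← stageVal_congr hYY (a := key q), ← t3]
    exact s2
  · intro s hs
    obtain ⟨q, hq, -, -, -, t, -⟩ := m4 s hs
    exact ⟨q, hq, t⟩

/-! ### Loops over the coordinates, unrolled -/

/-- A coordinate is part of the name of an array and hence fixed in the program text. Unrolling is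
harmless because the dimension is a constant. -/
def seqFin : (k : ℕ) → (Fin k → Prog) → Prog
  | 0, _ => .skip
  | k + 1, f => .seq (seqFin k fun i => f i.castSucc) (f (Fin.last k))

theorem wp_seqFin {ω : Draws d n} {k : ℕ} {f : Fin k → Prog} {h : Mem d n} {c : ℕ}
    (Inv : ℕ → Mem d n → ℕ → Prop) (h0 : Inv 0 h (c + 1))
    (H : ∀ i : Fin k, ∀ h c, Inv i h c → WP ω (f i) h c (Inv (i + 1))) :
    WP ω (seqFin k f) h c (Inv k) := by
  induction k with
  | zero => exact wp_skip h0
  | succ k ih =>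
    exact wp_seq ((ih fun i => H i.castSucc).mono fun h c hI => H (Fin.last k) h c hI)

/-! ### Normalisation by Gaussian elimination with pivoting -/

/-- The real variables changed by the normalisation. -/
def wrkVars (d : ℕ) : List (RVar d) := .lam :: .piv :: (List.finRange d).map .wrk

/-- The working coordinates of the first `N` points are `w`. -/
def IsWrk (h : Mem d n) (N : ℕ) (w : ℕ → Fin d → ℝ) : Prop :=
  ∀ t < N, ∀ l, h.R (.wrk l) (t : ℕ) = w t l

/-- Eliminate coordinate `k` with pivot row `b`, and store the multipliers in place. -/
def elim (k : Fin d) (b : ℕ) (w : ℕ → Fin d → ℝ) (t : ℕ) (l : Fin d) : ℝ :=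
  if l < k then w t l else if l = k then w t k / w b k else w t l - w t k / w b k * w b l

/-- Squares replace absolute values in the search for the pivot. The pivot row is copied first,
since the elimination loop overwrites it as well. -/
def pivotP (k : Fin d) : Prog :=
  .seq (iset .best (.const 0) (.const 0))
  (.seq (forP .t (isc .n)
    (.ite (.realLe (.mul (rget (.wrk k) (isc .t)) (rget (.wrk k) (isc .t)))
      (.mul (rget (.wrk k) (isc .best)) (rget (.wrk k) (isc .best)))) .skip
      (iset .best (.const 0) (isc .t))))
  (.seq (seqFin d fun l => rset (RVar.piv : RVar d) (.const (l : ℕ)) (rget (.wrk l) (isc .best)))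
    (forP .t (isc .n)
      (.seq (rset (RVar.lam : RVar d) (.const 0)
        (.div (rget (.wrk k) (isc .t)) (rget (RVar.piv : RVar d) (.const (k : ℕ)))))
        (seqFin d fun l => rset (.wrk l) (isc .t)
          (if l < k then rget (.wrk l) (isc .t) else if l = k then rsc (RVar.lam : RVar d) else
            .sub (rget (.wrk l) (isc .t)) (.mul (rsc (RVar.lam : RVar d))
              (rget (RVar.piv : RVar d) (.const (l : ℕ))))))))))

theorem wp_pivot {ω : Draws d n} {h : Mem d n} {c N : ℕ} {k : Fin d} {w : ℕ → Fin d → ℝ}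
    (hN : h.I .n 0 = N) (hN0 : 0 < N) (hw : IsWrk h N w) :
    WP ω (pivotP k) h c fun h' c' => Frame [.t, .best] (wrkVars d) h h' ∧
      (∃ b < N, (∀ t < N, |w t k| ≤ |w b k|) ∧ IsWrk h' N (elim k b w)) ∧
      c' ≤ c + (d + 20) * (N + 1) := by
  refine wp_seq (wp_iset (wp_seq (wp_for N (fun s h' c' => h'.I .t 0 = s ∧
    Frame [.t, .best] [] h h' ∧ (∃ b < N, h'.I .best 0 = b ∧ ∀ t < s, |w t k| ≤ |w b k|) ∧
    c' ≤ c + 4 * s + 2) ?_ ?_ ?_ ?_)))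
  · exact ⟨by simp, (Frame.refl _ _ h).setI.setI, ⟨0, hN0, by simp⟩, by omega⟩
  · rintro s h' c' - ⟨h1, hf, -⟩
    exact ⟨h1, by simp [hf.I .n (by simp), hN]⟩
  · rintro s h' c' hs ⟨h1, hf, ⟨b, hb, h2, h3⟩, h4⟩
    have e1 : h'.R (.wrk k) (s : ℕ) = w s k := by rw [hf.R _ (by simp), hw s hs]
    have e2 : h'.R (.wrk k) (b : ℕ) = w b k := by rw [hf.R _ (by simp), hw b hb]
    refine wp_ite (fun ht => wp_skip ?_) (fun ht => wp_iset ?_)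
    · refine ⟨by simp [h1], hf.setI, ⟨b, hb, by simpa using h2, ?_⟩, by omega⟩
      simp only [Mem.te_realLe, Mem.re_mul, Mem.re_rget, Mem.ie_isc, h1, h2, e1, e2] at ht
      intro t hts
      rcases Nat.lt_succ_iff_lt_or_eq.1 hts with hts | rfl
      · exact h3 t hts
      · exact abs_le_iff_mul_self_le.2 ht
    · refine ⟨by simp [h1], hf.setI.setI, ⟨s, hs, by simp [h1], ?_⟩, by omega⟩
      simp only [Mem.te_realLe, Mem.re_mul, Mem.re_rget, Mem.ie_isc, h1, h2, e1, e2, not_le] at ht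
      have hlt := abs_le_iff_mul_self_le.2 ht.le
      intro t hts
      rcases Nat.lt_succ_iff_lt_or_eq.1 hts with hts | rfl
      · exact (h3 t hts).trans hlt
      · exact le_rfl
  rintro h1 c1 ⟨-, f1, ⟨b, hb, hbest, hmax⟩, hc1⟩
  refine wp_seq ((wp_seqFin (fun s h' c' => Frame [.t, .best] [.piv] h h' ∧ h'.I .best 0 = b ∧
    (∀ l : Fin d, (l : ℕ) < s → h'.R .piv (l : ℕ) = w b l) ∧ c' ≤ c + 4 * N + 4 + s)
    ⟨f1.weaken, hbest, by simp, by omega⟩ ?_).mono ?_)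
  · rintro i h' c' ⟨hf, h2, h3, h4⟩
    refine wp_rset ⟨hf.setR, by simpa using h2, ?_, by omega⟩
    intro l hl
    simp only [Mem.setR_R, Function.update_self, Mem.ie_const, Mem.re_rget, Mem.ie_isc, h2]
    rcases Nat.lt_succ_iff_lt_or_eq.1 hl with hl | hl
    · rw [Function.update_of_ne (by exact_mod_cast hl.ne)]
      exact h3 l hl
    · obtain rfl : l = i := Fin.ext hl
      rw [Function.update_self, hf.R _ (by simp), hw b hb]
  rintro h2 c2 ⟨f2, -, hpiv, hc2⟩
  have hpiv : ∀ l : Fin d, h2.R .piv (l : ℕ) = w b l := fun l => hpiv l l.2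
  refine wp_for N (fun s h' c' => h'.I .t 0 = s ∧ Frame [.t, .best] (wrkVars d) h h' ∧
    h'.R .piv = h2.R .piv ∧ (∀ t < N, ∀ l, h'.R (.wrk l) (t : ℕ) =
      if t < s then elim k b w t l else w t l) ∧ c' ≤ c + 4 * N + 5 + d + (d + 4) * s) ?_ ?_ ?_ ?_
  · refine ⟨by simp, (f2.weaken (by simp) (by simp [wrkVars])).setI, by simp, ?_, by omega⟩
    intro t ht l
    simp [f2.R (.wrk l) (by simp), hw t ht]
  · rintro s h' c' - ⟨h1, hf, -⟩
    exact ⟨h1, by simp [hf.I .n (by simp), hN]⟩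
  · rintro s h' c' hs ⟨h3, hf, h4, h5, h6⟩
    have hsk : ∀ l, h'.R (.wrk l) (s : ℕ) = w s l := fun l => by simp [h5 s hs l]
    refine wp_seq (wp_rset ((wp_seqFin (fun r h'' c'' => h''.I .t 0 = s ∧
      Frame [.t, .best] (wrkVars d) h h'' ∧ h''.R .piv = h2.R .piv ∧
      h''.R .lam 0 = w s k / w b k ∧ (∀ t < N, ∀ l : Fin d, h''.R (.wrk l) (t : ℕ) =
        if t < s ∨ t = s ∧ (l : ℕ) < r then elim k b w t l else w t l) ∧
        c'' ≤ c + 4 * N + 5 + d + (d + 4) * s + 3 + r) ?_ ?_).mono ?_))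
    · refine ⟨by simpa using h3, hf.setR (by simp [wrkVars]), by simpa using h4, ?_, ?_, by omega⟩
      · simp [h3, hsk, h4, hpiv]
      · intro t ht l
        simp [h5 t ht l]
    · rintro r g c'' ⟨g1, gf, g2, g3, g4, g5⟩
      refine wp_rset ⟨by simpa using g1, gf.setR (by simp [wrkVars]), by simpa using g2,
        by simpa using g3, ?_, by omega⟩
      intro t ht l
      have hval : g.re (if r < k then rget (.wrk r) (isc .t) else
          if r = k then rsc (RVar.lam : RVar d) else
            .sub (rget (.wrk r) (isc .t)) (.mul (rsc (RVar.lam : RVar d))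
              (rget (RVar.piv : RVar d) (.const (r : ℕ))))) = elim k b w s r := by
        have e1 : g.R (.wrk r) (s : ℕ) = w s r := by simp [g4 s hs r]
        unfold elim
        split_ifs <;> simp [g1, e1, g3, g2, hpiv]
      rw [hval]
      simp only [Mem.setR_R, Mem.ie_isc, g1]
      by_cases hlr : l = r
      · subst hlr
        rw [Function.update_self]
        by_cases hts : t = s
        · subst hts; simp
        · rw [Function.update_of_ne (by exact_mod_cast hts), g4 t ht l]
          simp [hts]
      · rw [Function.update_of_ne (by simpa using hlr), g4 t ht l]
        have : (l : ℕ) ≠ r := fun h => hlr (Fin.ext h)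
        have : ((l : ℕ) < r + 1) ↔ (l : ℕ) < r := by omega
        simp only [this]
    · rintro g c'' ⟨g1, gf, g2, g3, g4, g5⟩
      refine ⟨by simp [g1], gf.setI, by simpa using g2, ?_, ?_⟩
      · intro t ht l
        simp only [Mem.setI_R]
        rw [g4 t ht l]
        have : (t < s ∨ t = s ∧ (l : ℕ) < d) ↔ t < s + 1 := by have := l.2; omega
        simp only [this]
      · have : (d + 4) * (s + 1) = (d + 4) * s + d + 4 := by ring
        omega
  · rintro h' c' ⟨-, hf, -, h5, h6⟩
    refine ⟨hf, ⟨b, hb, hmax, fun t ht l => by rw [h5 t ht l, if_pos ht]⟩, ?_⟩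
    have : (d + 20) * (N + 1) = (d + 4) * N + 16 * N + d + 20 := by ring
    omega

/-- State of the elimination after `k` coordinates: the first `k` working coordinates of the
points `x t` are coordinates with respect to the vectors `r j`, the others are residuals. -/
def Eliminated (N : ℕ) (x : ℕ → Fin d → ℝ) (k : ℕ) (w : ℕ → Fin d → ℝ) : Prop :=
  ∃ (π : Fin d → ℕ) (r : Fin d → Fin d → ℝ),
    (∀ t < N, ∀ l, x t l - x 0 l =
      ∑ j : Fin d, (if (j : ℕ) < k then w t j * r j l else 0) + if k ≤ l then w t l else 0) ∧
    (∀ t < N, ∀ j : Fin d, (j : ℕ) < k → |w t j| ≤ 1) ∧ (∀ l, w 0 l = 0) ∧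
    ∀ j : Fin d, (j : ℕ) < k → π j < N ∧
      (r j = 0 ∨ w (π j) j = 1 ∧ ∀ l, j < l → w (π j) l = 0)

/-- The new vector is the residual of the pivot row. By maximality of the pivot all multipliers are
at most `1` in absolute value; the pivot row itself gets multiplier `1` and residual `0`. -/
theorem Eliminated.step {N : ℕ} {x : ℕ → Fin d → ℝ} {k : Fin d} {w : ℕ → Fin d → ℝ}
    (H : Eliminated N x k w) {b : ℕ} (hb : b < N) (hmax : ∀ t < N, |w t k| ≤ |w b k|) :
    Eliminated N x (k + 1) (elim k b w) := by
  obtain ⟨π, r, h1, h2, h3, h4⟩ := H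
  have hlt : ∀ t, ∀ j : Fin d, (j : ℕ) < k → elim k b w t j = w t j := fun t j hj => by
    rw [elim, if_pos (by exact_mod_cast hj)]
  have hk : ∀ t, elim k b w t k = w t k / w b k := fun t => by simp [elim]
  have hgt : ∀ t, ∀ j : Fin d, k < j → elim k b w t j = w t j - w t k / w b k * w b j :=
    fun t j hj => by rw [elim, if_neg (not_lt.2 hj.le), if_neg hj.ne']
  -- A zero pivot means that this coordinate is already used up. Division by zero then yields
  -- multiplier `0`, and the zero vector is recorded.
  have hzero : w b k = 0 → ∀ t < N, w t k = 0 := fun h0 t ht => by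
    have := hmax t ht
    rw [h0, abs_zero] at this
    exact abs_nonpos_iff.1 this
  refine ⟨Function.update π k b, Function.update r k (fun l =>
    if w b k = 0 then 0 else if k ≤ l then w b l else 0), ?_, ?_, ?_, ?_⟩
  · intro t ht l
    rw [h1 t ht l, ← Finset.add_sum_erase _ _ (Finset.mem_univ k),
      ← Finset.add_sum_erase Finset.univ (fun j : Fin d => if (j : ℕ) < k + 1 then _ else _)
        (Finset.mem_univ k)]
    have hs : ∑ j ∈ Finset.univ.erase k, (if (j : ℕ) < k then w t j * r j l else 0) =
        ∑ j ∈ Finset.univ.erase k, (if (j : ℕ) < k + 1 then elim k b w t j *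
          (Function.update r k (fun l => if w b k = 0 then 0 else if k ≤ l then w b l else 0)) j l
          else 0) := by
      refine Finset.sum_congr rfl fun j hj => ?_
      have hjk : j ≠ k := Finset.ne_of_mem_erase hj
      have hjk' : (j : ℕ) ≠ k := fun h => hjk (Fin.ext h)
      rw [Function.update_of_ne hjk]
      by_cases hj' : (j : ℕ) < k
      · rw [if_pos hj', if_pos (by omega), hlt t j hj']
      · rw [if_neg hj', if_neg (by omega)]
    rw [hs, if_neg (lt_irrefl _), if_pos (Nat.lt_succ_self _), Function.update_self, hk]
    have hres : (if (k : ℕ) ≤ l then w t l else 0) =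
        w t k / w b k * (if w b k = 0 then 0 else if k ≤ l then w b l else 0) +
          (if (k : ℕ) + 1 ≤ l then elim k b w t l else 0) := by
      rcases lt_trichotomy l k with hl | rfl | hl
      · have h5 : ¬ (k : ℕ) ≤ l := by exact_mod_cast not_le.2 hl
        have h6 : ¬ (k : ℕ) + 1 ≤ l := by omega
        simp [h5, h6, not_le.2 hl]
      · by_cases h0 : w b l = 0
        · simp [h0, hzero h0 t ht]
        · simp [h0]
      · have h5 : (k : ℕ) < l := by exact_mod_cast hl
        have h6 : (k : ℕ) + 1 ≤ l := by omega
        by_cases h0 : w b k = 0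
        · simp [h0, h5.le, h6, hgt t l hl]
        · simp [h0, h5.le, h6, hl.le, hgt t l hl]
    rw [hres]
    ring
  · intro t ht j hj
    rcases Nat.lt_succ_iff_lt_or_eq.1 hj with hj | hj
    · rw [hlt t j hj]; exact h2 t ht j hj
    · obtain rfl : j = k := Fin.ext hj
      rw [hk, abs_div]
      exact div_le_one_of_le₀ (hmax t ht) (abs_nonneg _)
  · intro l
    unfold elim
    simp [h3]
  · intro j hj
    rcases Nat.lt_succ_iff_lt_or_eq.1 hj with hj | hj
    · have hjk : j ≠ k := fun h => by rw [h] at hj; omega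
      rw [Function.update_of_ne hjk, Function.update_of_ne hjk]
      obtain ⟨a1, a2⟩ := h4 j hj
      refine ⟨a1, a2.imp_right fun ⟨a3, a4⟩ => ⟨by rw [hlt _ _ hj, a3], fun l hl => ?_⟩⟩
      -- An earlier pivot row has no residual left, so its multiplier here is `0` and it stays
      -- finished.
      have e0 := a4 k hj
      unfold elim
      simp [e0, a4 l hl]
    · obtain rfl : j = k := Fin.ext hj
      rw [Function.update_self, Function.update_self]
      refine ⟨hb, ?_⟩
      by_cases h0 : w b j = 0
      · left; funext l; simp [h0]
      · right
        refine ⟨by rw [hk, div_self h0], fun l hl => ?_⟩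
        rw [hgt b l hl, div_self h0]; ring

theorem sum_Iio_two_pow_le (j : Fin d) : ∑ i ∈ Finset.Iio j, (2 : ℝ) ^ (i : ℕ) = 2 ^ (j : ℕ) - 1 := by
  have h : ∑ i ∈ Finset.Iio j, (2 : ℝ) ^ (i : ℕ) = ∑ i ∈ Finset.range (j : ℕ), (2 : ℝ) ^ i := by
    refine Finset.sum_nbij (fun i => (i : ℕ)) ?_ ?_ ?_ ?_
    · intro i hi; simpa using hi
    · intro a _ b _ hab; exact Fin.ext hab
    · intro a ha
      have ha' : a < (j : ℕ) := by simpa using ha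
      exact ⟨⟨a, ha'.trans j.2⟩, by simpa [Fin.lt_def] using ha', rfl⟩
    · simp
  rw [h]
  have := geom_sum_eq (by norm_num : (2 : ℝ) ≠ 1) (j : ℕ)
  rw [this]; ring

/-- A linear functional with bounded variation on the points has bounded coefficients with respect
to the vectors found by the elimination. -/
theorem Eliminated.coeff_le {N : ℕ} {x : ℕ → Fin d → ℝ} {w : ℕ → Fin d → ℝ}
    (H : Eliminated N x d w) : ∃ r : Fin d → Fin d → ℝ,
      (∀ t < N, ∀ l, x t l - x 0 l = ∑ j : Fin d, w t j * r j l) ∧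
      ∀ (u : Fin d → ℝ) (W : ℝ), (∀ t < N, |∑ l, (x t l - x 0 l) * u l| ≤ W) →
        ∀ j, |∑ l, r j l * u l| ≤ 2 ^ (j : ℕ) * W := by
  obtain ⟨π, r, h1, h2, h3, h4⟩ := H
  have h1' : ∀ t < N, ∀ l, x t l - x 0 l = ∑ j : Fin d, w t j * r j l := fun t ht l => by
    rw [h1 t ht l, if_neg (by have := l.2; omega), add_zero]
    exact Finset.sum_congr rfl fun j _ => if_pos j.2
  refine ⟨r, h1', fun u W hW => ?_⟩
  set o : Fin d → ℝ := fun j => ∑ l, r j l * u l with ho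
  have hx : ∀ t < N, ∑ l, (x t l - x 0 l) * u l = ∑ j, w t j * o j := by
    intro t ht
    simp only [ho, Finset.mul_sum]
    rw [Finset.sum_comm]
    refine Finset.sum_congr rfl fun l _ => ?_
    rw [h1' t ht l, Finset.sum_mul]
    exact Finset.sum_congr rfl fun j _ => by ring
  intro j
  induction j using WellFoundedLT.induction with
  | ind j ih =>
    obtain ⟨a1, a2⟩ := h4 j j.2
    have hW0 : 0 ≤ W := (abs_nonneg _).trans (hW _ a1)
    rcases a2 with a2 | ⟨a2, a3⟩
    · simp only [a2, Pi.zero_apply, zero_mul, Finset.sum_const_zero, abs_zero]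
      positivity
    -- In row `π j` coordinate `j` is `1` and the later ones vanish, so `o j` can be solved for.
    -- Forward substitution gives at most `W` plus the sum of `2 ^ i * W` over `i < j`, which is `2
    -- ^ j * W`.
    · have hs : ∑ i, w (π j) i * o i = ∑ i ∈ Finset.Iio j, w (π j) i * o i + o j := by
        rw [← Finset.sum_subset (Finset.subset_univ (Finset.Iic j))]
        · rw [← Finset.Iio_insert, Finset.sum_insert (by simp), a2]; ring
        · intro i _ hi
          rw [a3 i (by simpa using hi), zero_mul]
      have hle : |∑ i ∈ Finset.Iio j, w (π j) i * o i| ≤ (2 ^ (j : ℕ) - 1) * W := by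
        rw [← sum_Iio_two_pow_le, Finset.sum_mul]
        refine (Finset.abs_sum_le_sum_abs _ _).trans (Finset.sum_le_sum fun i hi => ?_)
        rw [abs_mul]
        have := h2 _ a1 i i.2
        have := ih i (by simpa using hi)
        calc _ ≤ 1 * |o i| := by gcongr
          _ ≤ _ := by rw [one_mul]; exact this
      have := hW _ a1
      rw [hx _ a1, hs] at this
      have e : o j = (∑ i ∈ Finset.Iio j, w (π j) i * o i + o j) -
        ∑ i ∈ Finset.Iio j, w (π j) i * o i := by ring
      change |o j| ≤ _
      rw [e]
      calc _ ≤ _ := abs_sub _ _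
        _ ≤ W + (2 ^ (j : ℕ) - 1) * W := add_le_add this hle
        _ = _ := by ring

/-- Compute normalised coordinates of all points. -/
def normP (d : ℕ) : Prog :=
  .seq (forP .t (isc .n) (seqFin d fun l => rset (.wrk l) (isc .t)
    (.sub (rget (.raw l) (isc .t)) (rget (.raw l) (.const 0)))))
  (seqFin d pivotP)

theorem wp_norm {ω : Draws d n} {h : Mem d n} {c N : ℕ} {x : ℕ → Fin d → ℝ}
    (hN : h.I .n 0 = N) (hN0 : 0 < N) (hx : ∀ t < N, ∀ l, h.R (.raw l) (t : ℕ) = x t l) :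
    WP ω (normP d) h c fun h' c' => Frame [.t, .best] (wrkVars d) h h' ∧
      (∃ w, IsWrk h' N w ∧ Eliminated N x d w) ∧ c' ≤ c + (d + 1) * ((d + 20) * (N + 1)) := by
  refine wp_seq (wp_for N (fun s h' c' => h'.I .t 0 = s ∧ Frame [.t, .best] (wrkVars d) h h' ∧
    (∀ t < s, ∀ l, h'.R (.wrk l) (t : ℕ) = x t l - x 0 l) ∧ c' ≤ c + 1 + (d + 3) * s) ?_ ?_ ?_ ?_)
  · exact ⟨by simp, (Frame.refl _ _ h).setI, by simp, by omega⟩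
  · rintro s h' c' - ⟨h1, hf, -⟩
    exact ⟨h1, by simp [hf.I .n (by simp), hN]⟩
  · rintro s h' c' hs ⟨h1, hf, h2, h3⟩
    refine (wp_seqFin (fun r g c'' => g.I .t 0 = s ∧ Frame [.t, .best] (wrkVars d) h g ∧
      (∀ t, ∀ l : Fin d, t < s ∨ t = s ∧ (l : ℕ) < r → g.R (.wrk l) (t : ℕ) = x t l - x 0 l) ∧
      c'' ≤ c + 1 + (d + 3) * s + 2 + r) ⟨h1, hf, ?_, by omega⟩ ?_).mono ?_
    · rintro t l (ht | ht)
      · exact h2 t ht l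
      · omega
    · rintro r g c'' ⟨g1, gf, g2, g3⟩
      refine wp_rset ⟨by simpa using g1, gf.setR (by simp [wrkVars]), ?_, by omega⟩
      intro t l htl
      have e0 : ∀ l, g.R (.raw l) = h.R (.raw l) := fun l => gf.R _ (by simp [wrkVars])
      have e2 : h.R (.raw r) 0 = x 0 r := hx 0 hN0 r
      simp only [Mem.setR_R, Mem.ie_isc, g1, Mem.re_sub, Mem.re_rget, Mem.ie_const, e0,
        hx s hs r, e2]
      by_cases hlr : l = r
      · subst hlr
        rw [Function.update_self]
        by_cases hts : t = s
        · subst hts; simp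
        · rw [Function.update_of_ne (by exact_mod_cast hts)]
          exact g2 t l (by omega)
      · rw [Function.update_of_ne (by simpa using hlr)]
        have : (l : ℕ) ≠ r := fun h => hlr (Fin.ext h)
        exact g2 t l (by omega)
    · rintro g c'' ⟨g1, gf, g2, g3⟩
      refine ⟨by simp [g1], gf.setI, fun t ht l => ?_, ?_⟩
      · exact g2 t l (by have := l.2; omega)
      · have : (d + 3) * (s + 1) = (d + 3) * s + d + 3 := by ring
        omega
  rintro h1 c1 ⟨-, f1, hw1, hc1⟩
  refine (wp_seqFin (fun k h' c' => Frame [.t, .best] (wrkVars d) h h' ∧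
    (∃ w, IsWrk h' N w ∧ Eliminated N x k w) ∧
      c' ≤ c + 3 + (d + 3) * N + k * ((d + 20) * (N + 1))) ⟨f1, ⟨fun t l => x t l - x 0 l,
        fun t ht l => hw1 t ht l, fun _ => 0, 0, ?_, ?_, ?_, ?_⟩, by omega⟩ ?_).mono ?_
  · intro t ht l; simp
  · intro t ht j hj; omega
  · intro l; simp
  · intro j hj; omega
  · rintro k h' c' ⟨hf, ⟨w, hw, he⟩, h2⟩
    refine (wp_pivot (N := N) (by rw [hf.I _ (by simp), hN]) hN0 hw).mono ?_
    rintro h'' c'' ⟨hf', ⟨b, hb, hmax, hw'⟩, h3⟩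
    refine ⟨hf.trans hf', ⟨_, hw', he.step hb hmax⟩, ?_⟩
    have : ((k : ℕ) + 1) * ((d + 20) * (N + 1)) =
      k * ((d + 20) * (N + 1)) + (d + 20) * (N + 1) := by ring
    omega
  · rintro h' c' ⟨hf, hw, h2⟩
    refine ⟨hf, hw, ?_⟩
    have : (d + 1) * ((d + 20) * (N + 1)) = d * ((d + 20) * (N + 1)) + (d + 3) * N + 17 * N + d + 20 := by
      ring
    omega

/-! ### Grids -/

/-- The grid cell of a number in `[-1, 1]`. -/
def cellOf (F : ℕ) (x : ℝ) : ℕ := ⌊(x + 1) * ((F : ℝ) - 1) / 2⌋.toNat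

/-- The scale is `F - 1` rather than `F`, so that `x = 1` still falls into a cell below `F`. -/
theorem cellOf_spec {F : ℕ} (hF : 0 < F) {x : ℝ} (hx : |x| ≤ 1) :
    (⌊(x + 1) * ((F : ℝ) - 1) / 2⌋ = (cellOf F x : ℤ)) ∧ cellOf F x < F ∧
      (cellOf F x : ℝ) ≤ (x + 1) * ((F : ℝ) - 1) / 2 ∧
      (x + 1) * ((F : ℝ) - 1) / 2 - 1 ≤ cellOf F x := by
  obtain ⟨h1, h2⟩ := abs_le.1 hx
  have hF' : (1 : ℝ) ≤ F := by exact_mod_cast hF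
  set z := (x + 1) * ((F : ℝ) - 1) / 2 with hz
  have hz0 : 0 ≤ z := by
    have := mul_nonneg (by linarith : 0 ≤ x + 1) (by linarith : 0 ≤ (F : ℝ) - 1)
    positivity
  have hzF : z ≤ (F : ℝ) - 1 := by
    rw [hz]; nlinarith
  have e : (⌊z⌋ = (cellOf F x : ℤ)) := (Int.toNat_of_nonneg (Int.floor_nonneg.2 hz0)).symm
  have e' : ((⌊z⌋ : ℤ) : ℝ) = (cellOf F x : ℝ) := by rw [e]; simp
  refine ⟨e, ?_, ?_, ?_⟩
  · have : (cellOf F x : ℝ) < F := by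
      rw [← e']; linarith [Int.floor_le z]
    exact_mod_cast this
  · rw [← e']; exact Int.floor_le z
  · rw [← e']; exact (Int.sub_one_lt_floor z).le

theorem exists_grid {E : ℕ} (hE : 0 < E) {y : ℝ} (hy : |y| ≤ 2) :
    ∃ Y < E, |-2 + 4 * (Y : ℝ) / E - y| ≤ 4 / E := by
  obtain ⟨h1, h2⟩ := abs_le.1 hy
  have hE' : (0 : ℝ) < E := by exact_mod_cast hE
  set z := (y + 2) * E / 4 with hz
  have hz0 : 0 ≤ z := by
    have := mul_nonneg (by linarith : 0 ≤ y + 2) hE'.le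
    positivity
  have hzE : z ≤ E := by rw [hz]; nlinarith
  have key : ∃ Y < E, |(Y : ℝ) - z| ≤ 1 := by
    rcases lt_or_ge ⌊z⌋₊ E with h | h
    · refine ⟨_, h, abs_le.2 ⟨?_, ?_⟩⟩
      · linarith [Nat.lt_floor_add_one z]
      · linarith [Nat.floor_le hz0]
    -- The right end `2` is not a grid point; the last one, `E - 1`, is a full spacing away. Hence
    -- the bound `4 / E`.
    · have h3 : (E : ℝ) ≤ z := (Nat.cast_le.2 h).trans (Nat.floor_le hz0)
      refine ⟨E - 1, by omega, ?_⟩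
      rw [Nat.cast_sub (by omega), le_antisymm hzE h3]
      simp
  obtain ⟨Y, hY, h3⟩ := key
  refine ⟨Y, hY, ?_⟩
  have e : -2 + 4 * (Y : ℝ) / E - y = 4 / E * (Y - z) := by
    rw [hz]; field_simp; ring
  rw [e, abs_mul, abs_of_pos (by positivity)]
  calc _ ≤ 4 / (E : ℝ) * 1 := by gcongr
    _ = _ := mul_one _

/-- Put `y = -2 + 4 * Y / E`. Without rounding, the stored value at `s` is `y * s - s² / 2` up to a
constant that does not depend on `s`. If `y = s + x + e`, the difference of the values at `s` and
`k` is `x * (s - k) + ((s - k + e)² - e²) / 2`, so the loss in direction `x` is at most `e² / 2 ≤ 8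
/ E²`. Rounding to cells adds at most `16 / E²`. -/
theorem grid_coord {E Y : ℕ} (hE : 2 ≤ E) (hY : Y < E) {s k x : ℝ} (hs : |s| ≤ 1) (hk : |k| ≤ 1)
    (hy : |-2 + 4 * (Y : ℝ) / E - (s + x)| ≤ 4 / E) :
    x * s - x * k ≤ (-(s ^ 2 / 2 + 2 * s) +
        8 / (E * ((E * E : ℕ) - 1 : ℝ)) * (Y * cellOf (E * E) s)) -
      (-(k ^ 2 / 2 + 2 * k) + 8 / (E * ((E * E : ℕ) - 1 : ℝ)) * (Y * cellOf (E * E) k))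
      + 24 / (E : ℝ) ^ 2 := by
  have hE' : (2 : ℝ) ≤ E := by exact_mod_cast hE
  have hF : 0 < E * E := Nat.mul_pos (by omega) (by omega)
  obtain ⟨-, -, -, s2⟩ := cellOf_spec hF hs
  obtain ⟨-, -, k1, -⟩ := cellOf_spec hF hk
  set F : ℝ := ((E * E : ℕ) : ℝ) with hFdef
  have hFE : F = (E : ℝ) * E := by rw [hFdef]; push_cast; ring
  have hF1 : 0 < F - 1 := by nlinarith
  set cc := 8 / (E * (F - 1)) with hcc
  have hcc0 : 0 < cc := by positivity
  have hY0 : (0 : ℝ) ≤ Y := Nat.cast_nonneg _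
  have hYE : (Y : ℝ) ≤ E := by exact_mod_cast hY.le
  have e1 : cc * (F - 1) = 8 / E := by rw [hcc]; field_simp
  have A1 : cc * (Y * cellOf (E * E) k) ≤ 4 * Y / E * (k + 1) := by
    calc _ ≤ cc * (Y * ((k + 1) * (F - 1) / 2)) := by gcongr
      _ = (cc * (F - 1)) * Y * (k + 1) / 2 := by ring
      _ = _ := by rw [e1]; ring
  have A2 : 4 * Y / E * (s + 1) - 16 / (E : ℝ) ^ 2 ≤ cc * (Y * cellOf (E * E) s) := by
    -- The rounding error is one cell. Both cells are rounded down, so only the one of `s` hurts.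
    have h3 : cc * Y ≤ 16 / (E : ℝ) ^ 2 := by
      calc cc * Y ≤ cc * E := by gcongr
        _ = 8 / (F - 1) := by rw [hcc]; field_simp
        _ ≤ 16 / (E : ℝ) ^ 2 := by
          rw [div_le_div_iff₀ hF1 (by positivity), hFE]; nlinarith
    calc _ ≤ 4 * Y / E * (s + 1) - cc * Y := by linarith
      _ = (cc * (F - 1)) * Y * (s + 1) / 2 - cc * Y := by rw [e1]; ring
      _ = cc * (Y * ((s + 1) * (F - 1) / 2 - 1)) := by ring
      _ ≤ _ := by gcongr
  set e := -2 + 4 * (Y : ℝ) / E - (s + x) with he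
  have he2 : e ^ 2 ≤ 16 / (E : ℝ) ^ 2 := by
    calc e ^ 2 = |e| ^ 2 := (sq_abs e).symm
      _ ≤ (4 / (E : ℝ)) ^ 2 := by gcongr
      _ = _ := by rw [div_pow]; norm_num
  have hy' : 4 * (Y : ℝ) / E = e + 2 + s + x := by rw [he]; ring
  rw [hy'] at A1 A2
  have h24 : 24 / (E : ℝ) ^ 2 = 16 / (E : ℝ) ^ 2 + 16 / (E : ℝ) ^ 2 / 2 := by ring
  rw [h24]
  -- The completed square.
  nlinarith [sq_nonneg (s - k + e)]

/-- The digits of a number given in base `F`. -/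
theorem digit_sum {F D k : ℕ} {dg : ℕ → ℕ} (hdg : ∀ l, dg l < F) (hk : k < D) :
    (∑ l ∈ Finset.range D, dg l * F ^ l) / F ^ k % F = dg k := by
  obtain ⟨r, rfl⟩ : ∃ r, D = k + 1 + r := ⟨D - (k + 1), by omega⟩
  have hF : 0 < F := Nat.zero_lt_of_lt (hdg 0)
  have e : ∑ l ∈ Finset.range (k + 1 + r), dg l * F ^ l =
      ∑ l ∈ Finset.range k, dg l * F ^ l +
        F ^ k * (dg k + F * ∑ l ∈ Finset.range r, dg (k + 1 + l) * F ^ l) := by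
    rw [Finset.sum_range_add, Finset.sum_range_succ, mul_add, add_assoc]
    congr 2
    · ring
    · rw [← mul_assoc, Finset.mul_sum]
      refine Finset.sum_congr rfl fun l _ => ?_
      ring
  rw [e, Nat.add_mul_div_left _ _ (pow_pos hF k), Nat.div_eq_of_lt (sum_digits_lt hdg k), zero_add,
    Nat.add_mul_mod_self_left, Nat.mod_eq_of_lt (hdg k)]

/-- Extend a tuple by zeros. -/
def extZ {D : ℕ} (f : Fin D → ℕ) (l : ℕ) : ℕ := if h : l < D then f ⟨l, h⟩ else 0

theorem extZ_fin {D : ℕ} (f : Fin D → ℕ) (l : Fin D) : extZ f l = f l := by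
  simp [extZ]

theorem extZ_lt {D E : ℕ} {f : Fin D → ℕ} (hE : 0 < E) (hf : ∀ l, f l < E) (l : ℕ) :
    extZ f l < E := by
  unfold extZ
  split_ifs
  · exact hf _
  · exact hE

/-- The initial key of a point with coordinates `x`. -/
def initKey {D : ℕ} (F : ℕ) (x : Fin D → ℝ) : ℕ :=
  ∑ l ∈ Finset.range D, extZ (fun l => cellOf F (x l)) l * F ^ l

/-- The initial value of a point with height `v` and coordinates `x`. -/
def initVal {D : ℕ} (v : ℝ) (x : Fin D → ℝ) : ℝ := v - ∑ l, ((x l) ^ 2 / 2 + 2 * x l)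

theorem initKey_lt {D F : ℕ} (hF : 0 < F) {x : Fin D → ℝ} (hx : ∀ l, |x l| ≤ 1) :
    initKey F x < F ^ (max D 1) :=
  (sum_digits_lt (extZ_lt hF fun l => (cellOf_spec hF (hx l)).2.1) D).trans_le
    (Nat.pow_le_pow_right hF (le_max_left _ _))

theorem stageVal_init {D E : ℕ} (hE : 0 < E) {cc v : ℝ} {x : Fin D → ℝ} (hx : ∀ l, |x l| ≤ 1)
    (Y : Fin D → ℕ) :
    stageVal E (max D 1) (initKey (E * E) x) cc (initVal v x) (extZ Y) =
      v + ∑ l, (-((x l) ^ 2 / 2 + 2 * x l) + cc * (Y l * cellOf (E * E) (x l))) := by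
  have hF : 0 < E * E := Nat.mul_pos hE hE
  have hd : ∀ l, extZ (fun l => cellOf (E * E) (x l)) l < E * E :=
    extZ_lt hF fun l => (cellOf_spec hF (hx l)).2.1
  have e1 : ∑ l ∈ Finset.range (max D 1), (extZ Y l : ℝ) *
      (initKey (E * E) x / (E * E) ^ l % (E * E) : ℕ) =
      ∑ l : Fin D, (Y l : ℝ) * cellOf (E * E) (x l) := by
    rw [← Finset.sum_subset (Finset.range_subset_range.2 (le_max_left D 1)), Finset.sum_range]
    · refine Finset.sum_congr rfl fun l _ => ?_
      rw [initKey, digit_sum hd l.2, extZ_fin, extZ_fin]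
    · intro l _ hl
      have : ¬ l < D := by simpa using hl
      simp [extZ, this]
  rw [stageVal, e1, initVal, Finset.mul_sum, sub_eq_add_neg, ← Finset.sum_neg_distrib, add_assoc,
    ← Finset.sum_add_distrib]

/-- `grid_coord` summed over the coordinates; the heights enter linearly and without error. For `D =
0` the sums are empty, and `E = 1` is allowed. -/
theorem grid_approx {D E : ℕ} (hE : 0 < E) (hE2 : 0 < D → 2 ≤ E) {vs vk : ℝ}
    {xs xk x : Fin D → ℝ} (hs : ∀ l, |xs l| ≤ 1) (hk : ∀ l, |xk l| ≤ 1)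
    {Y : Fin D → ℕ} (hY : ∀ l, Y l < E)
    (hy : ∀ l, |-2 + 4 * (Y l : ℝ) / E - (xs l + x l)| ≤ 4 / E)
    (hle : stageVal E (max D 1) (initKey (E * E) xs) (8 / (E * ((E * E : ℕ) - 1 : ℝ)))
        (initVal vs xs) (extZ Y) ≤
      stageVal E (max D 1) (initKey (E * E) xk) (8 / (E * ((E * E : ℕ) - 1 : ℝ)))
        (initVal vk xk) (extZ Y)) :
    vs + ∑ l, x l * xs l ≤ vk + ∑ l, x l * xk l + D * (24 / (E : ℝ) ^ 2) := by
  rw [stageVal_init hE hs, stageVal_init hE hk] at hle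
  have h1 : ∑ l, (x l * xs l - x l * xk l) ≤ ∑ l : Fin D, _ := Finset.sum_le_sum fun l _ =>
    grid_coord (hE2 (Nat.zero_lt_of_lt l.2)) (hY l) (hs l) (hk l) (hy l)
  rw [Finset.sum_sub_distrib, Finset.sum_add_distrib, Finset.sum_sub_distrib] at h1
  simp only [Finset.sum_const, Finset.card_univ, Fintype.card_fin, nsmul_eq_mul] at h1
  linarith

/-! ### Extreme points for the directions of one face of the cube -/

/-- Set up the items for the face with outer normal `s` times the `a`-th unit vector. -/
def faceInitP {D : ℕ} (a : Fin (D + 1)) (s : ℤ) : Prog :=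
  .seq (forP .t (isc .n)
    (.seq (rset (RVar.val : RVar (D + 1)) (isc .t) (.mul (.ofInt (.const s)) (rget (.wrk a) (isc .t))))
    (.seq (iset .key (isc .t) (.const 0))
    (.seq (iset .id (isc .t) (isc .t))
      (seqFin D fun l =>
        .seq (rset (RVar.val : RVar (D + 1)) (isc .t)
          (.sub (rget (RVar.val : RVar (D + 1)) (isc .t))
            (.add (.div (.mul (rget (.wrk (a.succAbove l)) (isc .t))
              (rget (.wrk (a.succAbove l)) (isc .t))) (.ofInt (.const 2)))
              (.mul (.ofInt (.const 2)) (rget (.wrk (a.succAbove l)) (isc .t))))))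
        (.seq (fset .i (.const 0)
          (.div (.mul (.add (rget (.wrk (a.succAbove l)) (isc .t)) (.ofInt (.const 1)))
            (.sub (.ofInt (isc .F)) (.ofInt (.const 1)))) (.ofInt (.const 2))))
          (iset .key (isc .t) (.add (iget .key (isc .t)) (.mul (isc .i) (ipow (isc .F) l))))))))))
  (iset .N (.const 0) (isc .n))

theorem wp_faceInit {D : ℕ} {ω : Draws (D + 1) n} {h : Mem (D + 1) n} {c N F : ℕ} {a : Fin (D + 1)}
    {s : ℤ} {w : ℕ → Fin (D + 1) → ℝ} (hN : h.I .n 0 = N) (hF : h.I .F 0 = F) (hF0 : 0 < F)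
    (hw : IsWrk h N w) (hw1 : ∀ t < N, ∀ l, |w t l| ≤ 1) :
    WP ω (faceInitP a s) h c fun h' c' => Frame [.t, .i, .key, .id, .N] [.val] h h' ∧
      h'.I .N 0 = N ∧ (∀ t < N, h'.I .key (t : ℕ) = initKey F (fun l => w t (a.succAbove l)) ∧
        h'.R .val (t : ℕ) = initVal (s * w t a) (fun l => w t (a.succAbove l)) ∧
        h'.I .id (t : ℕ) = t) ∧ c' ≤ c + (3 * D + 10) * (N + 1) := by
  refine wp_seq (wp_for N (fun r h' c' => h'.I .t 0 = r ∧ Frame [.t, .i, .key, .id] [.val] h h' ∧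
    (∀ t < r, h'.I .key (t : ℕ) = initKey F (fun l => w t (a.succAbove l)) ∧
        h'.R .val (t : ℕ) = initVal (s * w t a) (fun l => w t (a.succAbove l)) ∧
        h'.I .id (t : ℕ) = t) ∧ c' ≤ c + 1 + (3 * D + 6) * r) ?_ ?_ ?_ ?_)
  · exact ⟨by simp, (Frame.refl _ _ h).setI, by simp, by simp⟩
  · rintro r h' c' - ⟨h1, hf, -⟩
    exact ⟨h1, by simp [hf.I .n (by simp), hN]⟩
  · rintro r h' c' hr ⟨h1, hf, h2, h3⟩
    set x : Fin D → ℝ := fun l => w r (a.succAbove l) with hx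
    set g : ℕ → ℝ := fun l => if hl : l < D then (x ⟨l, hl⟩) ^ 2 / 2 + 2 * x ⟨l, hl⟩ else 0 with hg
    have hgs : initVal (s * w r a) x = s * w r a - ∑ l ∈ Finset.range D, g l := by
      rw [initVal, Finset.sum_range]
      simp [hg]
    have hwr : ∀ l, h'.R (.wrk l) (r : ℕ) = w r l := fun l => by
      rw [hf.R _ (by simp), hw r hr]
    refine wp_seq (wp_rset (wp_seq (wp_iset (wp_seq (wp_iset
      ((wp_seqFin (fun k q c'' => q.I .t 0 = r ∧ Frame [.t, .i, .key, .id] [.val] h q ∧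
        (∀ t < r, q.I .key (t : ℕ) = initKey F (fun l => w t (a.succAbove l)) ∧
        q.R .val (t : ℕ) = initVal (s * w t a) (fun l => w t (a.succAbove l)) ∧
        q.I .id (t : ℕ) = t) ∧
        q.I .key (r : ℕ) = (∑ l ∈ Finset.range k, extZ (fun l => cellOf F (x l)) l * F ^ l : ℕ) ∧
        q.R .val (r : ℕ) = s * w r a - ∑ l ∈ Finset.range k, g l ∧
        q.I .id (r : ℕ) = r ∧ c'' ≤ c + 1 + (3 * D + 6) * r + 5 + 3 * k) ?_ ?_).mono ?_))))))
    · refine ⟨by simp [h1], hf.setR.setI.setI, ?_, by simp [h1], by simp [h1, hwr], by simp [h1],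
        by omega⟩
      intro t ht
      have hne : (t : ℤ) ≠ r := by exact_mod_cast ht.ne
      simpa [h1, hne] using h2 t ht
    · rintro k q c'' ⟨q1, qf, q2, q3, q4, q5, q6⟩
      have e1 : q.R (.wrk (a.succAbove k)) (r : ℕ) = x k := by rw [qf.R _ (by simp), hw r hr]
      have e2 : q.I .F 0 = F := by rw [qf.I _ (by simp), hF]
      have e3 := (cellOf_spec hF0 (x := x k) (hw1 r hr _)).1
      refine wp_seq (wp_rset (wp_seq (wp_fset (wp_iset ⟨?_, qf.setR.setI.setI, ?_, ?_, ?_, ?_,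
        by omega⟩))))
      · simp [q1]
      · intro t ht
        have hne : (t : ℤ) ≠ r := by exact_mod_cast ht.ne
        simpa [q1, hne] using q2 t ht
      · rw [Finset.sum_range_succ]
        simp [q1, e1, e2, e3, q3, extZ_fin]
      · rw [Finset.sum_range_succ]
        simp only [Mem.setI_R, Mem.setR_R, Mem.ie_isc, q1, Function.update_self, Mem.re_sub,
          Mem.re_add, Mem.re_div, Mem.re_mul, Mem.re_rget, q4, e1, Mem.re_ofInt, Mem.ie_const]
        have : g k = x k ^ 2 / 2 + 2 * x k := by simp [hg]
        rw [this]
        push_cast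
        ring
      · simpa using q5
    · rintro q c'' ⟨q1, qf, q2, q3, q4, q5, q6⟩
      refine ⟨by simp [q1], qf.setI, ?_, ?_⟩
      · intro t ht
        simp only [Mem.setI_I, ne_eq, reduceCtorEq, not_false_eq_true, Function.update_of_ne,
          Mem.setI_R]
        rcases Nat.lt_succ_iff_lt_or_eq.1 ht with ht | rfl
        · exact q2 t ht
        · exact ⟨q3, by rw [q4, ← hgs], q5⟩
      · have : (3 * D + 6) * (r + 1) = (3 * D + 6) * r + 3 * D + 6 := by ring
        omega
  · rintro h' c' ⟨-, hf, h2, h3⟩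
    refine wp_iset ⟨hf.weaken.setI, ?_, by simpa using h2, ?_⟩
    · simp [hf.I .n (by simp), hN]
    · have : (3 * D + 10) * (N + 1) = (3 * D + 6) * N + 4 * N + 3 * D + 10 := by ring
      omega

/-- Append all current items to the output. -/
def emitP (d : ℕ) : Prog := forP .t (isc .N) (.emit (rawAddr d (iget .id (isc .t))))

/-- The raw point with index `t`. -/
def Mem.pt (h : Mem d n) (t : ℕ) : Pt d := WithLp.toLp 2 fun k : Fin d => h.R (.raw k) (t : ℕ)

/-- Append points to the `J`-th output list. -/
def Mem.app (h : Mem d n) (J : ℕ) (L : List ℕ) : Mem d n :=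
  { h with out := Function.update h.out J (h.out J ++ L.map h.pt) }

theorem Mem.app_app (h : Mem d n) (J : ℕ) (L L' : List ℕ) :
    (h.app J L).app J L' = h.app J (L ++ L') := by
  unfold Mem.app Mem.pt
  simp

theorem Frame.app {MI : List IVar} {MR : List (RVar d)} {h h' : Mem d n} (hf : Frame MI MR h h')
    (J : ℕ) (L : List ℕ) (hR : ∀ k, RVar.raw k ∉ MR) : Frame MI MR (h.app J L) (h'.app J L) := by
  refine ⟨hf.I, hf.R, hf.drawn, hf.outLen, ?_⟩
  have : h'.pt = h.pt := by
    funext t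
    unfold Mem.pt
    congr 1
    funext k
    rw [hf.R _ (hR k)]
  simp only [Mem.app, hf.out, this]

theorem wp_emitAll {ω : Draws d n} {h : Mem d n} {c M J : ℕ} {f : ℕ → ℕ} (hM : h.I .N 0 = M)
    (hJ : h.outLen = J + 1) (hf : ∀ s < M, h.I .id (s : ℕ) = f s) :
    WP ω (emitP d) h c fun h' c' => Frame [.t] [] (h.app J ((List.range M).map f)) h' ∧
      c' = c + 3 * M + 2 := by
  refine wp_for M (fun k h' c' => h'.I .t 0 = k ∧
    Frame [.t] [] (h.app J ((List.range k).map f)) h' ∧ c' = c + 1 + 3 * k) ?_ ?_ ?_ ?_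
  · have : Frame [.t] [] (h.app J ((List.range 0).map f)) h :=
      ⟨fun _ _ => rfl, fun _ _ => rfl, rfl, rfl, by simp [Mem.app]⟩
    exact ⟨by simp, this.setI, by simp⟩
  · rintro k h' c' - ⟨h1, fr, -⟩
    exact ⟨h1, by simp [fr.I .N (by simp), Mem.app, hM]⟩
  · rintro k h' c' hk ⟨h1, fr, rfl⟩
    refine wp_emit J (fr.outLen.trans hJ) ?_
    have fr' : Frame [.t] [] (h.app J ((List.range (k + 1)).map f)) { h' with
        out := Function.update h'.out J (h'.out J ++
          [WithLp.toLp 2 fun l : Fin d => h'.R (.raw l) (h'.ie (iget .id (isc .t)))]) } := by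
      refine ⟨fr.I, fr.R, fr.drawn, fr.outLen, ?_⟩
      have e1 : h'.I .id k = f k := by rw [fr.I _ (by simp)]; exact hf k hk
      have e2 : ∀ l : Fin d, h'.R (.raw l) = h.R (.raw l) := fun l => fr.R _ (by simp)
      simp only [fr.out, Mem.ie_iget, Mem.ie_isc, h1, e1, e2]
      simp [Mem.app, List.range_succ, Mem.pt]
    exact ⟨by simp [h1], fr'.setI, by ring⟩
  · rintro h' c' ⟨-, fr, rfl⟩
    exact ⟨fr, by ring⟩

/-- Output extreme points for the directions of one face. -/
def faceP {D : ℕ} (a : Fin (D + 1)) (s : ℤ) : Prog :=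
  .seq (faceInitP a s) (.seq (stagesP (D + 1) (max D 1) (max D 1)) (emitP (D + 1)))

/-- The precision for which the machine is set up. -/
structure Ready {D : ℕ} (h : Mem (D + 1) n) (N E : ℕ) : Prop where
  hn : h.I .n 0 = N
  hE : h.I .E 0 = E
  hF : h.I .F 0 = (E * E : ℕ)
  hc : h.R .c 0 = 8 / (E * ((E * E : ℕ) - 1 : ℝ))
  pos : 0 < E
  two : 0 < D → 2 ≤ E

theorem Ready.frame {D : ℕ} {h h' : Mem (D + 1) n} {N E : ℕ} (H : Ready h N E) {MI : List IVar}
    {MR : List (RVar (D + 1))} (hf : Frame MI MR h h') (h1 : .n ∉ MI) (h2 : .E ∉ MI) (h3 : .F ∉ MI)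
    (h4 : .c ∉ MR) : Ready h' N E :=
  ⟨by rw [hf.I _ h1, H.hn], by rw [hf.I _ h2, H.hE], by rw [hf.I _ h3, H.hF], by rw [hf.R _ h4, H.hc],
    H.pos, H.two⟩

/-- For `E = 1`, possible only if `D = 0`, the denominator is `0` and the factor has the value `0`;
the single stage then just selects a maximal height. -/
theorem Ready.c_nonneg {D : ℕ} {h : Mem (D + 1) n} {N E : ℕ} (H : Ready h N E) :
    (0 : ℝ) ≤ 8 / (E * ((E * E : ℕ) - 1 : ℝ)) := by
  have h1 : 1 ≤ E * E := Nat.mul_pos H.pos H.pos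
  have h2 : (1 : ℝ) ≤ (E * E : ℕ) := by exact_mod_cast h1
  have : (0 : ℝ) ≤ (E * E : ℕ) - 1 := by linarith
  positivity

/-- The grid point used for a point `p` and a direction `x` is one near `w p + x` and so depends on
both. Since each summand lies in the unit cube, the grid has to cover `[-2, 2]^D`. -/
theorem wp_face {D : ℕ} {ω : Draws (D + 1) n} {h : Mem (D + 1) n} {c N E J : ℕ} {a : Fin (D + 1)}
    {s : ℤ} {w : ℕ → Fin (D + 1) → ℝ} (H : Ready h N E) (hJ : h.outLen = J + 1)
    (hw : IsWrk h N w) (hw1 : ∀ t < N, ∀ l, |w t l| ≤ 1) :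
    WP ω (faceP a s) h c fun h' c' => ∃ L : List ℕ, Frame stageVars [.val, .oval] (h.app J L) h' ∧
      L.length ≤ E ^ (max D 1) ∧ (∀ q ∈ L, q < N) ∧
      (∀ p < N, ∀ x : Fin D → ℝ, (∀ l, |x l| ≤ 1) → ∃ q ∈ L,
        s * w p a + ∑ l, x l * w p (a.succAbove l) ≤
          s * w q a + ∑ l, x l * w q (a.succAbove l) + D * (24 / (E : ℝ) ^ 2)) ∧
      c' ≤ c + 1000 * (D + 1) * (N + E ^ (2 * max D 1 - 1)) := by
  have hE0 := H.pos
  have hF0 : 0 < E * E := Nat.mul_pos hE0 hE0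
  refine wp_seq ((wp_faceInit H.hn H.hF hF0 hw hw1).mono ?_)
  rintro h1 c1 ⟨f1, n1, i1, hc1⟩
  have f1' : Frame stageVars [.val, .oval] h h1 := f1.weaken (by simp [stageVars])
  have R1 := H.frame f1 (by simp) (by simp) (by simp) (by simp)
  refine wp_seq ((wp_stages (N := N) (E := E) (D := max D 1)
    (key := fun t => initKey (E * E) fun l => w t (a.succAbove l))
    (val := fun t => initVal (s * w t a) fun l => w t (a.succAbove l))
    H.c_nonneg R1.hc R1.hE hE0 R1.hF n1
    (fun t ht => ⟨(i1 t ht).1, initKey_lt hF0 fun l => hw1 t ht _⟩) (fun t ht => (i1 t ht).2.1)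
    (fun t ht => (i1 t ht).2.2) (by simp)).mono ?_)
  rintro h2 c2 ⟨f2, M, m1, m2, m3, m4, m5⟩
  choose! f hf hf' using m4
  have f12 := f1'.trans f2
  refine (wp_emitAll (J := J) m2 (by rw [f12.outLen, hJ]) hf').mono ?_
  rintro h3 c3 ⟨f3, rfl⟩
  refine ⟨(List.range M).map f, ?_, by simpa using m1, ?_, ?_, ?_⟩
  · exact (f12.app J _ (by simp)).trans f3 (by simp [stageVars])
  · intro q hq
    simp only [List.mem_map, List.mem_range] at hq
    obtain ⟨r, hr, rfl⟩ := hq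
    exact hf r hr
  · intro p hp x hx
    have hy : ∀ l, ∃ Y < E, |-2 + 4 * (Y : ℝ) / E - (w p (a.succAbove l) + x l)| ≤ 4 / E := by
      intro l
      refine exists_grid hE0 ((abs_add_le _ _).trans ?_)
      have := hw1 p hp (a.succAbove l)
      have := hx l
      linarith
    choose Y hY hy using hy
    obtain ⟨r, hr, q, hq, r1, r2⟩ := m3 p hp (extZ Y) (extZ_lt hE0 hY)
    have hqr : q = f r := by
      have := hf' r hr
      rw [r1] at this
      exact_mod_cast this
    refine ⟨q, by simp only [List.mem_map, List.mem_range]; exact ⟨r, hr, hqr.symm⟩, ?_⟩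
    exact grid_approx hE0 H.two (fun l => hw1 p hp _) (fun l => hw1 q hq _) hY hy r2
  · have e1 : E ^ (max D 1) ≤ E ^ (2 * max D 1 - 1) := Nat.pow_le_pow_right hE0 (by omega)
    have e2 : 1 ≤ E ^ (2 * max D 1 - 1) := Nat.pow_pos hE0
    set T := N + E ^ (2 * max D 1 - 1) with hT
    have e3 : (max D 1) * (400 * T) ≤ (D + 1) * (400 * T) :=
      Nat.mul_le_mul_right _ (by omega)
    have e4 : (3 * D + 10) * (N + 1) ≤ (3 * D + 10) * T := Nat.mul_le_mul_left _ (by omega)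
    have e5 : (3 * D + 10) * T + (D + 1) * (400 * T) + 6 * T ≤ 1000 * (D + 1) * T := by
      have : 1000 * (D + 1) * T = (3 * D + 10) * T + (D + 1) * (400 * T) + 6 * T +
        (597 * D + 584) * T := by ring
      omega
    omega

/-- Output extreme points for all directions. -/
def facesP (D : ℕ) : Prog := seqFin (D + 1) fun a => .seq (faceP a 1) (faceP a (-1))

theorem wp_faces {D : ℕ} {ω : Draws (D + 1) n} {h : Mem (D + 1) n} {c N E J : ℕ}
    {w : ℕ → Fin (D + 1) → ℝ} (H : Ready h N E) (hJ : h.outLen = J + 1)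
    (hw : IsWrk h N w) (hw1 : ∀ t < N, ∀ l, |w t l| ≤ 1) :
    WP ω (facesP D) h c fun h' c' => ∃ L : List ℕ, Frame stageVars [.val, .oval] (h.app J L) h' ∧
      L.length ≤ (D + 1) * (2 * E ^ (max D 1)) ∧ (∀ q ∈ L, q < N) ∧
      (∀ a : Fin (D + 1), ∀ s : ℤ, s = 1 ∨ s = -1 → ∀ p < N, ∀ x : Fin D → ℝ, (∀ l, |x l| ≤ 1) →
        ∃ q ∈ L, s * w p a + ∑ l, x l * w p (a.succAbove l) ≤
          s * w q a + ∑ l, x l * w q (a.succAbove l) + D * (24 / (E : ℝ) ^ 2)) ∧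
      c' ≤ c + 1 + (D + 1) * (2000 * (D + 1) * (N + E ^ (2 * max D 1 - 1))) := by
  refine (wp_seqFin (fun k h' c' => ∃ L : List ℕ,
      Frame stageVars [.val, .oval] (h.app J L) h' ∧
      L.length ≤ k * (2 * E ^ (max D 1)) ∧ (∀ q ∈ L, q < N) ∧
      (∀ a : Fin (D + 1), (a : ℕ) < k → ∀ s : ℤ, s = 1 ∨ s = -1 → ∀ p < N, ∀ x : Fin D → ℝ,
        (∀ l, |x l| ≤ 1) →
        ∃ q ∈ L, s * w p a + ∑ l, x l * w p (a.succAbove l) ≤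
          s * w q a + ∑ l, x l * w q (a.succAbove l) + D * (24 / (E : ℝ) ^ 2)) ∧
      c' ≤ c + 1 + k * (2000 * (D + 1) * (N + E ^ (2 * max D 1 - 1)))) ?_ ?_).mono ?_
  · refine ⟨[], ⟨fun _ _ => rfl, fun _ _ => rfl, rfl, rfl, ?_⟩, by simp, by simp,
      fun a ha => by omega, by omega⟩
    simp [Mem.app]
  · rintro a h1 c1 ⟨L, f1, l1, l2, l3, l4⟩
    have H1 : Ready h1 N E := Ready.frame (h := h.app J L) ⟨H.hn, H.hE, H.hF, H.hc, H.pos, H.two⟩ f1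
      (by simp [stageVars]) (by simp [stageVars]) (by simp [stageVars]) (by simp)
    have hw1' : IsWrk h1 N w := fun t ht l => by rw [f1.R _ (by simp)]; exact hw t ht l
    refine wp_seq ((wp_face H1 (f1.outLen.trans hJ) hw1' hw1).mono ?_)
    rintro h2 c2 ⟨L2, f2, a1, a2, a3, a4⟩
    have f12 := (f1.app J L2 (by simp)).trans f2
    rw [Mem.app_app] at f12
    have H2 : Ready h2 N E := Ready.frame (h := h.app J (L ++ L2))
      ⟨H.hn, H.hE, H.hF, H.hc, H.pos, H.two⟩ f12
      (by simp [stageVars]) (by simp [stageVars]) (by simp [stageVars]) (by simp)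
    have hw2' : IsWrk h2 N w := fun t ht l => by rw [f12.R _ (by simp)]; exact hw t ht l
    refine (wp_face H2 (f12.outLen.trans hJ) hw2' hw1).mono ?_
    rintro h3 c3 ⟨L3, f3, b1, b2, b3, b4⟩
    have f13 := (f12.app J L3 (by simp)).trans f3
    rw [Mem.app_app] at f13
    refine ⟨_, f13, ?_, ?_, ?_, ?_⟩
    · simp only [List.length_append]
      have : ((a : ℕ) + 1) * (2 * E ^ max D 1) = a * (2 * E ^ max D 1) + 2 * E ^ max D 1 := by ring
      omega
    · intro q hq
      simp only [List.mem_append] at hq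
      rcases hq with (hq | hq) | hq
      · exact l2 q hq
      · exact a2 q hq
      · exact b2 q hq
    · intro a' ha' s hs p hp x hx
      simp only [List.mem_append]
      rcases Nat.lt_succ_iff_lt_or_eq.1 ha' with ha' | ha'
      · obtain ⟨q, hq, hq'⟩ := l3 a' ha' s hs p hp x hx
        exact ⟨q, Or.inl (Or.inl hq), hq'⟩
      · obtain rfl : a' = a := Fin.ext ha'
        rcases hs with rfl | rfl
        · obtain ⟨q, hq, hq'⟩ := a3 p hp x hx
          exact ⟨q, Or.inl (Or.inr hq), hq'⟩
        · obtain ⟨q, hq, hq'⟩ := b3 p hp x hx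
          exact ⟨q, Or.inr hq, hq'⟩
    · have : ((a : ℕ) + 1) * (2000 * (D + 1) * (N + E ^ (2 * max D 1 - 1))) =
        a * (2000 * (D + 1) * (N + E ^ (2 * max D 1 - 1))) +
        (1000 * (D + 1) * (N + E ^ (2 * max D 1 - 1)) +
        1000 * (D + 1) * (N + E ^ (2 * max D 1 - 1))) := by ring
      omega
  · rintro h' c' ⟨L, f1, l1, l2, l3, l4⟩
    exact ⟨L, f1, l1, l2, fun a => l3 a a.2, l4⟩

/-! ### Widths of finite sets and kernels -/

theorem inner_sub_le_width {S : Set (Pt d)} (hS : S.Finite) {p q : Pt d} (hp : p ∈ S) (hq : q ∈ S)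
    (u : Pt d) : inner ℝ p u - inner ℝ q u ≤ width S u :=
  sub_le_sub (le_csSup (hS.image _).bddAbove ⟨p, hp, rfl⟩)
    (csInf_le (hS.image _).bddBelow ⟨q, hq, rfl⟩)

theorem exists_width_eq {S : Set (Pt d)} (hS : S.Finite) (h0 : S.Nonempty) (u : Pt d) :
    ∃ p ∈ S, ∃ q ∈ S, width S u = inner ℝ p u - inner ℝ q u := by
  obtain ⟨p, hp, hp'⟩ := (h0.image fun p : Pt d => inner ℝ p u).csSup_mem (hS.image _)
  obtain ⟨q, hq, hq'⟩ := (h0.image fun p : Pt d => inner ℝ p u).csInf_mem (hS.image _)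
  exact ⟨p, hp, q, hq, by rw [width, ← hp', ← hq']⟩

/-- In the coordinates `w` the direction becomes the vector `o` of its values on the `r j`. Dividing
by its largest entry `|o a|` puts it on a face of the cube; undoing this multiplies the error by `|o
a| ≤ 2 ^ D * W`. -/
theorem Eliminated.exists_support {D N : ℕ} {P : ℕ → Pt (D + 1)} {w : ℕ → Fin (D + 1) → ℝ}
    (H : Eliminated N (fun t l => P t l) (D + 1) w) {L : List ℕ} {e : ℝ} (hL : ∀ q ∈ L, q < N)
    (hcov : ∀ a : Fin (D + 1), ∀ s : ℤ, s = 1 ∨ s = -1 → ∀ p < N, ∀ x : Fin D → ℝ,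
      (∀ l, |x l| ≤ 1) → ∃ q ∈ L, s * w p a + ∑ l, x l * w p (a.succAbove l) ≤
          s * w q a + ∑ l, x l * w q (a.succAbove l) + e) (he : 0 ≤ e) {u : Pt (D + 1)} {W : ℝ}
    (hW0 : 0 ≤ W) (hW : ∀ t < N, |inner ℝ (P t) u - inner ℝ (P 0) u| ≤ W) {t : ℕ} (ht : t < N) :
    ∃ q ∈ L, inner ℝ (P t) u ≤ inner ℝ (P q) u + e * (2 ^ D * W) := by
  have hin : ∀ p : Pt (D + 1), inner ℝ p u = ∑ l, p l * u l := fun p => by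
    rw [PiLp.inner_apply]
    exact Finset.sum_congr rfl fun l _ => by simp [mul_comm]
  have hsub : ∀ t, inner ℝ (P t) u - inner ℝ (P 0) u = ∑ l, (P t l - P 0 l) * u l := fun t => by
    rw [hin, hin, ← Finset.sum_sub_distrib]
    exact Finset.sum_congr rfl fun l _ => by ring
  obtain ⟨r, h1, h2⟩ := H.coeff_le
  have h2 := h2 u W fun t ht => by rw [← hsub]; exact hW t ht
  set o : Fin (D + 1) → ℝ := fun j => ∑ l, r j l * u l with ho
  have h3 : ∀ t < N, inner ℝ (P t) u = inner ℝ (P 0) u + ∑ j, w t j * o j := by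
    intro t ht
    rw [← sub_eq_iff_eq_add', hsub]
    simp only [h1 t ht, ho, Finset.sum_mul, Finset.mul_sum]
    rw [Finset.sum_comm]
    exact Finset.sum_congr rfl fun j _ => Finset.sum_congr rfl fun l _ => by ring
  obtain ⟨a, ha⟩ := Finite.exists_max fun j => |o j|
  obtain ⟨s, hs, hsa⟩ : ∃ s : ℤ, (s = 1 ∨ s = -1) ∧ o a = |o a| * s := by
    rcases le_total 0 (o a) with h | h
    · exact ⟨1, Or.inl rfl, by rw [abs_of_nonneg h]; simp⟩
    · exact ⟨-1, Or.inr rfl, by rw [abs_of_nonpos h]; simp⟩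
  set x : Fin D → ℝ := fun l => o (a.succAbove l) / |o a| with hx
  have hx1 : ∀ l, |x l| ≤ 1 := fun l => by
    rw [hx, abs_div, abs_abs]
    exact div_le_one_of_le₀ (ha _) (abs_nonneg _)
  have hox : ∀ l, o (a.succAbove l) = |o a| * x l := fun l => by
    rcases eq_or_ne |o a| 0 with h0 | h0
    · have := ha (a.succAbove l)
      simp only [h0] at this
      rw [h0, zero_mul]
      exact abs_nonpos_iff.1 this
    · rw [hx]; field_simp
  have h4 : ∀ t < N, inner ℝ (P t) u = inner ℝ (P 0) u +
      |o a| * (s * w t a + ∑ l, x l * w t (a.succAbove l)) := fun t ht => by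
    have e1 : w t a * o a = |o a| * (s * w t a) := by
      calc w t a * o a = w t a * (|o a| * s) := by rw [← hsa]
        _ = _ := by ring
    rw [h3 t ht, Fin.sum_univ_succAbove _ a, mul_add, e1, Finset.mul_sum]
    congr 2
    refine Finset.sum_congr rfl fun l _ => ?_
    rw [hox]; ring
  obtain ⟨q, hq, hq'⟩ := hcov a s hs t ht x hx1
  refine ⟨q, hq, ?_⟩
  have e1 := mul_le_mul_of_nonneg_left hq' (abs_nonneg (o a))
  have e2 : |o a| ≤ 2 ^ D * W := (h2 a).trans (mul_le_mul_of_nonneg_right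
    (pow_le_pow_right₀ one_le_two (Nat.lt_succ_iff.1 a.2)) hW0)
  have e3 := mul_le_mul_of_nonneg_left e2 he
  rw [h4 t ht, h4 q (hL q hq)]
  rw [mul_add] at e1
  linarith

/-- The error occurs at both ends of the support, for `u` and for `-u`; hence the factor `2`. -/
theorem Eliminated.isKernel {D N : ℕ} {P : ℕ → Pt (D + 1)} {w : ℕ → Fin (D + 1) → ℝ}
    (H : Eliminated N (fun t l => P t l) (D + 1) w) (hN : 0 < N) {L : List ℕ} {e α : ℝ}
    (hL : ∀ q ∈ L, q < N)
    (hcov : ∀ a : Fin (D + 1), ∀ s : ℤ, s = 1 ∨ s = -1 → ∀ p < N, ∀ x : Fin D → ℝ,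
      (∀ l, |x l| ≤ 1) → ∃ q ∈ L, s * w p a + ∑ l, x l * w p (a.succAbove l) ≤
          s * w q a + ∑ l, x l * w q (a.succAbove l) + e) (he : 0 ≤ e) (hα : 2 * e * 2 ^ D ≤ α) :
    IsKernel α {p | p ∈ L.map P} (P '' {t | t < N}) := by
  have hfin : (P '' {t | t < N}).Finite := (Set.finite_lt_nat N).image _
  have hsub : {p | p ∈ L.map P} ⊆ P '' {t | t < N} := by
    rintro p hp
    simp only [Set.mem_ofPred_eq, List.mem_map] at hp
    obtain ⟨q, hq, rfl⟩ := hp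
    exact ⟨q, hL q hq, rfl⟩
  have hne : {p | p ∈ L.map P}.Nonempty := by
    obtain ⟨q, hq, -⟩ := hcov 0 1 (Or.inl rfl) 0 hN 0 (by simp)
    exact ⟨P q, List.mem_map_of_mem hq⟩
  refine ⟨hsub, hne, fun u _ => ?_⟩
  set W := width (P '' {t | t < N}) u with hWdef
  have hmem : ∀ t < N, P t ∈ P '' {t | t < N} := fun t ht => ⟨t, ht, rfl⟩
  have hW : ∀ t < N, |inner ℝ (P t) u - inner ℝ (P 0) u| ≤ W := fun t ht =>
    abs_sub_le_iff.2 ⟨inner_sub_le_width hfin (hmem t ht) (hmem 0 hN) u,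
      inner_sub_le_width hfin (hmem 0 hN) (hmem t ht) u⟩
  have hW0 : 0 ≤ W := (abs_nonneg _).trans (hW 0 hN)
  obtain ⟨-, ⟨t1, ht1, rfl⟩, -, ⟨t2, ht2, rfl⟩, hw⟩ := exists_width_eq hfin (hne.mono hsub) u
  obtain ⟨q1, hq1, h1⟩ := H.exists_support hL hcov he hW0 hW ht1
  obtain ⟨q2, hq2, h2⟩ := H.exists_support hL hcov he (u := -u) hW0 (fun t ht => by
    simp only [inner_neg_right]
    rw [← neg_sub', abs_neg]
    exact hW t ht) ht2
  simp only [inner_neg_right] at h2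
  have h3 := inner_sub_le_width (hfin.subset hsub) (List.mem_map_of_mem hq1 : P q1 ∈ L.map P)
    (List.mem_map_of_mem hq2 : P q2 ∈ L.map P) u
  have h4 := mul_le_mul_of_nonneg_right hα hW0
  rw [← hWdef] at hw
  linarith

/-! ### One round and the whole program -/

/-- Draw one point from each distribution. -/
def drawP (d : ℕ) : Prog := forP .t (isc .n) (.draw (isc .t) (rawAddr d (isc .t)))

/-- All draw counters stand at `J` before round `J`, so this round reads exactly row `J` of the
outcomes, and different rounds use independent supports. -/
theorem wp_drawAll {ω : Draws d n} {h : Mem d n} {c J : ℕ} (hn : h.I .n 0 = n)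
    (hd : h.drawn = fun _ => J) :
    WP ω (drawP d) h c fun h' c' => (∀ v, v ≠ .t → h'.I v = h.I v) ∧
      (∀ v, (∀ k, v ≠ .raw k) → h'.R v = h.R v) ∧ h'.outLen = h.outLen ∧ h'.out = h.out ∧
      h'.drawn = (fun _ => J + 1) ∧
      (∀ t : Fin n, ∀ l, h'.R (.raw l) (t : ℕ) = ω J t l) ∧ c' = c + 3 * n + 2 := by
  refine wp_for n (fun k h' c' => h'.I .t 0 = k ∧ (∀ v, v ≠ .t → h'.I v = h.I v) ∧
      (∀ v, (∀ k, v ≠ .raw k) → h'.R v = h.R v) ∧ h'.outLen = h.outLen ∧ h'.out = h.out ∧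
      (∀ i : Fin n, h'.drawn i = if (i : ℕ) < k then J + 1 else J) ∧
      (∀ t : Fin n, (t : ℕ) < k → ∀ l, h'.R (.raw l) (t : ℕ) = ω J t l) ∧ c' = c + 1 + 3 * k)
    ?_ ?_ ?_ ?_
  · exact ⟨by simp, fun v hv => by simp [hv], by simp, rfl, rfl, by simp [hd], by simp, by simp⟩
  · rintro k h' c' - ⟨h1, h2, -⟩
    exact ⟨h1, by simp [h2 .n (by simp), hn]⟩
  · rintro k h' c' hk ⟨h1, h2, h3, h4, h5, h6, h7, rfl⟩
    refine wp_draw ⟨k, hk⟩ (by simp [h1]) ⟨by simp [h1, Mem.setRaw], ?_, ?_, h4, h5, ?_, ?_, by ring⟩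
    · intro v hv
      simp [hv, Mem.setRaw, h2 v hv]
    · intro v hv
      rw [← h3 v hv]
      cases v with
      | raw k => exact absurd rfl (hv k)
      | _ => rfl
    · intro i
      simp only [Mem.setI_drawn, Function.update_apply, Fin.ext_iff]
      rcases lt_trichotomy (i : ℕ) k with hi | hi | hi
      · rw [if_neg hi.ne, h6, if_pos hi, if_pos (by omega)]
      · rw [if_pos hi, h6, if_neg (lt_irrefl k), if_pos (by omega)]
      · rw [if_neg hi.ne', h6, if_neg (by omega), if_neg (by omega)]
    · intro t ht l
      have e : h'.drawn ⟨k, hk⟩ = J := by rw [h6]; simp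
      simp only [Mem.setRaw, Mem.setI_R, Mem.ie_isc, h1, e]
      rcases Nat.lt_succ_iff_lt_or_eq.1 ht with ht | rfl
      · rw [Function.update_of_ne (by exact_mod_cast ht.ne)]
        exact h7 t ht l
      · simp
  · rintro h' c' ⟨h1, h2, h3, h4, h5, h6, h7, rfl⟩
    exact ⟨h2, h3, h4, h5, by funext i; simp [h6], fun t => h7 t t.2, by ring⟩

/-- Draw a random support and output a kernel of it. -/
def roundP (D : ℕ) : Prog :=
  .seq .newSet (.seq (drawP (D + 1)) (.seq (normP (D + 1)) (facesP D)))

theorem wp_round {D : ℕ} {ω : Draws (D + 1) n} {h : Mem (D + 1) n} {c E J : ℕ} {α : ℝ}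
    (H : Ready h n E) (hn : 0 < n) (hJ : h.outLen = J) (hd : h.drawn = fun _ => J)
    (hα : 2 * (D * (24 / (E : ℝ) ^ 2)) * 2 ^ D ≤ α) :
    WP ω (roundP D) h c fun h' c' => Ready h' n E ∧ h'.I .m = h.I .m ∧ h'.I .rd = h.I .rd ∧
      h'.outLen = J + 1 ∧ h'.drawn = (fun _ => J + 1) ∧
      (∃ L : List (Pt (D + 1)), h'.out = Function.update h.out J L ∧
        L.length ≤ (D + 1) * (2 * E ^ (max D 1)) ∧ IsKernel α {p | p ∈ L} (Set.range (ω J))) ∧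
      c' ≤ c + 3000 * (D + 2) ^ 2 * (n + E ^ (2 * max D 1 - 1)) := by
  refine wp_seq (wp_newSet (wp_seq ((wp_drawAll (J := J) (by exact H.hn)
    (by exact hd)).mono ?_)))
  rintro h1 c1 ⟨i1, r1, l1, o1, d1, p1, rfl⟩
  simp only [hJ] at i1 r1 l1 o1
  have H1 : Ready h1 n E := ⟨by rw [i1 _ (by simp), H.hn], by rw [i1 _ (by simp), H.hE],
    by rw [i1 _ (by simp), H.hF], by rw [r1 _ (by simp), H.hc], H.pos, H.two⟩
  set P : ℕ → Pt (D + 1) := fun t => if ht : t < n then ω J ⟨t, ht⟩ else 0 with hP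
  have hP1 : ∀ t < n, ∀ l, h1.R (.raw l) (t : ℕ) = P t l := fun t ht l => by
    rw [hP]; simp only [ht, dif_pos]; exact p1 ⟨t, ht⟩ l
  have hPr : P '' {t | t < n} = Set.range (ω J) := by
    ext p
    constructor
    · rintro ⟨t, ht, rfl⟩
      exact ⟨⟨t, ht⟩, by rw [hP]; simp only [dif_pos (show t < n from ht)]⟩
    · rintro ⟨t, rfl⟩
      exact ⟨t, t.2, by rw [hP]; simp⟩
  refine wp_seq ((wp_norm H1.hn hn hP1).mono ?_)
  rintro h2 c2 ⟨f2, ⟨w, hw, hel⟩, hc2⟩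
  have H2 : Ready h2 n E := H1.frame f2 (by simp) (by simp) (by simp) (by simp [wrkVars])
  have hw1 : ∀ t < n, ∀ l, |w t l| ≤ 1 := by
    obtain ⟨_, _, _, h, _⟩ := hel
    exact fun t ht l => h t ht l l.2
  have J2 : h2.outLen = J + 1 := by rw [f2.outLen, l1]
  refine (wp_faces H2 J2 hw hw1).mono ?_
  rintro h3 c3 ⟨L, f3, a1, a2, a3, a4⟩
  have hpt : ∀ t < n, h2.pt t = P t := fun t ht => by
    ext l
    rw [← hP1 t ht, Mem.pt]
    simp only [f2.R (.raw l) (by simp [wrkVars])]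
  refine ⟨Ready.frame (h := h2.app J L) ⟨H2.hn, H2.hE, H2.hF, H2.hc, H2.pos, H2.two⟩ f3
      (by simp [stageVars]) (by simp [stageVars]) (by simp [stageVars]) (by simp),
    ?_, ?_, f3.outLen.trans J2, ?_, ⟨L.map P, ?_, by simpa using a1, ?_⟩, ?_⟩
  · rw [f3.I _ (by simp [stageVars])]
    exact (f2.I _ (by simp)).trans (i1 _ (by simp))
  · rw [f3.I _ (by simp [stageVars])]
    exact (f2.I _ (by simp)).trans (i1 _ (by simp))
  · exact f3.drawn.trans (f2.drawn.trans d1)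
  · rw [f3.out]
    simp only [Mem.app, f2.out, o1]
    rw [List.map_congr_left fun q hq => hpt q (a2 q hq)]
    simp
  · rw [← hPr]
    exact hel.isKernel hn a2 a3 (by positivity) hα
  · have hG : 1 ≤ E ^ (2 * max D 1 - 1) := Nat.pow_pos H.pos
    set T := n + E ^ (2 * max D 1 - 1) with hT
    have e1 : (D + 1 + 1) * ((D + 1 + 20) * (n + 1)) ≤ (D + 1 + 1) * ((D + 1 + 20) * T) :=
      Nat.mul_le_mul_left _ (Nat.mul_le_mul_left _ (by omega))
    have e2 : 3000 * (D + 2) ^ 2 * T = (D + 1 + 1) * ((D + 1 + 20) * T) +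
      (D + 1) * (2000 * (D + 1) * T) + (9958 + 7977 * D + 999 * D ^ 2) * T := by ring
    have e3 : 9958 * T ≤ (9958 + 7977 * D + 999 * D ^ 2) * T := Nat.mul_le_mul_right _ (by omega)
    omega

/-- The least `k` with `1 ≤ δ * 2 ^ k`. -/
def doublings (δ : ℝ) : ℕ := ⌈Real.logb 2 (1 / δ)⌉₊

theorem doublings_le_iff {δ : ℝ} (hδ : 0 < δ) (k : ℕ) : doublings δ ≤ k ↔ 1 ≤ δ * 2 ^ k := by
  rw [doublings, Nat.ceil_le, Real.logb_le_iff_le_rpow one_lt_two (by positivity),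
    Real.rpow_natCast, div_le_iff₀ hδ, mul_comm]

/-- The number of random supports. -/
def rounds (A : ℕ) (ε δ : ℝ) : ℕ := ⌊A * doublings δ / (ε * ε)⌋₊ + 1

/-- The number of grid lines in each coordinate. -/
def gridSize (D : ℕ) (α : ℝ) : ℕ := ⌊√((96 * D * 2 ^ D : ℕ) / α)⌋₊ + 1

theorem two_le_gridSize {D : ℕ} (hD : 0 < D) {α : ℝ} (h0 : 0 < α) (h1 : α ≤ 1) :
    2 ≤ gridSize D α := by
  have h2 : 1 ≤ 96 * D * 2 ^ D := Nat.mul_pos (by omega) (by positivity)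
  have h3 : (1 : ℝ) ≤ (96 * D * 2 ^ D : ℕ) := by exact_mod_cast h2
  have h4 : 1 ≤ √((96 * D * 2 ^ D : ℕ) / α) := by
    rw [Real.one_le_sqrt, le_div_iff₀ h0]; linarith
  have := (Nat.one_le_floor_iff _).2 h4
  unfold gridSize
  omega

/-- The `96` is `24` from the grid, times `2` for both ends of the width, times `2` because an
`(α/2)`-kernel is wanted; `2 ^ D` comes from the elimination. -/
theorem le_mul_gridSize_sq (D : ℕ) {α : ℝ} (h0 : 0 < α) :
    (96 * D * 2 ^ D : ℝ) ≤ α * (gridSize D α : ℝ) ^ 2 := by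
  have h1 : √((96 * D * 2 ^ D : ℕ) / α) ≤ gridSize D α := by
    unfold gridSize
    push_cast
    exact (Nat.lt_floor_add_one _).le
  rw [Real.sqrt_le_left (by positivity), div_le_iff₀ h0] at h1
  push_cast at h1
  linarith

/-- Initialise the machine. -/
def setupP (D A : ℕ) : Prog :=
  .seq (rset (RVar.x : RVar (D + 1)) (.const 0) (rsc (RVar.del : RVar (D + 1))))
  (.seq (.while (.neg (.realLe (.ofInt (.const 1)) (rsc (RVar.x : RVar (D + 1)))))
    (.seq (rset (RVar.x : RVar (D + 1)) (.const 0)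
      (.mul (rsc (RVar.x : RVar (D + 1))) (.ofInt (.const 2))))
      (iset .kk (.const 0) (.add (isc .kk) (.const 1)))))
  (.seq (fset .m (.const 0) (.div (.mul (.ofInt (.const A)) (.ofInt (isc .kk)))
    (.mul (rsc (RVar.eps : RVar (D + 1))) (rsc (RVar.eps : RVar (D + 1))))))
  (.seq (iset .m (.const 0) (.add (isc .m) (.const 1)))
  (.seq (fset .E (.const 0) (.sqrt (.div (.ofInt (.const (96 * D * 2 ^ D : ℕ)))
    (rsc (RVar.alp : RVar (D + 1))))))
  (.seq (iset .E (.const 0) (.add (isc .E) (.const 1)))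
  (.seq (iset .F (.const 0) (.mul (isc .E) (isc .E)))
    (rset (RVar.c : RVar (D + 1)) (.const 0) (.div (.ofInt (.const 8))
      (.mul (.ofInt (isc .E)) (.sub (.ofInt (isc .F)) (.ofInt (.const 1))))))))))))

/-- The initial state, seen through named arrays. -/
def initMem (D n : ℕ) (ε δ α : ℝ) : Mem (D + 1) n where
  I v i := if v = .n ∧ i = 0 then n else 0
  R v i := if i = 0 then (match v with | .eps => ε | .del => δ | .alp => α | _ => 0) else 0
  drawn _ := 0
  outLen := 0
  out _ := []

theorem initMem_st (D n : ℕ) (ε δ α : ℝ) :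
    (initMem D n ε δ α).st = initState (D + 1) n ε δ α := by
  unfold Mem.st initState
  congr 1
  · refine (Mem.ext_im fun v i => ?_).symm
    have := v.code_lt
    have e : 30 * i + (v.code : ℤ) = 0 ↔ v = .n ∧ i = 0 := by
      rw [← Mem.icode_inj, show IVar.n.code = 0 from rfl]
      omega
    simp [e, initMem]
  · refine (Mem.ext_rm fun v i => ?_).symm
    have h1 := v.code_lt
    have key : ∀ w : RVar (D + 1), (rwidth (D + 1) : ℤ) * i + (v.code : ℤ) = (w.code : ℕ) ↔
        v = w ∧ i = 0 := by
      intro w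
      have := Mem.addr_inj (i := i) (j := 0) h1 w.code_lt
      rw [mul_zero, zero_add] at this
      rw [this, Mem.rcode_inj, and_comm]
    have k0 : (rwidth (D + 1) : ℤ) * i + (v.code : ℤ) = 0 ↔ v = .eps ∧ i = 0 := key .eps
    have k1 : (rwidth (D + 1) : ℤ) * i + (v.code : ℤ) = 1 ↔ v = .del ∧ i = 0 := key .del
    have k2 : (rwidth (D + 1) : ℤ) * i + (v.code : ℤ) = 2 ↔ v = .alp ∧ i = 0 := key .alp
    simp only [k0, k1, k2, initMem]
    by_cases hi : i = 0
    · cases v <;> simp [hi]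
    · simp [hi]

theorem wp_setup {D A : ℕ} {ω : Draws (D + 1) n} {ε δ α : ℝ} (hδ : 0 < δ) (hα : 0 < α)
    (hα1 : α ≤ 1) :
    WP ω (setupP D A) (initMem D n ε δ α) 0 fun h c => Ready h n (gridSize D α) ∧
      h.I .m 0 = rounds A ε δ ∧ h.outLen = 0 ∧ h.drawn = (fun _ => 0) ∧
      c = 8 + 3 * doublings δ := by
  refine wp_seq (wp_rset (wp_seq ?_))
  -- The machine has no logarithm: `δ` is doubled until it reaches `1`, and the doublings are
  -- counted.
  have key : ∀ r k (h : Mem (D + 1) n) c, k + r = doublings δ → h.I .kk 0 = k →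
      h.R .x 0 = δ * 2 ^ k → Frame [.kk] [.x] (initMem D n ε δ α) h → c = 1 + 3 * k →
      WP ω (.while (.neg (.realLe (.ofInt (.const 1)) (rsc (RVar.x : RVar (D + 1)))))
        (.seq (rset (RVar.x : RVar (D + 1)) (.const 0)
        (.mul (rsc (RVar.x : RVar (D + 1))) (.ofInt (.const 2))))
        (iset .kk (.const 0) (.add (isc .kk) (.const 1))))) h c fun h c =>
        h.I .kk 0 = doublings δ ∧ Frame [.kk] [.x] (initMem D n ε δ α) h ∧
        c = 2 + 3 * doublings δ := by
    intro r
    induction r with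
    | zero =>
      rintro k h c hk h1 h2 f rfl
      obtain rfl : k = doublings δ := by omega
      refine wp_while_false ?_ ⟨h1, f, by omega⟩
      simp [h2, (doublings_le_iff hδ _).1 le_rfl]
    | succ r ih =>
      rintro k h c hk h1 h2 f rfl
      refine wp_while_true ?_ (wp_seq (wp_rset (wp_iset (ih (k + 1) _ _ (by omega) ?_ ?_
        (f.setR.setI) (by omega)))))
      · have := mt (doublings_le_iff hδ k).2 (by omega)
        simpa [h2] using this
      · simp [h1]
      · simp [h2]; ring
  refine (key (doublings δ) 0 _ _ (by omega) (by simp [initMem]) (by simp [initMem])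
    (Frame.refl _ _ _).setR (by omega)).mono ?_
  rintro h c ⟨h1, f, rfl⟩
  have re : h.R .eps 0 = ε := by rw [f.R _ (by simp)]; simp [initMem]
  have ra : h.R .alp 0 = α := by rw [f.R _ (by simp)]; simp [initMem]
  have rn : h.I .n 0 = n := by rw [f.I _ (by simp)]; simp [initMem]
  refine wp_seq (wp_fset (wp_seq (wp_iset (wp_seq (wp_fset (wp_seq (wp_iset (wp_seq (wp_iset
    (wp_rset ?_))))))))))
  have hm : ⌊(A : ℝ) * doublings δ / (ε * ε)⌋ = (⌊(A : ℝ) * doublings δ / (ε * ε)⌋₊ : ℤ) :=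
    (Int.natCast_floor_eq_floor (by have := mul_self_nonneg ε; positivity)).symm
  have hE : ⌊√((96 * D * 2 ^ D : ℕ) / α)⌋ = (⌊√((96 * D * 2 ^ D : ℕ) / α)⌋₊ : ℤ) :=
    (Int.natCast_floor_eq_floor (Real.sqrt_nonneg _)).symm
  push_cast at hE
  refine ⟨⟨?_, ?_, ?_, ?_, by unfold gridSize; omega, fun hD => two_le_gridSize hD hα hα1⟩,
    ?_, f.outLen, f.drawn, by omega⟩
  · simp [rn]
  · simp [ra, hE, gridSize]
  · simp [ra, hE, gridSize]
  · simp [ra, hE, gridSize]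
  · simp [re, h1, hm, rounds]

/-- The whole program. -/
def kernelP (D A : ℕ) : Prog := .seq (setupP D A) (forP .rd (isc .m) (roundP D))

theorem wp_kernelP {D A : ℕ} {ω : Draws (D + 1) n} {ε δ α : ℝ} (hδ : 0 < δ) (hα : 0 < α)
    (hα1 : α ≤ 1) (hn : 0 < n) :
    WP ω (kernelP D A) (initMem D n ε δ α) 0 fun h c => h.outLen = rounds A ε δ ∧
      (∀ j < rounds A ε δ, IsKernel (α / 2) {p | p ∈ h.out j} (Set.range (ω j)) ∧
        (h.out j).length ≤ (D + 1) * (2 * gridSize D α ^ (max D 1))) ∧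
      c ≤ 10 + 3 * doublings δ + rounds A ε δ *
        (3002 * (D + 2) ^ 2 * (n + gridSize D α ^ (2 * max D 1 - 1))) := by
  refine wp_seq ((wp_setup hδ hα hα1).mono ?_)
  rintro h c ⟨H, hm, hl, hd, rfl⟩
  have he : 2 * (D * (24 / (gridSize D α : ℝ) ^ 2)) * 2 ^ D ≤ α / 2 := by
    have h1 := le_mul_gridSize_sq D hα
    have h2 : (0 : ℝ) < (gridSize D α : ℝ) ^ 2 := by
      have : (0 : ℝ) < gridSize D α := by exact_mod_cast H.pos
      positivity
    have h3 : 2 * (D * (24 / (gridSize D α : ℝ) ^ 2)) * 2 ^ D =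
      (96 * D * 2 ^ D) / (gridSize D α : ℝ) ^ 2 / 2 := by ring
    rw [h3]
    have := (div_le_iff₀ h2).2 h1
    linarith
  set G := n + gridSize D α ^ (2 * max D 1 - 1) with hG
  refine wp_for (rounds A ε δ) (fun J h' c' => h'.I .rd 0 = J ∧ Ready h' n (gridSize D α) ∧
    h'.I .m 0 = rounds A ε δ ∧ h'.outLen = J ∧ h'.drawn = (fun _ => J) ∧
      (∀ j < J, IsKernel (α / 2) {p | p ∈ h'.out j} (Set.range (ω j)) ∧
        (h'.out j).length ≤ (D + 1) * (2 * gridSize D α ^ (max D 1))) ∧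
      c' ≤ 9 + 3 * doublings δ + J * (3002 * (D + 2) ^ 2 * G)) ?_ ?_ ?_ ?_
  · exact ⟨by simp, ⟨by simpa using H.hn, by simpa using H.hE, by simpa using H.hF,
      by simpa using H.hc, H.pos, H.two⟩, by simpa using hm, hl, hd, by simp, by omega⟩
  · rintro J h' c' - ⟨h1, -, h2, -⟩
    exact ⟨h1, by simpa using h2⟩
  · rintro J h' c' hJ ⟨h1, h2, h3, h4, h5, h6, h7⟩
    refine (wp_round h2 hn h4 h5 he).mono ?_
    rintro h'' c'' ⟨b1, b2, b3, b4, b5, ⟨L, b6, b7, b8⟩, b9⟩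
    refine ⟨by simp [b3, h1], ⟨by simpa using b1.hn, by simpa using b1.hE, by simpa using b1.hF,
      by simpa using b1.hc, b1.pos, b1.two⟩, by simpa [b2] using h3, b4, b5, ?_, ?_⟩
    · intro j hj
      simp only [Mem.setI_out, b6]
      rcases Nat.lt_succ_iff_lt_or_eq.1 hj with hj | rfl
      · rw [Function.update_of_ne hj.ne]
        exact h6 j hj
      · rw [Function.update_self]
        exact ⟨b8, b7⟩
    · have hG1 : 1 ≤ G := by omega
      have e1 : (J + 1) * (3002 * (D + 2) ^ 2 * G) = J * (3002 * (D + 2) ^ 2 * G) +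
        3000 * (D + 2) ^ 2 * G + 2 * ((D + 2) ^ 2 * G) := by ring
      have e2 : 1 ≤ (D + 2) ^ 2 * G := Nat.mul_pos (by positivity) hG1
      rw [← hG] at b9
      omega
  · rintro h' c' ⟨-, -, -, h4, -, h6, h7⟩
    exact ⟨h4, h6, by omega⟩

/-! ### The empirical distribution function -/

/-- The number `1` if `x ≤ q`, and `0` otherwise. -/
def below01 (x q : ℝ) : ℝ := if x ≤ q then 1 else 0

/-- A random sign. -/
def sgn {ι : Type*} (τ : ℝ) (T : Finset ι) (j : ι) : ℝ := open Classical in if j ∈ T then -τ else τ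

open Classical in
/-- Maximal inequality for the partial sums of random signs. -/
theorem sum_powerset_exists_le {ι : Type*} (x : ι → ℝ) {τ : ℝ} (hτ : τ = 1 ∨ τ = -1) {l : ℝ}
    (hl : 0 ≤ l) (J : Finset ι) (s : ℝ) :
    ∑ T ∈ J.powerset, (if ∃ q, s ≤ ∑ j ∈ J, sgn τ T j * below01 (x j) q then (1 : ℝ) else 0) ≤
      Real.exp (-(l * s)) * (2 * Real.cosh l) ^ J.card := by
  -- At levels `s ≤ 0` the right side is at least the number of subsets. The induction may therefore
  -- lower the level freely.
  have triv : ∀ (J : Finset ι) (s : ℝ), s ≤ 0 →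
      ∑ T ∈ J.powerset, (if ∃ q, s ≤ ∑ j ∈ J, sgn τ T j * below01 (x j) q then (1 : ℝ) else 0) ≤
      Real.exp (-(l * s)) * (2 * Real.cosh l) ^ J.card := by
    intro J s hs
    calc _ ≤ ∑ T ∈ J.powerset, (1 : ℝ) := Finset.sum_le_sum fun T _ => by split_ifs <;> norm_num
      _ = 1 * 2 ^ J.card := by simp
      _ ≤ _ := by
        refine mul_le_mul (Real.one_le_exp (by nlinarith)) ?_ (by positivity) (Real.exp_nonneg _)
        have := Real.one_le_cosh l
        gcongr
        linarith
  induction J using Finset.induction_on_min_value x generalizing s with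
  | empty =>
    rcases le_or_gt s 0 with hs | hs
    · exact triv _ _ hs
    · rw [Finset.powerset_empty, Finset.sum_singleton, if_neg (by simpa using hs)]
      positivity
  | insert a J ha hmin ih =>
    rcases le_or_gt s 0 with hs | hs
    · exact triv _ _ hs
    -- The smallest value `x a` is split off. A positive level can only be reached at a threshold `q
    -- ≥ x a`, where `a` contributes its full sign `b`; the other indices then have to reach `s -
    -- b`. Both signs together produce the factor `2 * cosh l`.
    have step : ∀ T : Finset ι, ∀ b : ℝ, (∀ j ∈ J, sgn τ T j = sgn τ (T.erase a) j) →
        sgn τ T a = b →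
        (if ∃ q, s ≤ ∑ j ∈ insert a J, sgn τ T j * below01 (x j) q then (1 : ℝ) else 0) ≤
        if ∃ q, s - b ≤ ∑ j ∈ J, sgn τ (T.erase a) j * below01 (x j) q then (1 : ℝ) else 0 := by
      intro T b hT hb
      split_ifs with h1 h2 h2 <;> try norm_num
      obtain ⟨q, hq⟩ := h1
      refine h2 ⟨q, ?_⟩
      rw [Finset.sum_insert ha] at hq
      rcases le_or_gt (x a) q with hx | hx
      · rw [below01, if_pos hx, mul_one, hb] at hq
        have : ∑ j ∈ J, sgn τ T j * below01 (x j) q =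
            ∑ j ∈ J, sgn τ (T.erase a) j * below01 (x j) q :=
          Finset.sum_congr rfl fun j hj => by rw [hT j hj]
        linarith
      · exfalso
        rw [below01, if_neg (not_le.2 hx), Finset.sum_eq_zero] at hq
        · linarith
        · intro j hj
          rw [below01, if_neg (by have := hmin j hj; linarith), mul_zero]
    rw [Finset.sum_powerset_insert ha]
    have e1 : ∀ T ∈ J.powerset, (if ∃ q, s ≤ ∑ j ∈ insert a J, sgn τ T j * below01 (x j) q
        then (1 : ℝ) else 0) ≤
        if ∃ q, s - τ ≤ ∑ j ∈ J, sgn τ T j * below01 (x j) q then (1 : ℝ) else 0 := by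
      intro T hT
      have haT : a ∉ T := fun h => ha (Finset.mem_powerset.1 hT h)
      have := step T τ (fun j _ => by rw [Finset.erase_eq_of_notMem haT]) (by simp [sgn, haT])
      rwa [Finset.erase_eq_of_notMem haT] at this
    have e2 : ∀ T ∈ J.powerset, (if ∃ q, s ≤ ∑ j ∈ insert a J, sgn τ (insert a T) j * below01 (x j) q
        then (1 : ℝ) else 0) ≤
        if ∃ q, s - -τ ≤ ∑ j ∈ J, sgn τ T j * below01 (x j) q then (1 : ℝ) else 0 := by
      intro T hT
      have haT : a ∉ T := fun h => ha (Finset.mem_powerset.1 hT h)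
      have := step (insert a T) (-τ) (fun j hj => by
        rw [Finset.erase_insert haT]
        have hja : j ≠ a := fun h => ha (h ▸ hj)
        simp [sgn, hja]) (by simp [sgn])
      rwa [Finset.erase_insert haT] at this
    refine (add_le_add ((Finset.sum_le_sum e1).trans (ih _))
      ((Finset.sum_le_sum e2).trans (ih _))).trans (le_of_eq ?_)
    rw [Finset.card_insert_of_notMem ha, pow_succ, ← add_mul]
    have : Real.exp (-(l * (s - τ))) + Real.exp (-(l * (s - -τ))) =
        Real.exp (-(l * s)) * (2 * Real.cosh l) := by
      rw [Real.cosh_eq]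
      rcases hτ with rfl | rfl
      · rw [show -(l * (s - 1)) = -(l * s) + l by ring,
          show -(l * (s - -1)) = -(l * s) + -l by ring, Real.exp_add, Real.exp_add]
        ring
      · rw [show -(l * (s - -1)) = -(l * s) + -l by ring,
          show -(l * (s - - -1)) = -(l * s) + l by ring, Real.exp_add, Real.exp_add]
        ring
    rw [this]; ring

open Classical in
-- The choice `l = e` together with `cosh e ≤ exp (e² / 2)`.
theorem sum_powerset_exists_le_exp {ι : Type*} [Fintype ι] (x : ι → ℝ) {τ : ℝ}
    (hτ : τ = 1 ∨ τ = -1) {e : ℝ} (he : 0 ≤ e) :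
    ∑ T : Finset ι, (if ∃ q, e * Fintype.card ι ≤ ∑ j, sgn τ T j * below01 (x j) q
      then (1 : ℝ) else 0) ≤
      2 ^ Fintype.card ι * Real.exp (-(Fintype.card ι * e ^ 2 / 2)) := by
  have h := sum_powerset_exists_le x hτ he Finset.univ (e * Fintype.card ι)
  rw [Finset.powerset_univ, Finset.card_univ] at h
  refine h.trans ?_
  have h2 : (2 * Real.cosh e) ^ Fintype.card ι ≤ (2 * Real.exp (e ^ 2 / 2)) ^ Fintype.card ι := by
    have := Real.cosh_le_exp_half_sq e
    have := Real.cosh_pos e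
    gcongr
  refine (mul_le_mul_of_nonneg_left h2 (Real.exp_nonneg _)).trans (le_of_eq ?_)
  rw [mul_pow, mul_left_comm, ← Real.exp_nat_mul, ← Real.exp_add]
  congr 2
  ring

/-- Right continuity in the threshold. It reduces events over all real thresholds to countable
unions and so makes them measurable. -/
theorem exists_rat_below01 {κ : Type*} [Finite κ] (v : κ → ℝ) (q : ℝ) :
    ∃ r : ℚ, ∀ i, below01 (v i) r = below01 (v i) q := by
  have h : ∀ i, ∀ᶠ y in nhdsWithin q (Set.Ioi q), below01 (v i) y = below01 (v i) q := by
    intro i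
    rcases le_or_gt (v i) q with hi | hi
    · filter_upwards [self_mem_nhdsWithin] with y hy
      rw [below01, below01, if_pos hi, if_pos (hi.trans (le_of_lt hy))]
    · filter_upwards [Ioo_mem_nhdsGT hi] with y hy
      rw [below01, below01, if_neg (not_le.2 hi), if_neg (not_le.2 hy.2)]
  obtain ⟨b, hb, hb'⟩ := mem_nhdsGT_iff_exists_Ioo_subset.1 (Filter.eventually_all.2 h)
  obtain ⟨r, hr⟩ := exists_rat_btwn (show q < b from hb)
  exact ⟨r, hb' hr⟩

theorem measurable_below01 {S : Type*} [MeasurableSpace S] {f : S → ℝ} (hf : Measurable f) (q : ℝ) :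
    Measurable fun s => below01 (f s) q :=
  Measurable.ite (hf measurableSet_Iic) measurable_const measurable_const

/-! ### Symmetrisation by exchanging two samples -/

section Symmetrization

variable {S ι : Type*} [Fintype ι] {f : S → ℝ}

/-- The pairs of samples whose empirical distribution functions differ by at least `s / |ι|`. -/
def farPairs (ι : Type*) [Fintype ι] (f : S → ℝ) (s : ℝ) : Set (ι → S × S) :=
  {z | ∃ q : ℝ, s ≤ |∑ j, (below01 (f (z j).1) q - below01 (f (z j).2) q)|}

open Classical in
/-- Exchange the two samples on the indices in `T`. -/
def flipOn (T : Finset ι) (z : ι → S × S) : ι → S × S :=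
  fun j => (if j ∈ T then Prod.swap else id) (z j)

/-- Exchanging the samples at `j` flips the sign of the `j`-th term. The resulting signed sum is a
difference of two, one per sample, and one of these is at least `e` in absolute value; the two
values of `τ` stand for its two signs. -/
theorem flipOn_mem_farPairs {z : ι → S × S} {T : Finset ι} {e : ℝ}
    (h : flipOn T z ∈ farPairs ι f (2 * e)) :
    ((∃ q, e ≤ ∑ j, sgn 1 T j * below01 (f (z j).1) q) ∨
      (∃ q, e ≤ ∑ j, sgn (-1) T j * below01 (f (z j).1) q)) ∨
    ((∃ q, e ≤ ∑ j, sgn 1 T j * below01 (f (z j).2) q) ∨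
      (∃ q, e ≤ ∑ j, sgn (-1) T j * below01 (f (z j).2) q)) := by
  classical
  obtain ⟨q, hq⟩ := h
  have e1 : ∑ j, (below01 (f (flipOn T z j).1) q - below01 (f (flipOn T z j).2) q) =
      ∑ j, sgn 1 T j * below01 (f (z j).1) q - ∑ j, sgn 1 T j * below01 (f (z j).2) q := by
    rw [← Finset.sum_sub_distrib]
    refine Finset.sum_congr rfl fun j _ => ?_
    by_cases hj : j ∈ T <;> simp [flipOn, sgn, hj, neg_add_eq_sub]
  have e2 : ∀ g : ι → ℝ, ∑ j, sgn (-1) T j * g j = - ∑ j, sgn 1 T j * g j := by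
    intro g
    rw [← Finset.sum_neg_distrib]
    refine Finset.sum_congr rfl fun j _ => ?_
    by_cases hj : j ∈ T <;> simp [sgn, hj]
  rw [e1] at hq
  by_contra hc
  simp only [not_or, not_exists, not_le] at hc
  obtain ⟨⟨h1, h2⟩, h3, h4⟩ := hc
  have h1 := h1 q
  have h2 := h2 q
  have h3 := h3 q
  have h4 := h4 q
  rw [e2] at h2 h4
  have := abs_lt.2 (⟨by linarith, by linarith⟩ :
    -(2 * e) < ∑ j, sgn 1 T j * below01 (f (z j).1) q - ∑ j, sgn 1 T j * below01 (f (z j).2) q ∧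
    ∑ j, sgn 1 T j * below01 (f (z j).1) q - ∑ j, sgn 1 T j * below01 (f (z j).2) q < 2 * e)
  linarith

variable [MeasurableSpace S]

theorem measurableSet_farPairs (hf : Measurable f) (s : ℝ) :
    MeasurableSet (farPairs ι f s) := by
  have : farPairs ι f s = ⋃ r : ℚ,
      {z | s ≤ |∑ j, (below01 (f (z j).1) r - below01 (f (z j).2) r)|} := by
    ext z
    simp only [farPairs, Set.mem_iUnion, Set.mem_ofPred_eq]
    constructor
    · rintro ⟨q, hq⟩
      obtain ⟨r, hr⟩ := exists_rat_below01
        (Sum.elim (fun j => f (z j).1) fun j => f (z j).2 : ι ⊕ ι → ℝ) q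
      refine ⟨r, ?_⟩
      have h1 := fun j => hr (Sum.inl j)
      have h2 := fun j => hr (Sum.inr j)
      simp only [Sum.elim_inl, Sum.elim_inr] at h1 h2
      simpa only [h1, h2] using hq
    · rintro ⟨r, hr⟩
      exact ⟨r, hr⟩
  rw [this]
  refine MeasurableSet.iUnion fun r => measurableSet_le measurable_const ?_
  have h1 := measurable_below01 hf r
  have : Measurable fun z : ι → S × S =>
      ∑ j, (below01 (f (z j).1) r - below01 (f (z j).2) r) :=
    Finset.measurable_sum _ fun j _ =>
      (h1.comp (measurable_fst.comp (measurable_pi_apply j))).sub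
        (h1.comp (measurable_snd.comp (measurable_pi_apply j)))
  exact this.abs

theorem measurePreserving_flipOn (ν : Measure S) [IsProbabilityMeasure ν] (T : Finset ι) :
    MeasurePreserving (flipOn T) (Measure.pi fun _ : ι => ν.prod ν)
      (Measure.pi fun _ : ι => ν.prod ν) := by
  classical
  refine measurePreserving_pi _ _ fun j => ?_
  split_ifs
  · exact Measure.measurePreserving_swap
  · exact MeasurePreserving.id _

/-- The law of the pairs is invariant under all `2 ^ m` exchanges, so the measure may be averaged
over them. For fixed samples the average is then the purely combinatorial count above; the `4` is
two samples times two signs. -/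
theorem measure_farPairs_le (ν : Measure S) [IsProbabilityMeasure ν] (hf : Measurable f) {e : ℝ}
    (he : 0 ≤ e) :
    (Measure.pi fun _ : ι => ν.prod ν) (farPairs ι f (2 * (e * Fintype.card ι))) ≤
      ENNReal.ofReal (4 * Real.exp (-(Fintype.card ι * e ^ 2 / 2))) := by
  classical
  set m := Fintype.card ι with hm
  set ρ := Measure.pi fun _ : ι => ν.prod ν with hρ
  set B := farPairs ι f (2 * (e * m)) with hB
  have hBm : MeasurableSet B := measurableSet_farPairs hf _
  have h1 : ∀ T : Finset ι, ρ B = ∫⁻ z, (flipOn T ⁻¹' B).indicator 1 z ∂ρ := fun T => by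
    rw [lintegral_indicator_one ((measurePreserving_flipOn ν T).measurable hBm),
      (measurePreserving_flipOn ν T).measure_preimage hBm.nullMeasurableSet]
  have h2 : ∀ z : ι → S × S, ∑ T : Finset ι, (flipOn T ⁻¹' B).indicator (1 : (ι → S × S) → ENNReal) z ≤
      ENNReal.ofReal (2 ^ m * (4 * Real.exp (-(m * e ^ 2 / 2)))) := by
    intro z
    let P (τ : ℝ) (g : ι → ℝ) (T : Finset ι) : ℝ :=
      if ∃ q, e * m ≤ ∑ j, sgn τ T j * below01 (g j) q then 1 else 0
    have hP0 : ∀ τ g T, 0 ≤ P τ g T := fun τ g T => by simp only [P]; split_ifs <;> norm_num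
    have key : ∀ T, (flipOn T ⁻¹' B).indicator (1 : (ι → S × S) → ENNReal) z ≤ ENNReal.ofReal
        ((P 1 (fun j => f (z j).1) T + P (-1) (fun j => f (z j).1) T) +
          (P 1 (fun j => f (z j).2) T + P (-1) (fun j => f (z j).2) T)) := by
      intro T
      by_cases hz : z ∈ flipOn T ⁻¹' B
      · rw [Set.indicator_of_mem hz, Pi.one_apply, ← ENNReal.ofReal_one]
        refine ENNReal.ofReal_le_ofReal ?_
        have p1 := hP0 1 (fun j => f (z j).1) T
        have p2 := hP0 (-1) (fun j => f (z j).1) T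
        have p3 := hP0 1 (fun j => f (z j).2) T
        have p4 := hP0 (-1) (fun j => f (z j).2) T
        rcases flipOn_mem_farPairs hz with (h | h) | (h | h)
        · have : P 1 (fun j => f (z j).1) T = 1 := if_pos h
          linarith
        · have : P (-1) (fun j => f (z j).1) T = 1 := if_pos h
          linarith
        · have : P 1 (fun j => f (z j).2) T = 1 := if_pos h
          linarith
        · have : P (-1) (fun j => f (z j).2) T = 1 := if_pos h
          linarith
      · rw [Set.indicator_of_notMem hz]
        exact zero_le
    refine (Finset.sum_le_sum fun T _ => key T).trans ?_
    rw [← ENNReal.ofReal_sum_of_nonneg fun T _ => add_nonneg (add_nonneg (hP0 _ _ _) (hP0 _ _ _))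
      (add_nonneg (hP0 _ _ _) (hP0 _ _ _))]
    refine ENNReal.ofReal_le_ofReal ?_
    rw [Finset.sum_add_distrib, Finset.sum_add_distrib, Finset.sum_add_distrib]
    have q1 := sum_powerset_exists_le_exp (fun j => f (z j).1) (Or.inl rfl) he
    have q2 := sum_powerset_exists_le_exp (fun j => f (z j).1) (Or.inr rfl) he
    have q3 := sum_powerset_exists_le_exp (fun j => f (z j).2) (Or.inl rfl) he
    have q4 := sum_powerset_exists_le_exp (fun j => f (z j).2) (Or.inr rfl) he
    rw [← hm] at q1 q2 q3 q4
    simp only [P]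
    linarith
  have h3 : (2 ^ m : ENNReal) * ρ B ≤
      ENNReal.ofReal (2 ^ m * (4 * Real.exp (-(m * e ^ 2 / 2)))) := by
    calc (2 ^ m : ENNReal) * ρ B = ∑ T : Finset ι, ρ B := by
          rw [Finset.sum_const, Finset.card_univ, Fintype.card_finset, nsmul_eq_mul]
          push_cast; rfl
      _ = ∑ T : Finset ι, ∫⁻ z, (flipOn T ⁻¹' B).indicator 1 z ∂ρ :=
          Finset.sum_congr rfl fun T _ => h1 T
      _ = ∫⁻ z, ∑ T : Finset ι, (flipOn T ⁻¹' B).indicator 1 z ∂ρ := by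
          rw [lintegral_finsetSum]
          exact fun T _ => measurable_one.indicator ((measurePreserving_flipOn ν T).measurable hBm)
      _ ≤ ∫⁻ _, ENNReal.ofReal (2 ^ m * (4 * Real.exp (-(m * e ^ 2 / 2)))) ∂ρ :=
          lintegral_mono h2
      _ = _ := by rw [lintegral_const, measure_univ, mul_one]
  rw [ENNReal.ofReal_mul (by positivity), ENNReal.ofReal_pow (by norm_num), ENNReal.ofReal_ofNat]
    at h3
  exact (ENNReal.mul_le_mul_iff_right (by simp) (by simp)).1 h3

end Symmetrization

/-! ### Uniform deviation of the empirical distribution function -/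

section EmpiricalCDF

variable {S ι : Type*} [MeasurableSpace S] [Fintype ι] {f : S → ℝ}

theorem integral_below01 (ν : Measure S) (hf : Measurable f) (q : ℝ) :
    ∫ s, below01 (f s) q ∂ν = ν.real {s | f s ≤ q} := by
  have h : MeasurableSet {s | f s ≤ q} := hf measurableSet_Iic
  rw [← integral_indicator_one h]
  refine integral_congr_ae (Filter.Eventually.of_forall fun s => ?_)
  by_cases hs : f s ≤ q <;> simp [below01, hs]

theorem below01_mem (x q : ℝ) : below01 x q ∈ Set.Icc (0 : ℝ) 1 := by
  unfold below01; split_ifs <;> simp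

theorem memLp_below01 (ν : Measure S) [IsProbabilityMeasure ν] (hf : Measurable f) (q : ℝ)
    (p : ENNReal) : MemLp (fun s => below01 (f s) q) p ν := by
  refine MemLp.of_bound (measurable_below01 hf q).aestronglyMeasurable 1
    (Filter.Eventually.of_forall fun s => ?_)
  have := below01_mem (f s) q
  rw [Real.norm_eq_abs, abs_of_nonneg this.1]
  exact this.2

/-- Chebyshev's inequality for the empirical distribution function at one point. -/
theorem measure_empirical_far_le (ν : Measure S) [IsProbabilityMeasure ν] (hf : Measurable f)
    {e : ℝ} (he : 0 < e) (hm : 2 ≤ Fintype.card ι * (2 * e) ^ 2) (q : ℝ) :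
    (Measure.pi fun _ : ι => ν) {y | e * Fintype.card ι ≤
      |∑ j, below01 (f (y j)) q - Fintype.card ι * ν.real {s | f s ≤ q}|} ≤ 1 / 2 := by
  set m := Fintype.card ι with hm'
  have hm0 : (0 : ℝ) < m := by
    by_contra h
    have : (m : ℝ) = 0 := le_antisymm (not_lt.1 h) (Nat.cast_nonneg _)
    rw [this] at hm
    linarith
  set X : (ι → S) → ℝ := ∑ j : ι, fun y : ι → S => below01 (f (y j)) q with hX
  have hXe : ∀ y, X y = ∑ j, below01 (f (y j)) q := fun y => by rw [hX, Finset.sum_apply]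
  have hmem : ∀ j : ι, MemLp (fun y : ι → S => below01 (f (y j)) q) 2 (Measure.pi fun _ : ι => ν) :=
    fun j => memLp_below01 (f := fun y : ι → S => f (y j)) _ (hf.comp (measurable_pi_apply j)) q 2
  have hX2 : MemLp X 2 (Measure.pi fun _ : ι => ν) := memLp_finsetSum' _ fun j _ => hmem j
  have hmean : ∫ y, X y ∂(Measure.pi fun _ : ι => ν) = m * ν.real {s | f s ≤ q} := by
    simp only [hXe]
    rw [integral_finsetSum _ fun j _ => (hmem j).integrable (by norm_num)]
    have : ∀ j : ι, ∫ y, below01 (f (y j)) q ∂(Measure.pi fun _ : ι => ν) =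
        ν.real {s | f s ≤ q} := fun j => by
      rw [integral_comp_eval (μ := fun _ : ι => ν) (i := j) (f := fun s => below01 (f s) q)
        (measurable_below01 hf q).aestronglyMeasurable, integral_below01 ν hf]
    simp [this, hm']
  have hvar : ProbabilityTheory.variance X (Measure.pi fun _ : ι => ν) ≤ m / 4 := by
    rw [hX, ProbabilityTheory.variance_sum_pi (μ := fun _ : ι => ν)
      (X := fun _ s => below01 (f s) q) fun _ => memLp_below01 ν hf q 2]
    calc _ ≤ ∑ _ : ι, ((1 - 0) / 2 : ℝ) ^ 2 := Finset.sum_le_sum fun j _ =>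
          ProbabilityTheory.variance_le_sq_of_bounded
            (Filter.Eventually.of_forall fun s => below01_mem _ _)
            (measurable_below01 hf q).aemeasurable
      _ = m / 4 := by simp [hm']; ring
  have h := ProbabilityTheory.meas_ge_le_variance_div_sq hX2 (mul_pos he hm0)
  rw [hmean] at h
  simp only [hXe] at h
  refine h.trans ?_
  rw [show (1 / 2 : ENNReal) = ENNReal.ofReal (1 / 2) by
    rw [ENNReal.ofReal_div_of_pos two_pos]; simp]
  refine ENNReal.ofReal_le_ofReal ?_
  rw [div_le_iff₀ (by positivity)]
  nlinarith

/-- A bound of Dvoretzky–Kiefer–Wolfowitz type. -/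
theorem measure_exists_empirical_far_le (ν : Measure S) [IsProbabilityMeasure ν]
    (hf : Measurable f) {e : ℝ} (he : 0 < e) (hm : 2 ≤ Fintype.card ι * e ^ 2) :
    (Measure.pi fun _ : ι => ν) {x | ∃ q, e * Fintype.card ι <
      |∑ j, below01 (f (x j)) q - Fintype.card ι * ν.real {s | f s ≤ q}|} ≤
      ENNReal.ofReal (8 * Real.exp (-(Fintype.card ι * e ^ 2 / 32))) := by
  set m := Fintype.card ι with hm'
  set P := Measure.pi fun _ : ι => ν with hP
  set E := MeasurableEquiv.arrowProdEquivProdArrow S S ι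
  have hE : MeasurePreserving E (Measure.pi fun _ : ι => ν.prod ν) (P.prod P) :=
    measurePreserving_arrowProdEquivProdArrow S S ι (fun _ => ν) fun _ => ν
  set B := farPairs ι f (2 * (e / 4 * m)) with hB
  have hBm : MeasurableSet B := measurableSet_farPairs hf _
  have hB' : (P.prod P) (E.symm ⁻¹' B) ≤ ENNReal.ofReal (4 * Real.exp (-(m * e ^ 2 / 32))) := by
    rw [(hE.symm E).measure_preimage hBm.nullMeasurableSet]
    refine (measure_farPairs_le ν hf (by positivity)).trans (le_of_eq ?_)
    congr 3
    rw [← hm']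
    ring
  have hB'm : MeasurableSet (E.symm ⁻¹' B) := E.symm.measurable hBm
  -- Ghost sample: if `x` is far at the threshold `q`, an independent sample is within `e / 2` at
  -- the same `q` with probability at least `1/2`, and then the two empirical functions differ by at
  -- least `e / 2`.
  have h1 : {x | ∃ q, e * m < |∑ j, below01 (f (x j)) q - m * ν.real {s | f s ≤ q}|} ⊆
      {x | 1 / 2 ≤ P (Prod.mk x ⁻¹' (E.symm ⁻¹' B))} := by
    rintro x ⟨q, hq⟩
    have hc := measure_empirical_far_le (ι := ι) ν hf (half_pos he) (by
      rw [mul_div_cancel₀ _ two_ne_zero]; exact hm) q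
    rw [← hm', ← hP] at hc
    set A := {y : ι → S | e / 2 * m ≤ |∑ j, below01 (f (y j)) q - m * ν.real {s | f s ≤ q}|}
    have hA : Aᶜ ⊆ Prod.mk x ⁻¹' (E.symm ⁻¹' B) := by
      intro y hy
      have hy : |∑ j, below01 (f (y j)) q - m * ν.real {s | f s ≤ q}| < e / 2 * m := not_le.1 hy
      refine ⟨q, ?_⟩
      change 2 * (e / 4 * m) ≤ |∑ j, (below01 (f (x j)) q - below01 (f (y j)) q)|
      rw [Finset.sum_sub_distrib]
      have := abs_sub_abs_le_abs_sub (∑ j, below01 (f (x j)) q - m * ν.real {s | f s ≤ q})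
        (∑ j, below01 (f (y j)) q - m * ν.real {s | f s ≤ q})
      rw [sub_sub_sub_cancel_right] at this
      linarith
    have hAm : MeasurableSet A := by
      refine measurableSet_le measurable_const ?_
      have : Measurable fun y : ι → S => ∑ j, below01 (f (y j)) q - m * ν.real {s | f s ≤ q} :=
        (Finset.measurable_sum _ fun j _ =>
          (measurable_below01 hf q).comp (measurable_pi_apply j)).sub_const _
      exact this.abs
    change 1 / 2 ≤ P _
    refine le_trans ?_ (measure_mono hA)
    rw [prob_compl_eq_one_sub hAm]
    calc (1 / 2 : ENNReal) = 1 - 1 / 2 := by simp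
      _ ≤ _ := tsub_le_tsub_left hc 1
  refine (measure_mono h1).trans ?_
  -- Markov's inequality for the measure of the sections; the level `1/2` turns the factor `4` into
  -- `8`.
  have h2 := mul_meas_ge_le_lintegral₀ (μ := P)
    (measurable_measure_prodMk_left (ν := P) hB'm).aemeasurable (1 / 2)
  rw [← Measure.prod_apply hB'm] at h2
  have h3 := mul_le_mul_of_nonneg_left (h2.trans hB') (zero_le : (0 : ENNReal) ≤ 2)
  rw [← mul_assoc, ENNReal.mul_div_cancel (by simp) (by simp), one_mul] at h3
  refine h3.trans (le_of_eq ?_)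
  rw [show (2 : ENNReal) = ENNReal.ofReal 2 by simp, ← ENNReal.ofReal_mul (by norm_num)]
  congr 1
  ring

/-- The same for the first terms of an infinite independent sequence. -/
theorem infinitePi_exists_empirical_far_le (ν : Measure S) [IsProbabilityMeasure ν]
    (hf : Measurable f) {e : ℝ} (he : 0 < e) {m : ℕ} (hm : 2 ≤ m * e ^ 2) :
    (Measure.infinitePi fun _ : ℕ => ν) {x | ∃ q, e * m <
      |∑ j ∈ Finset.range m, below01 (f (x j)) q - m * ν.real {s | f s ≤ q}|} ≤
      ENNReal.ofReal (8 * Real.exp (-(m * e ^ 2 / 32))) := by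
  have h1 := measure_exists_empirical_far_le (ι := Fin m) ν hf he (by simpa using hm)
  have h2 : (Measure.infinitePi fun _ : ℕ => ν).map (fun x (j : Fin m) => x j) =
      Measure.pi fun _ : Fin m => ν := by
    rw [Measure.map_infinitePi_infinitePi_of_inj Fin.val_injective, Measure.infinitePi_eq_pi]
  rw [← h2, Fintype.card_fin] at h1
  refine le_trans (le_trans ?_ (Measure.le_map_apply
    (measurable_pi_lambda _ fun j => measurable_pi_apply _).aemeasurable _)) h1
  refine measure_mono ?_
  rintro x ⟨q, hq⟩
  refine ⟨q, ?_⟩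
  rwa [Finset.sum_range] at hq

end EmpiricalCDF

/-! ### The distribution of the width -/

theorem width_range [Nonempty (Fin n)] (Q : Fin n → Pt d) (u : Pt d) :
    width (Set.range Q) u = (⨆ i, inner ℝ (Q i) u) - ⨅ i, inner ℝ (Q i) u := by
  rw [width, ← Set.range_comp]
  rfl

theorem measurable_width [Nonempty (Fin n)] (u : Pt d) :
    Measurable fun Q : Fin n → Pt d => width (Set.range Q) u := by
  simp only [width_range]
  have h : ∀ i, Measurable fun Q : Fin n → Pt d => inner ℝ (Q i) u := fun i =>
    (measurable_pi_apply i).inner_const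
  exact (Measurable.iSup h).sub (Measurable.iInf h)

theorem volume_hyperplane {u : Pt d} (hu : ‖u‖ = 1) (c : ℝ) :
    volume {p : Pt d | inner ℝ p u = c} = 0 := by
  let s : AffineSubspace ℝ (Pt d) :=
    { carrier := {p | inner ℝ p u = c}
      smul_vsub_vadd_mem' := fun t p q r hp hq hr => by
        simp only [Set.mem_ofPred_eq, vsub_eq_sub, vadd_eq_add, inner_add_left, inner_smul_left,
          inner_sub_left] at hp hq hr ⊢
        rw [hp, hq, hr]
        simp }
  refine Measure.addHaar_affineSubspace volume s fun h => ?_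
  have h1 : ∀ p : Pt d, inner ℝ p u = c := fun p => by
    have : p ∈ s := h ▸ AffineSubspace.mem_top ℝ (Pt d) p
    exact this
  have h2 := h1 u
  rw [← h1 0, inner_zero_left, real_inner_self_eq_norm_sq, hu] at h2
  norm_num at h2

section Law

variable (μ : Fin n → Measure (Pt d)) [∀ i, IsProbabilityMeasure (μ i)]

/-- By Fubini: with `Q i` fixed, `Q j` has to lie in a hyperplane, a null set for `μ j`. -/
theorem supportLaw_diff_eq_zero (hμ : ∀ i, μ i ≪ volume) {u : Pt d} (hu : ‖u‖ = 1) {i j : Fin n}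
    (hij : i ≠ j) (v : ℝ) :
    supportLaw μ {Q | inner ℝ (Q i) u - inner ℝ (Q j) u = v} = 0 := by
  have h1 : (supportLaw μ).map (fun Q => (Q i, Q j)) = (μ i).prod (μ j) := by
    rw [supportLaw, ← Measure.infinitePi_eq_pi]
    exact Measure.infinitePi_map_eval_prod hij
  have hB : MeasurableSet {p : Pt d × Pt d | inner ℝ p.1 u - inner ℝ p.2 u = v} :=
    measurableSet_eq_fun (measurable_fst.inner_const.sub measurable_snd.inner_const)
      measurable_const
  have h2 : (μ i).prod (μ j) {p | inner ℝ p.1 u - inner ℝ p.2 u = v} = 0 := by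
    rw [Measure.measure_prod_null hB]
    refine Filter.Eventually.of_forall fun p => ?_
    refine measure_mono_null (fun q hq => ?_) (hμ j (volume_hyperplane hu (inner ℝ p u - v)))
    have : inner ℝ p u - inner ℝ q u = v := hq
    change inner ℝ q u = inner ℝ p u - v
    linarith
  rw [← h1, Measure.map_apply ((measurable_pi_apply i).prodMk (measurable_pi_apply j)) hB] at h2
  exact h2

/-- A positive width is a difference of projections of two points with different indices. The value
`0` must be excluded, since for `n = 1` the width is always `0`. -/
theorem supportLaw_width_eq_zero [Nonempty (Fin n)] (hμ : ∀ i, μ i ≪ volume) {u : Pt d}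
    (hu : ‖u‖ = 1) {v : ℝ} (hv : 0 < v) : supportLaw μ {Q | width (Set.range Q) u = v} = 0 := by
  have h : {Q : Fin n → Pt d | width (Set.range Q) u = v} ⊆
      ⋃ (i : Fin n) (j : Fin n) (_ : i ≠ j), {Q | inner ℝ (Q i) u - inner ℝ (Q j) u = v} := by
    intro Q hQ
    have hQ : width (Set.range Q) u = v := hQ
    obtain ⟨-, ⟨i, rfl⟩, -, ⟨j, rfl⟩, hw⟩ :=
      exists_width_eq (Set.finite_range Q) (Set.range_nonempty Q) u
    simp only [Set.mem_iUnion]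
    refine ⟨i, j, ?_, hw.symm.trans hQ⟩
    rintro rfl
    rw [hQ, sub_self] at hw
    exact hv.ne' hw
  refine measure_mono_null h ?_
  simp only [measure_iUnion_null_iff]
  exact fun i j hij => supportLaw_diff_eq_zero μ hμ hu hij v

theorem widthCDF_eq_cdf [Nonempty (Fin n)] (u : Pt d) :
    widthCDF μ u = ProbabilityTheory.cdf
      ((supportLaw μ).map fun Q => width (Set.range Q) u) := by
  have : IsProbabilityMeasure (supportLaw μ) := by unfold supportLaw; infer_instance
  have := Measure.isProbabilityMeasure_map (μ := supportLaw μ) (measurable_width u).aemeasurable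
  funext v
  rw [ProbabilityTheory.cdf_eq_real, map_measureReal_apply (measurable_width u) measurableSet_Iic]
  rfl

theorem continuousAt_widthCDF [Nonempty (Fin n)] (hμ : ∀ i, μ i ≪ volume) {u : Pt d}
    (hu : ‖u‖ = 1) {v : ℝ} (hv : 0 < v) : ContinuousAt (widthCDF μ u) v := by
  have : IsProbabilityMeasure (supportLaw μ) := by unfold supportLaw; infer_instance
  have := Measure.isProbabilityMeasure_map (μ := supportLaw μ) (measurable_width u).aemeasurable
  rw [widthCDF_eq_cdf]
  set l := (supportLaw μ).map fun Q => width (Set.range Q) u with hl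
  have h1 : l {v} = 0 := by
    rw [hl, Measure.map_apply (measurable_width u) (measurableSet_singleton v)]
    exact supportLaw_width_eq_zero μ hμ hu hv
  rw [← ProbabilityTheory.measure_cdf l, StieltjesFunction.measure_singleton,
    ENNReal.ofReal_eq_zero] at h1
  have hm := ProbabilityTheory.monotone_cdf l
  have h2 : Function.leftLim (ProbabilityTheory.cdf l) v = ProbabilityTheory.cdf l v :=
    le_antisymm (hm.leftLim_le le_rfl) (by linarith)
  refine continuousAt_iff_continuous_left'_right'.2
    ⟨hm.continuousWithinAt_Iio_iff_leftLim_eq.2 h2, ?_⟩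
  exact ((ProbabilityTheory.cdf l).right_continuous v).mono Set.Ioi_subset_Ici_self

end Law

/-! ### From kernels to quantizations -/

/-- The value `h x` lies between `F x - ε` and `F ((1 + α) * x) + ε`. If it is not between the two
values of `F`, an endpoint serves as `x'`; otherwise `F` attains it exactly. -/
theorem isQuantization_of_empirical {ε α : ℝ} (hα : 0 ≤ α) {h F G : ℝ → ℝ}
    (hc : ∀ v, 0 < v → ContinuousAt F v) (hG : ∀ q, |G q - F q| ≤ ε)
    (hh : ∀ x, 0 ≤ x → G x ≤ h x ∧ h x ≤ G ((1 + α) * x)) : IsQuantization ε α h F := by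
  intro x hx
  obtain ⟨h1, h2⟩ := hh x hx
  have g1 := (abs_le.1 (hG x)).1
  have g2 := (abs_le.1 (hG ((1 + α) * x))).2
  have hαx : 0 ≤ α * x := mul_nonneg hα hx
  have hxx : x ≤ (1 + α) * x := by linarith
  rcases le_or_gt (h x) (F x) with h3 | h3
  · refine ⟨x, hx, by simpa using hαx, ?_⟩
    rw [abs_le]
    constructor <;> linarith [(abs_nonneg _).trans (hG x)]
  rcases le_or_gt (F ((1 + α) * x)) (h x) with h4 | h4
  · refine ⟨(1 + α) * x, hx.trans hxx, ?_, ?_⟩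
    · rw [abs_sub_comm, abs_of_nonneg] <;> linarith
    · rw [abs_le]; constructor <;> linarith [(abs_nonneg _).trans (hG x)]
  -- At `x = 0` both endpoints coincide and the third case is void, so no continuity at `0` is
  -- needed.
  rcases hx.eq_or_lt with rfl | hx0
  · rw [mul_zero] at h4
    exact absurd h3 (not_lt.2 h4.le)
  obtain ⟨y, hy, hy'⟩ := intermediate_value_Icc hxx (f := F)
    (fun v hv => (hc v (hx0.trans_le hv.1)).continuousWithinAt) ⟨h3.le, h4.le⟩
  refine ⟨y, hx.trans hy.1, ?_, ?_⟩
  · rw [abs_sub_comm, abs_of_nonneg] <;> linarith [hy.1, hy.2]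
  · rw [hy', sub_self, abs_zero]
    exact (abs_nonneg _).trans (hG x)

theorem widthFraction_eq (m : ℕ) (K : ℕ → Set (Pt d)) (u : Pt d) (x : ℝ) :
    widthFraction m K u x = (∑ j ∈ Finset.range m, below01 (width (K j) u) x) / m := by
  classical
  rw [widthFraction]
  congr 1
  simp only [below01]
  rw [Finset.sum_boole, ← Set.ncard_coe_finset]
  congr 2
  ext j
  simp

theorem IsKernel.width_le {α : ℝ} {K S : Set (Pt d)} (h : IsKernel α K S) (hS : S.Finite)
    (u : Pt d) : width K u ≤ width S u := by
  obtain ⟨p, hp, q, hq, hw⟩ := exists_width_eq (hS.subset h.1) h.2.1 u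
  rw [hw]
  exact inner_sub_le_width hS (h.1 hp) (h.1 hq) u

theorem below01_anti {x y : ℝ} (h : x ≤ y) (q : ℝ) : below01 y q ≤ below01 x q := by
  unfold below01
  split_ifs <;> linarith

/-- Off the exceptional event of the uniform bound, the empirical function of the support widths
plays the role of `G`. The upper comparison is where `α ≤ 1` enters: `(1 - α/2) * (1 + α) ≥ 1`. -/
theorem isProbKernel_of_isKernel [Nonempty (Fin n)] (μ : Fin n → Measure (Pt d))
    [∀ i, IsProbabilityMeasure (μ i)] (hμ : ∀ i, μ i ≪ volume) {ε δ α : ℝ} (hε : 0 < ε)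
    (hα : 0 ≤ α) (hα1 : α ≤ 1) {m : ℕ} (hm : 2 ≤ m * ε ^ 2)
    (hδ : 8 * Real.exp (-(m * ε ^ 2 / 32)) ≤ δ) {K : Draws d n → ℕ → Set (Pt d)}
    (hK : ∀ ω, ∀ j < m, IsKernel (α / 2) (K ω j) (Set.range (ω j))) :
    IsProbKernel μ ε δ α m K := by
  intro u hu
  have hm0 : (0 : ℝ) < m := by
    by_contra h
    have : (m : ℝ) = 0 := le_antisymm (not_lt.1 h) (Nat.cast_nonneg _)
    rw [this] at hm
    linarith
  have : IsProbabilityMeasure (supportLaw μ) := by unfold supportLaw; infer_instance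
  have h := infinitePi_exists_empirical_far_le (supportLaw μ) (measurable_width u) hε hm
  refine (measure_mono ?_).trans (h.trans (ENNReal.ofReal_le_ofReal hδ))
  intro ω hω
  by_contra hc
  refine hω ?_
  simp only [Set.mem_ofPred_eq, not_exists, not_lt] at hc
  refine isQuantization_of_empirical hα
    (fun v hv => continuousAt_widthCDF μ hμ hu hv)
    (G := fun q => (∑ j ∈ Finset.range m, below01 (width (Set.range (ω j)) u) q) / m) ?_ ?_
  · intro q
    have := hc q
    rw [← mul_le_mul_iff_left₀ hm0]
    calc _ = |(∑ j ∈ Finset.range m, below01 (width (Set.range (ω j)) u) q) / m -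
          widthCDF μ u q| * |(m : ℝ)| := by rw [abs_of_pos hm0]
      _ = |∑ j ∈ Finset.range m, below01 (width (Set.range (ω j)) u) q -
          m * (supportLaw μ).real {Q | width (Set.range Q) u ≤ q}| := by
        rw [← abs_mul, sub_mul, div_mul_cancel₀ _ hm0.ne', mul_comm (widthCDF μ u q)]
        rfl
      _ ≤ _ := this
  · intro x hx
    rw [widthFraction_eq]
    constructor
    · refine div_le_div_of_nonneg_right (Finset.sum_le_sum fun j hj => ?_) hm0.le
      exact below01_anti ((hK ω j (Finset.mem_range.1 hj)).width_le (Set.finite_range _) u) x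
    · refine div_le_div_of_nonneg_right (Finset.sum_le_sum fun j hj => ?_) hm0.le
      have hk := (hK ω j (Finset.mem_range.1 hj)).2.2 u hu
      unfold below01
      split_ifs with h1 h2 <;> try norm_num
      refine h2 ?_
      have : (1 - α / 2) * width (Set.range (ω j)) u ≤ x := by linarith
      have h3 : (1 - α / 2) * width (Set.range (ω j)) u ≤ (1 - α / 2) * ((1 + α) * x) := by
        refine this.trans ?_
        nlinarith [mul_nonneg hα hx, mul_nonneg (mul_nonneg hα hx) (sub_nonneg.2 hα1)]
      exact le_of_mul_le_mul_left h3 (by linarith)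

/-! ### The size of the parameters -/

theorem doublings_pos {δ : ℝ} (h0 : 0 < δ) (h1 : δ < 1) : 1 ≤ doublings δ := by
  by_contra h
  have := (doublings_le_iff h0 0).1 (by omega)
  rw [pow_zero, mul_one] at this
  linarith

/-- The `1` lost by rounding up is absorbed because `log (1/δ) ≥ log (1/δ₀) > 0`; this is why the
constant depends on `δ₀`. -/
theorem doublings_le {δ₀ δ : ℝ} (h1 : δ₀ < 1) (h : 0 < δ) (hδ : δ ≤ δ₀) :
    (doublings δ : ℝ) ≤ (1 / Real.log 2 + 1 / Real.log (1 / δ₀)) * Real.log (1 / δ) := by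
  have h0 : 0 < δ₀ := h.trans_le hδ
  have hl0 : 0 < Real.log (1 / δ₀) := Real.log_pos (one_lt_one_div h0 h1)
  have hl : Real.log (1 / δ₀) ≤ Real.log (1 / δ) :=
    Real.log_le_log (by positivity) (one_div_le_one_div_of_le h hδ)
  have hl2 : 0 < Real.log 2 := Real.log_pos one_lt_two
  have h2 : 0 ≤ Real.logb 2 (1 / δ) := div_nonneg (hl0.le.trans hl) hl2.le
  refine (Nat.ceil_lt_add_one h2).le.trans ?_
  have h3 : 1 ≤ 1 / Real.log (1 / δ₀) * Real.log (1 / δ) := by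
    rw [one_div, ← div_eq_inv_mul, le_div_iff₀ hl0]; linarith
  rw [add_mul, Real.logb, div_eq_mul_inv, one_div (Real.log 2), mul_comm]
  linarith

theorem rounds_le {δ₀ : ℝ} (h0 : 0 < δ₀) (h1 : δ₀ < 1) (A : ℕ) : ∃ c : ℝ, 0 ≤ c ∧
    ∀ ε δ : ℝ, 0 < ε → ε ≤ 1 → 0 < δ → δ ≤ δ₀ →
      (rounds A ε δ : ℝ) ≤ c * (1 / ε ^ 2 * Real.log (1 / δ)) := by
  have hl0 : 0 < Real.log (1 / δ₀) := Real.log_pos (one_lt_one_div h0 h1)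
  have hl2 : 0 < Real.log 2 := Real.log_pos one_lt_two
  refine ⟨A * (1 / Real.log 2 + 1 / Real.log (1 / δ₀)) + 1 / Real.log (1 / δ₀), by positivity,
    fun ε δ hε hε1 hδ hδ1 => ?_⟩
  have hl : Real.log (1 / δ₀) ≤ Real.log (1 / δ) :=
    Real.log_le_log (by positivity) (one_div_le_one_div_of_le hδ hδ1)
  have hε2 : 1 ≤ 1 / ε ^ 2 := by
    rw [le_div_iff₀ (by positivity), one_mul]
    exact pow_le_one₀ hε.le hε1
  have e1 : (⌊A * doublings δ / (ε * ε)⌋₊ : ℝ) ≤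
      A * ((1 / Real.log 2 + 1 / Real.log (1 / δ₀)) * Real.log (1 / δ)) * (1 / ε ^ 2) := by
    refine (Nat.floor_le (by positivity)).trans ?_
    rw [← sq, div_eq_mul_one_div]
    gcongr
    exact doublings_le h1 hδ hδ1
  have e2 : 1 ≤ 1 / Real.log (1 / δ₀) * (1 / ε ^ 2 * Real.log (1 / δ)) := by
    rw [one_div (Real.log _), ← div_eq_inv_mul, le_div_iff₀ hl0, one_mul]
    nlinarith
  have e3 : (rounds A ε δ : ℝ) = ⌊A * doublings δ / (ε * ε)⌋₊ + 1 := by simp [rounds]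
  rw [e3]
  linarith

theorem mul_doublings_le_rounds (A : ℕ) {ε : ℝ} (hε : 0 < ε) (δ : ℝ) :
    (A * doublings δ : ℝ) ≤ rounds A ε δ * ε ^ 2 := by
  have h : A * doublings δ / (ε * ε) ≤ rounds A ε δ := by
    unfold rounds
    push_cast
    exact (Nat.lt_floor_add_one _).le
  rwa [div_le_iff₀ (by positivity), ← sq] at h

theorem doublings_le_rounds {A : ℕ} (hA : 1 ≤ A) {ε : ℝ} (hε : 0 < ε) (hε1 : ε ≤ 1) (δ : ℝ) :
    doublings δ ≤ rounds A ε δ := by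
  have h := mul_doublings_le_rounds A hε δ
  have h2 : ε ^ 2 ≤ 1 := pow_le_one₀ hε.le hε1
  have h3 : (1 : ℝ) ≤ A := by exact_mod_cast hA
  have h4 : (doublings δ : ℝ) ≤ rounds A ε δ := by
    nlinarith [Nat.cast_nonneg (α := ℝ) (doublings δ), Nat.cast_nonneg (α := ℝ) (rounds A ε δ)]
  exact_mod_cast h4

/-- The exponent is at least `128 / 32 = 4` times the number of doublings: three of these four parts
absorb the `8`, the last one gives `2 ^ (-doublings δ) ≤ δ`. -/
theorem eight_mul_exp_le {ε δ : ℝ} (hε : 0 < ε) (hδ : 0 < δ) (hδ1 : δ < 1) :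
    8 * Real.exp (-(rounds 128 ε δ * ε ^ 2 / 32)) ≤ δ := by
  have h := mul_doublings_le_rounds 128 hε δ
  have hk : (1 : ℝ) ≤ doublings δ := by exact_mod_cast doublings_pos hδ hδ1
  have h2 := (doublings_le_iff hδ _).1 le_rfl
  have he : (2 : ℝ) ≤ Real.exp 1 := by linarith [Real.add_one_le_exp (1 : ℝ)]
  have h8 : 8 ≤ Real.exp (3 * doublings δ) := by
    calc (8 : ℝ) = 2 ^ 3 := by norm_num
      _ ≤ Real.exp 1 ^ 3 := by gcongr
      _ = Real.exp 3 := by rw [← Real.exp_nat_mul]; norm_num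
      _ ≤ _ := Real.exp_le_exp.2 (by linarith)
  have h3 : 2 ^ doublings δ ≤ Real.exp (doublings δ) := by
    calc (2 : ℝ) ^ doublings δ ≤ Real.exp 1 ^ doublings δ := by gcongr
      _ = _ := by rw [← Real.exp_nat_mul, mul_one]
  have h4 : Real.exp (-(rounds 128 ε δ * ε ^ 2 / 32)) ≤ Real.exp (-(4 * doublings δ)) := by
    refine Real.exp_le_exp.2 ?_
    push_cast at h
    linarith
  calc 8 * Real.exp (-(rounds 128 ε δ * ε ^ 2 / 32))
      ≤ Real.exp (3 * doublings δ) * Real.exp (-(4 * doublings δ)) := by gcongr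
    _ = (Real.exp (doublings δ))⁻¹ := by
      rw [← Real.exp_add, ← Real.exp_neg]
      congr 1
      ring
    _ ≤ (2 ^ doublings δ)⁻¹ := by gcongr
    _ ≤ δ := by
      rw [inv_le_iff_one_le_mul₀ (by positivity)]
      linarith

theorem gridSize_zero (α : ℝ) : gridSize 0 α = 1 := by simp [gridSize]

theorem gridSize_pow_le (D k : ℕ) : ∃ c : ℝ, 0 ≤ c ∧ ∀ α : ℝ, 0 < α → α ≤ 1 →
    (gridSize D α : ℝ) ^ k ≤ c * α ^ (-((k : ℝ) / 2)) := by
  refine ⟨(√((96 * D * 2 ^ D : ℕ)) + 1) ^ k, by positivity, fun α h0 h1 => ?_⟩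
  have ha : α ^ (-((k : ℝ) / 2)) = (1 / √α) ^ k := by
    rw [Real.rpow_neg h0.le, one_div, inv_pow, Real.sqrt_eq_rpow, ← Real.rpow_natCast,
      ← Real.rpow_mul h0.le]
    congr 2
    ring
  have hs : 1 ≤ 1 / √α := by
    rw [le_div_iff₀ (Real.sqrt_pos.2 h0), one_mul]
    exact Real.sqrt_le_one.2 h1
  rw [ha, ← mul_pow]
  refine pow_le_pow_left₀ (Nat.cast_nonneg _) ?_ k
  unfold gridSize
  push_cast
  refine (add_le_add_left (Nat.floor_le (Real.sqrt_nonneg _)) 1).trans ?_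
  rw [add_mul, one_mul, Real.sqrt_div (by positivity), mul_one_div]
  linarith

theorem list_length_le (D : ℕ) : ∃ c : ℝ, 0 ≤ c ∧ ∀ α : ℝ, 0 < α → α ≤ 1 →
    (gridSize D α : ℝ) ^ (max D 1) ≤ c * α ^ (-(((D + 1 : ℕ) : ℝ) - 1) / 2) := by
  rcases Nat.eq_zero_or_pos D with rfl | hD
  · exact ⟨1, zero_le_one, fun α _ _ => by simp [gridSize_zero]⟩
  · obtain ⟨c, hc, h⟩ := gridSize_pow_le D D
    refine ⟨c, hc, fun α h0 h1 => ?_⟩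
    rw [max_eq_left (by omega : 1 ≤ D)]
    convert h α h0 h1 using 3
    push_cast
    ring

/-- With `E` of order `α^(-1/2)` the exponent is `(2 * D - 1) / 2 = d - 3/2`. For `D = 0` this is
negative and the power of `α` gives no help; there `E = 1`, and `1 ≤ n` suffices. -/
theorem round_time_le (D : ℕ) : ∃ c : ℝ, 0 ≤ c ∧ ∀ α : ℝ, 0 < α → α ≤ 1 → ∀ n : ℕ, 1 ≤ n →
    ((n + gridSize D α ^ (2 * max D 1 - 1) : ℕ) : ℝ) ≤
      c * (n + α ^ (-(((D + 1 : ℕ) : ℝ) - 3 / 2))) := by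
  rcases Nat.eq_zero_or_pos D with rfl | hD
  · refine ⟨2, zero_le_two, fun α h0 h1 n hn => ?_⟩
    have := Real.rpow_nonneg h0.le (-(((0 + 1 : ℕ) : ℝ) - 3 / 2))
    have hn' : (1 : ℝ) ≤ n := by exact_mod_cast hn
    rw [gridSize_zero, one_pow]
    push_cast at this ⊢
    linarith
  · obtain ⟨c, hc, h⟩ := gridSize_pow_le D (2 * D - 1)
    refine ⟨1 + c, by linarith, fun α h0 h1 n hn => ?_⟩
    have h2 := h α h0 h1
    have e : -((2 * D - 1 : ℕ) : ℝ) / 2 = -(((D + 1 : ℕ) : ℝ) - 3 / 2) := by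
      rw [Nat.cast_sub (by omega)]
      push_cast
      ring
    rw [← neg_div, e] at h2
    rw [max_eq_left (by omega : 1 ≤ D)]
    have h3 := Real.rpow_nonneg h0.le (-(((D + 1 : ℕ) : ℝ) - 3 / 2))
    have hn' : (0 : ℝ) ≤ n := Nat.cast_nonneg n
    rw [Nat.cast_add, Nat.cast_pow]
    nlinarith [mul_nonneg hc hn']

end UncertainPoints

end

/-! ### The theorem -/

open UncertainPoints
theorem mainTheorem7 (d : ℕ) (hd : 1 ≤ d) :
    ∃ prog : Prog, ∀ δ₀ : ℝ, 0 < δ₀ → δ₀ < 1 → ∃ C : ℝ, 0 < C ∧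
      ∀ ε δ : ℝ, 0 < ε → ε ≤ 1 → 0 < δ → δ ≤ δ₀ →
      ∃ m : ℕ, 0 < m ∧ (m : ℝ) ≤ C * ((1 / ε ^ 2) * Real.log (1 / δ)) ∧
      ∀ α : ℝ, 0 < α → α ≤ 1 →
      ∀ (n : ℕ), 1 ≤ n →
      ∀ (μ : Fin n → Measure (Pt d)) [∀ i, IsProbabilityMeasure (μ i)],
      (∀ i, μ i ≪ volume) →
      ∃ (final : Draws d n → State d n) (time : Draws d n → ℕ),
        (∀ ω : Draws d n,
          Exec ω prog (initState d n ε δ α) (final ω) (time ω) ∧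
          (time ω : ℝ) ≤
            C * (((n : ℝ) + α ^ (-((d : ℝ) - 3 / 2))) * (1 / ε ^ 2) * Real.log (1 / δ)) ∧
          (final ω).outLen = m ∧
          (∀ j < m, IsKernel (α / 2) ((final ω).outSet j) (Set.range (ω j))) ∧
          ((∑ j ∈ Finset.range m, ((final ω).out j).length : ℕ) : ℝ) ≤
            C * (α ^ (-((d : ℝ) - 1) / 2) * (1 / ε ^ 2) * Real.log (1 / δ))) ∧
        IsProbKernel μ ε δ α m (fun ω j => (final ω).outSet j) := by
  obtain ⟨D, rfl⟩ : ∃ D, d = D + 1 := ⟨d - 1, by omega⟩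
  refine ⟨kernelP D 128, fun δ₀ hδ₀ hδ₀1 => ?_⟩
  obtain ⟨a, ha, hm⟩ := rounds_le hδ₀ hδ₀1 128
  obtain ⟨b, hb, hlen⟩ := list_length_le D
  obtain ⟨c, hc, htime⟩ := round_time_le D
  obtain ⟨T, hT⟩ : ∃ T : ℕ, T = (kernelP D 128).bnd (D + 1) * (3002 * (D + 2) ^ 2 + 13) := ⟨_, rfl⟩
  refine ⟨T * a * c + a + (D + 1) * 2 * b * a + 1, by positivity,
    fun ε δ hε hε1 hδ hδδ₀ => ?_⟩
  have hδ1 : δ < 1 := hδδ₀.trans_lt hδ₀1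
  have hX : 0 ≤ 1 / ε ^ 2 * Real.log (1 / δ) :=
    mul_nonneg (by positivity) (Real.log_nonneg (one_le_one_div hδ hδ1.le))
  have hm := hm ε δ hε hε1 hδ hδδ₀
  set X := 1 / ε ^ 2 * Real.log (1 / δ) with hXdef
  have p1 : 0 ≤ (T : ℝ) * a * c := by positivity
  have p2 : 0 ≤ ((D : ℝ) + 1) * 2 * b * a := by positivity
  refine ⟨rounds 128 ε δ, Nat.succ_pos _, hm.trans (mul_le_mul_of_nonneg_right (by linarith) hX),
    fun α hα hα1 n hn μ _ hμ => ?_⟩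
  have hne : Nonempty (Fin n) := ⟨⟨0, hn⟩⟩
  -- The run is analysed for each outcome separately; probability enters only in the last claim.
  have key := fun ω : Draws (D + 1) n =>
    wp_kernelP (D := D) (A := 128) (ω := ω) (ε := ε) hδ hα hα1 hn
  choose final k hrun hl hK hk using key
  choose time hexec ht using hrun
  have hK1 : ∀ ω, ∀ j < rounds 128 ε δ,
      IsKernel (α / 2) ((final ω).st.outSet j) (Set.range (ω j)) := fun ω j hj => (hK ω j hj).1
  refine ⟨fun ω => (final ω).st, time, fun ω => ⟨initMem_st D n ε δ α ▸ hexec ω, ?_, hl ω,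
    hK1 ω, ?_⟩, ?_⟩
  · set G := n + gridSize D α ^ (2 * max D 1 - 1) with hG
    have hG1 : 1 ≤ G := hn.trans (Nat.le_add_right _ _)
    have e0 : 1 ≤ rounds 128 ε δ := Nat.succ_pos _
    have e1 : rounds 128 ε δ ≤ rounds 128 ε δ * G := Nat.le_mul_of_pos_right _ hG1
    have e2 := doublings_le_rounds (A := 128) (by norm_num) hε hε1 δ
    -- The setup takes `10 + 3 * doublings δ` ticks, at most `13` per round since there are at least
    -- as many rounds as doublings.
    have e3 : k ω ≤ (3002 * (D + 2) ^ 2 + 13) * (rounds 128 ε δ * G) := by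
      have h1 := hk ω
      have h2 : (3002 * (D + 2) ^ 2 + 13) * (rounds 128 ε δ * G) =
        rounds 128 ε δ * (3002 * (D + 2) ^ 2 * G) + 13 * (rounds 128 ε δ * G) := by ring
      omega
    have e4 : time ω ≤ T * (rounds 128 ε δ * G) := by
      refine (ht ω).trans ((Nat.mul_le_mul_left _ e3).trans (le_of_eq ?_))
      rw [hT]; ring
    have e5 := htime α hα hα1 n hn
    rw [← hG] at e5
    set Y := (n : ℝ) + α ^ (-(((D + 1 : ℕ) : ℝ) - 3 / 2)) with hY
    have hY0 : 0 ≤ Y := add_nonneg (Nat.cast_nonneg _) (Real.rpow_nonneg hα.le _)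
    calc (time ω : ℝ) ≤ T * (rounds 128 ε δ * G) := by exact_mod_cast e4
      _ ≤ T * ((a * X) * (c * Y)) := by gcongr
      _ = T * a * c * (Y * X) := by ring
      _ ≤ (T * a * c + a + (D + 1) * 2 * b * a + 1) * (Y * X) :=
        mul_le_mul_of_nonneg_right (by linarith) (mul_nonneg hY0 hX)
      _ = _ := by rw [hXdef]; ring
  · have e1 : ∑ j ∈ Finset.range (rounds 128 ε δ), ((final ω).out j).length ≤
        rounds 128 ε δ * ((D + 1) * (2 * gridSize D α ^ (max D 1))) := by
      refine (Finset.sum_le_card_nsmul _ _ _ fun j hj =>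
        (hK ω j (Finset.mem_range.1 hj)).2).trans (le_of_eq ?_)
      rw [Finset.card_range, smul_eq_mul]
    have e2 := hlen α hα hα1
    set Z := α ^ (-(((D + 1 : ℕ) : ℝ) - 1) / 2) with hZ
    have hZ0 : 0 ≤ Z := Real.rpow_nonneg hα.le _
    calc ((∑ j ∈ Finset.range (rounds 128 ε δ), ((final ω).out j).length : ℕ) : ℝ)
        ≤ rounds 128 ε δ * ((D + 1) * (2 * gridSize D α ^ (max D 1))) := by exact_mod_cast e1
      _ ≤ (a * X) * ((D + 1) * (2 * (b * Z))) := by gcongr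
      _ = (D + 1) * 2 * b * a * (Z * X) := by ring
      _ ≤ (T * a * c + a + (D + 1) * 2 * b * a + 1) * (Z * X) :=
        mul_le_mul_of_nonneg_right (by linarith) (mul_nonneg hZ0 hX)
      _ = _ := by rw [hXdef]; ring
  · refine isProbKernel_of_isKernel μ hμ hε hα.le hα1 ?_ (eight_mul_exp_le hε hδ hδ1) hK1
    have h1 := mul_doublings_le_rounds 128 hε δ
    have h2 : (1 : ℝ) ≤ doublings δ := by exact_mod_cast doublings_pos hδ hδ1
    push_cast at h1
    linarith
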